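/- Let $G=(V,E,A)$ be a finite mixed graph with a set $E\subseteq\binom V2$ of undirected edges and a set $A\subseteq V\times V$ of arcs; $G$ is unweighted, i.e. every edge has weight $1$. A path is a sequence $v_1,\dots,v_m$ of pairwise distinct vertices with $\{v_i,v_{i+1}\}\in E$ or $(v_i,v_{i+1})\in A$ for all $i<m$. Let $\mathcal T=((s_1,t_1),\dots,(s_k,t_k))$ be a family of terminal pairs in $V\times V$. A solution is a family $\mathcal P=(P_1,\dots,P_k)$ in which $P_i$ is an $s_i$–$t_i$ path; its cost is $$\mathrm{cost}(\mathcal P)=\sum_{\{u,v\}\in E}x_{uv}\,x_{vu},$$ where $x_{uv}$ is the number of indices $i$ such that $u$ is immediately followed by $v$ in $P_i$. The vertex cover number $\mathrm{vc}(G)$ is the least size of a set of vertices that contains an endpoint of every edge and of every arc joining two distinct vertices. Theorem. There are an algorithm, a computable function $f:\mathbb N\to\mathbb N$ and a constant $c$ such that, for every instance $(G,\mathcal T)$ as above that has at least one solution and in which no vertex appears in more than one terminal pair, the algorithm computes a solution of minimum cost in at most $f(\mathrm{vc}(G))\cdot N^{c}$ steps, where $N$ is the size of the input. In other words, a minimum-cost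 solution of such instances of Crossing Cost Multi-Agent Routing (CC-MAR) can be computed in FPT time when parameterized by $\mathrm{vc}(G)$ alone. Here algorithms are random access machine programs over the natural numbers with additions and truncated subtractions, every operation counting as one step; the instance is given by $|V|$, $k$, the adjacency matrices of $E$ and $A$ and the list of terminal pairs, and $N$ is the length of this list of numbers. -/

import Mathlib

/-! ## Random access machines with a step count

Programs of a random access machine over the natural numbers, in structured form.  The arithmetic
is addition and truncated subtraction (no multiplication), so that counting every operation as one
step is polynomially equivalent to the running time of Turing machines. -/

namespace RAM

/-- A memory: registers `reg 0, reg 1, …` and arrays `arr 0, arr 1, …` of natural numbers.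
A program names registers and arrays by constants, array cells are addressed by computed indices. -/
structure State where
  reg : ℕ → ℕ
  arr : ℕ → ℕ → ℕ

inductive Expr where
  | const (c : ℕ)
  | reg (r : ℕ)
  | read (a : ℕ) (i : Expr)
  | add (x y : Expr)
  | sub (x y : Expr)

/-- The value of an expression; `sub` is truncated subtraction. -/
def Expr.eval (s : State) : Expr → ℕ
  | .const c => c
  | .reg r => s.reg r
  | .read a i => s.arr a (i.eval s)
  | .add x y => x.eval s + y.eval s
  | .sub x y => x.eval s - y.eval s

/-- The number of elementary operations made in evaluating an expression. -/
def Expr.cost : Expr → ℕ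
  | .const _ => 1
  | .reg _ => 1
  | .read _ i => i.cost + 1
  | .add x y => x.cost + y.cost + 1
  | .sub x y => x.cost + y.cost + 1

/-- Programs.  `assign r x` is `reg r := x`, `write a i x` is `arr a [i] := x`,
`branch b p q` runs `p` if `b ≠ 0` and `q` if `b = 0`, and `loop b p` repeats `p` while `b ≠ 0`. -/
inductive Program where
  | skip
  | assign (r : ℕ) (x : Expr)
  | write (a : ℕ) (i x : Expr)
  | seq (p q : Program)
  | branch (b : Expr) (p q : Program)
  | loop (b : Expr) (p : Program)

def State.setReg (s : State) (r v : ℕ) : State :=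
  { s with reg := Function.update s.reg r v }

def State.setArr (s : State) (a i v : ℕ) : State :=
  { s with arr := Function.update s.arr a (Function.update (s.arr a) i v) }

/-- `Exec p s t s'`: the program `p`, started in `s`, halts in `s'` after exactly `t` steps. -/
inductive Exec : Program → State → ℕ → State → Prop where
  | skip (s : State) : Exec .skip s 1 s
  | assign (s : State) (r : ℕ) (x : Expr) :
      Exec (.assign r x) s (x.cost + 1) (s.setReg r (x.eval s))
  | write (s : State) (a : ℕ) (i x : Expr) :
      Exec (.write a i x) s (i.cost + x.cost + 1) (s.setArr a (i.eval s) (x.eval s))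
  | seq {p q : Program} {s s₁ s₂ : State} {t₁ t₂ : ℕ} :
      Exec p s t₁ s₁ → Exec q s₁ t₂ s₂ → Exec (.seq p q) s (t₁ + t₂) s₂
  | branch_pos {b : Expr} {p q : Program} {s s' : State} {t : ℕ} :
      b.eval s ≠ 0 → Exec p s t s' → Exec (.branch b p q) s (b.cost + 1 + t) s'
  | branch_zero {b : Expr} {p q : Program} {s s' : State} {t : ℕ} :
      b.eval s = 0 → Exec q s t s' → Exec (.branch b p q) s (b.cost + 1 + t) s'
  | loop_pos {b : Expr} {p : Program} {s s₁ s₂ : State} {t₁ t₂ : ℕ} :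
      b.eval s ≠ 0 → Exec p s t₁ s₁ → Exec (.loop b p) s₁ t₂ s₂ →
      Exec (.loop b p) s (b.cost + 1 + t₁ + t₂) s₂
  | loop_zero {b : Expr} {p : Program} {s : State} :
      b.eval s = 0 → Exec (.loop b p) s (b.cost + 1) s

/-- The initial state: the input word stands in array `0`, its length in register `0`, and
everything else is zero. -/
def State.init (w : List ℕ) : State where
  reg r := if r = 0 then w.length else 0
  arr a i := if a = 0 then w.getD i 0 else 0

/-- The output word of a final state: it stands in array `1`, its length in register `1`. -/
def State.output (s : State) : List ℕ :=
  (List.range (s.reg 1)).map (s.arr 1)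

end RAM

/-- The search problem "given `x : I` with `promise x`, find some `y` with `IsAnswer x y`" is solved
in FPT time with respect to the parameter `param`: one program, one computable function `f` and one
exponent `c` serve all inputs, and the program halts within `f (param x) * |x| ^ c` steps with an
encoding of an answer, where `|x|` is the length of the encoding of `x`. -/
def SolvableInFPTTime {I : Type} {O : I → Type} (encIn : I → List ℕ)
    (encOut : (x : I) → O x → List ℕ) (param : I → ℕ) (promise : I → Prop)
    (IsAnswer : (x : I) → O x → Prop) : Prop :=
  ∃ (p : RAM.Program) (f : ℕ → ℕ) (c : ℕ), Computable f ∧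
    ∀ x : I, promise x →
      ∃ (t : ℕ) (s : RAM.State) (y : O x),
        RAM.Exec p (RAM.State.init (encIn x)) t s ∧
        t ≤ f (param x) * (encIn x).length ^ c ∧
        s.output = encOut x y ∧ IsAnswer x y

/-! ## Crossing Cost Multi-Agent Routing on unweighted mixed graphs -/

/-- A mixed graph on `V`: a set of undirected edges (2-element subsets of `V`) and a set of
arcs (ordered pairs). -/
structure MixedGraph (V : Type) where
  edges : SimpleGraph V
  arc : V → V → Prop

namespace MixedGraph

variable {V : Type}

/-- One step of a path: along an edge in either direction, or along an arc. -/
def Step (G : MixedGraph V) (u v : V) : Prop := G.edges.Adj u v ∨ G.arc u v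

/-- `p` is a path from `s` to `t`: a sequence of pairwise distinct vertices that starts in `s`,
ends in `t`, and whose consecutive vertices are joined by an edge or by a forward arc. -/
def IsPath (G : MixedGraph V) (s t : V) (p : List V) : Prop :=
  p.head? = some s ∧ p.getLast? = some t ∧ p.Nodup ∧ p.IsChain G.Step

/-- The underlying graph: two distinct vertices are adjacent if an edge or an arc, in either
direction, joins them. -/
def underlying (G : MixedGraph V) : SimpleGraph V := SimpleGraph.fromRel G.Step

/-- The vertex cover number: the least size of a set of vertices that meets all edges and arcs. -/
noncomputable def vc (G : MixedGraph V) : ℕ := G.underlying.vertexCoverNum.toNat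

end MixedGraph

/-- An instance of unweighted CC-MAR: a mixed graph with vertices `0, …, n - 1` and a family
of `k` terminal pairs, agent `i` having source `src i` and destination `dst i`. -/
structure CCMAR where
  n : ℕ
  graph : MixedGraph (Fin n)
  k : ℕ
  src : Fin k → Fin n
  dst : Fin k → Fin n

namespace CCMAR

/-- A strategy profile assigns a sequence of vertices to every agent. -/
abbrev Profile (Γ : CCMAR) : Type := Fin Γ.k → List (Fin Γ.n)

/-- A feasible solution: each agent takes a path from its source to its destination. -/
def IsSolution (Γ : CCMAR) (P : Γ.Profile) : Prop :=
  ∀ i, Γ.graph.IsPath (Γ.src i) (Γ.dst i) (P i)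

def Feasible (Γ : CCMAR) : Prop := ∃ P : Γ.Profile, Γ.IsSolution P

/-- The number of agents that go from `u` immediately to `v`. -/
noncomputable def load (Γ : CCMAR) (P : Γ.Profile) (u v : Fin Γ.n) : ℕ :=
  Nat.card {i : Fin Γ.k // [u, v] <:+: P i}

open Classical in
/-- The total crossing cost: the sum of `x_{uv} * x_{vu}` over the undirected edges `{u, v}`. -/
noncomputable def cost (Γ : CCMAR) (P : Γ.Profile) : ℕ :=
  ∑ e ∈ Γ.graph.edges.edgeFinset,
    Sym2.lift ⟨fun u v => Γ.load P u v * Γ.load P v u, fun _ _ => Nat.mul_comm _ _⟩ e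

/-- A minimum-cost solution. -/
def IsOptimal (Γ : CCMAR) (P : Γ.Profile) : Prop :=
  Γ.IsSolution P ∧ ∀ Q : Γ.Profile, Γ.IsSolution Q → Γ.cost P ≤ Γ.cost Q

/-- No vertex appears in more than one terminal pair. -/
def NoOverlap (Γ : CCMAR) : Prop :=
  ∀ (v : Fin Γ.n) (i j : Fin Γ.k),
    (v = Γ.src i ∨ v = Γ.dst i) → (v = Γ.src j ∨ v = Γ.dst j) → i = j

open Classical in
/-- An instance as an input word: `n`, `k`, the two adjacency matrices row by row, and the list of
terminal pairs. -/
noncomputable def encode (Γ : CCMAR) : List ℕ :=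
  [Γ.n, Γ.k] ++
  (List.finRange Γ.n).flatMap (fun u =>
    (List.finRange Γ.n).map fun v => if Γ.graph.edges.Adj u v then 1 else 0) ++
  (List.finRange Γ.n).flatMap (fun u =>
    (List.finRange Γ.n).map fun v => if Γ.graph.arc u v then 1 else 0) ++
  (List.finRange Γ.k).flatMap (fun i => [(Γ.src i : ℕ), (Γ.dst i : ℕ)])

/-- A strategy profile as an output word: for each agent in turn, the number of vertices of its
path followed by these vertices. -/
def encodeProfile (Γ : CCMAR) (P : Γ.Profile) : List ℕ :=
  (List.finRange Γ.k).flatMap fun i => (P i).length :: (P i).map Fin.val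

end CCMAR

/-! ## Total correctness with a time bound -/

/-! Vertices in no terminal pair are paired with themselves, so every vertex lies in exactly one
pair, and twice the cost is a sum of pairwise crossing numbers of paths (`Net.cost2_eq`). Two pairs
belong to the same class if corresponding terminals have equal neighbourhoods and both or neither of
the pairs are degenerate. Let `C` be a vertex cover of size `c`. An optimal family is normalised in
three ways.

Few inner vertices (`exists_opt_used_le`): an inner vertex outside `C` sits between two vertices
`a`, `b` of `C` and may be replaced by any vertex that fits between them and is not on the path. In
an optimal family with least sum of labels, the path through the worst vertex between `a` and `b`
contains all vertices used between `a` and `b`. Paths have at most `2 * c + 1` vertices, so the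
number of inner vertices is bounded in terms of `c`.

Hubs (`exists_opt_hub`): let `K` exceed this bound. Exchanging two pairs of a class is a symmetry,
so all inner vertices can be moved to the first `K` pairs of their classes.

Uniformity (`exists_opt_uniform`): the terminals of the remaining pairs are inner vertices of no
path, so what such a path pays depends on its inner part alone. Within a class all these pairs copy
the cheapest inner part, and the copies do not cross each other.

An optimum is thus determined by the inner parts of at most `K + 1` pairs per class. These are the
digits of a number below a bound depending on `c` (`exists_cert`, `numCert_le`), and all such
numbers are tried (`opt_cert`). Instead of a minimum cover, one that is found in polynomial time is
used; its size is at most `v + v * v` where `v` is the vertex cover number (`covNum_le_of_cover`).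

For the running time, every quantity is written with bounded sums, comparisons and indicators.
Closure properties of `Ev` turn such expressions into programs that are polynomial in a bound `Z` on
the loop lengths, here a polynomial in the input plus the number of certificates. Only the powers of
the base need recursion; they are tabulated by `exists_fill`. -/

namespace RAM

/-- Started in `s`, the program `p` halts within `T` steps in a state satisfying `Q`. -/
def Runs (p : Program) (s : State) (T : ℕ) (Q : State → Prop) : Prop :=
  ∃ t s', Exec p s t s' ∧ t ≤ T ∧ Q s'

theorem Runs.mono {p : Program} {s : State} {T T' : ℕ} {Q Q' : State → Prop}
    (h : Runs p s T Q) (hT : T ≤ T') (hQ : ∀ s', Q s' → Q' s') : Runs p s T' Q' := by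
  obtain ⟨t, s', he, ht, hq⟩ := h
  exact ⟨t, s', he, ht.trans hT, hQ _ hq⟩

theorem Runs.seq {p q : Program} {s : State} {T₁ T₂ : ℕ} {Q R : State → Prop}
    (hp : Runs p s T₁ Q) (hq : ∀ s', Q s' → Runs q s' T₂ R) :
    Runs (.seq p q) s (T₁ + T₂) R := by
  obtain ⟨t, s', he, ht, h⟩ := hp
  obtain ⟨t', s'', he', ht', h'⟩ := hq _ h
  exact ⟨_, _, .seq he he', by omega, h'⟩

theorem Runs.assign {s : State} {r : ℕ} {x : Expr} {Q : State → Prop}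
    (h : Q (s.setReg r (x.eval s))) : Runs (.assign r x) s (x.cost + 1) Q :=
  ⟨_, _, .assign s r x, le_rfl, h⟩

theorem Runs.write {s : State} {a : ℕ} {i x : Expr} {Q : State → Prop}
    (h : Q (s.setArr a (i.eval s) (x.eval s))) :
    Runs (.write a i x) s (i.cost + x.cost + 1) Q :=
  ⟨_, _, .write s a i x, le_rfl, h⟩

theorem Runs.branch {s : State} {b : Expr} {p q : Program} {T : ℕ} {Q : State → Prop}
    (hp : b.eval s ≠ 0 → Runs p s T Q) (hq : b.eval s = 0 → Runs q s T Q) :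
    Runs (.branch b p q) s (b.cost + 1 + T) Q := by
  by_cases hb : b.eval s = 0
  · obtain ⟨t, s', he, ht, h⟩ := hq hb
    exact ⟨_, _, .branch_zero hb he, by omega, h⟩
  · obtain ⟨t, s', he, ht, h⟩ := hp hb
    exact ⟨_, _, .branch_pos hb he, by omega, h⟩

/-- The invariant is indexed by the number of finished rounds, and the guard holds exactly while
this number is below `m`. The last summand pays for the final, failing test. -/
theorem Runs.loop {b : Expr} {p : Program} {T m : ℕ} (I : ℕ → State → Prop)
    (hb : ∀ j s, I j s → (b.eval s ≠ 0 ↔ j < m))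
    (hp : ∀ j s, j < m → I j s → Runs p s T (I (j + 1))) {s : State} (h0 : I 0 s) :
    Runs (.loop b p) s (m * (T + b.cost + 1) + (b.cost + 1)) (I m) := by
  have key : ∀ e j s, j + e = m → I j s →
      Runs (.loop b p) s (e * (T + b.cost + 1) + (b.cost + 1)) (I m) := by
    intro e
    induction e with
    | zero =>
      intro j s hj hI
      have hbz : b.eval s = 0 := by
        by_contra h
        have := (hb j s hI).1 h
        omega
      obtain rfl : j = m := by omega
      exact ⟨_, _, .loop_zero hbz, by omega, hI⟩
    | succ e ih =>
      intro j s hj hI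
      have hjm : j < m := by omega
      obtain ⟨t, s', he, ht, h⟩ := hp j s hjm hI
      obtain ⟨t', s'', he', ht', h'⟩ := ih (j + 1) s' (by omega) h
      refine ⟨_, _, .loop_pos ((hb j s hI).2 hjm) he he', ?_, h'⟩
      rw [Nat.succ_mul]
      omega
  exact key m 0 s (by omega) h0

@[simp] theorem State.setReg_arr (s : State) (r v : ℕ) : (s.setReg r v).arr = s.arr := rfl

@[simp] theorem State.setReg_reg (s : State) (r v : ℕ) :
    (s.setReg r v).reg = Function.update s.reg r v := rfl

@[simp] theorem State.setArr_reg (s : State) (a i v : ℕ) : (s.setArr a i v).reg = s.reg := rfl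

@[simp] theorem State.setArr_arr (s : State) (a i v : ℕ) :
    (s.setArr a i v).arr = Function.update s.arr a (Function.update (s.arr a) i v) := rfl

/-! ## Functions computable in polynomial time -/

section Poly

variable {α : Type} {Rep : α → (ℕ → ℕ → ℕ) → Prop} {Z : α → ℕ}

/-- On arrays that represent `a` in the sense of `Rep`, a function of `a` and of the registers
below `d` is evaluated, without changing arrays or registers below the target register `d' ≥ d`,
in time polynomial in `Z a`. -/
def Ev (Rep : α → (ℕ → ℕ → ℕ) → Prop) (Z : α → ℕ) (d : ℕ) (x : α → (ℕ → ℕ) → ℕ) : Prop :=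
  (∀ a ρ ρ', (∀ r < d, ρ r = ρ' r) → x a ρ = x a ρ') ∧
  ∀ d' ≥ d, ∃ p C, ∀ a s, Rep a s.arr → Runs p s ((Z a + 2) ^ C) fun s' =>
    s'.arr = s.arr ∧ s'.reg d' = x a s.reg ∧ ∀ r < d', s'.reg r = s.reg r

/-- Since the base is at least `2`, constants, sums and products of time bounds can be absorbed into
the exponent, and only exponents have to be tracked. -/
theorem le_pow_add_two (z c : ℕ) : c ≤ (z + 2) ^ c :=
  (Nat.lt_pow_self (by omega)).le

theorem add_le_pow_add_two {z t₁ t₂ c₁ c₂ : ℕ} (h₁ : t₁ ≤ (z + 2) ^ c₁) (h₂ : t₂ ≤ (z + 2) ^ c₂) :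
    t₁ + t₂ ≤ (z + 2) ^ (c₁ + c₂ + 1) := by
  have e₁ : (z + 2) ^ c₁ ≤ (z + 2) ^ (c₁ + c₂) := Nat.pow_le_pow_right (by omega) (by omega)
  have e₂ : (z + 2) ^ c₂ ≤ (z + 2) ^ (c₁ + c₂) := Nat.pow_le_pow_right (by omega) (by omega)
  rw [pow_succ]
  nlinarith [Nat.zero_le ((z + 2) ^ (c₁ + c₂))]

theorem mul_le_pow_add_two {z t₁ t₂ c₁ c₂ : ℕ} (h₁ : t₁ ≤ (z + 2) ^ c₁) (h₂ : t₂ ≤ (z + 2) ^ c₂) :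
    t₁ * t₂ ≤ (z + 2) ^ (c₁ + c₂) := by
  rw [pow_add]
  exact Nat.mul_le_mul h₁ h₂

theorem Ev.mono {d D : ℕ} {x : α → (ℕ → ℕ) → ℕ} (h : Ev Rep Z d x) (hd : d ≤ D) :
    Ev Rep Z D x :=
  ⟨fun a ρ ρ' hρ => h.1 a ρ ρ' fun r hr => hρ r (by omega),
    fun d' hd' => h.2 d' (by omega)⟩

theorem Ev.congr {d : ℕ} {x y : α → (ℕ → ℕ) → ℕ} (h : Ev Rep Z d x) (e : ∀ a ρ, x a ρ = y a ρ) :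
    Ev Rep Z d y := by
  obtain rfl : x = y := by
    funext a ρ
    exact e a ρ
  exact h

theorem Ev.const {d : ℕ} (c : ℕ) : Ev Rep Z d fun _ _ => c := by
  refine ⟨fun _ _ _ _ => rfl, fun d' _ => ⟨.assign d' (.const c), 2, fun a s _ => ?_⟩⟩
  refine (Runs.assign (Q := fun s' => _) ?_).mono (le_pow_add_two _ _) fun _ h => h
  refine ⟨rfl, by simp [Expr.eval], fun r hr => ?_⟩
  simp [Function.update_of_ne hr.ne]

theorem Ev.var {d r : ℕ} (hr : r < d) : Ev Rep Z d fun _ ρ => ρ r := by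
  refine ⟨fun _ _ _ h => h r hr, fun d' _ => ⟨.assign d' (.reg r), 2, fun a s _ => ?_⟩⟩
  refine (Runs.assign (Q := fun s' => _) ?_).mono (le_pow_add_two _ _) fun _ h => h
  refine ⟨rfl, by simp [Expr.eval], fun r hr => ?_⟩
  simp [Function.update_of_ne hr.ne]

/-- Reading a cell of an array where a condition holds; `y` gives the value in terms of `a`. -/
theorem Ev.readIf {d : ℕ} (A : ℕ) {b x y : α → (ℕ → ℕ) → ℕ} (hb : Ev Rep Z d b)
    (hx : Ev Rep Z d x) (hy : ∀ a ρ arr, Rep a arr → b a ρ ≠ 0 → arr A (x a ρ) = y a ρ)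
    (hl : ∀ a ρ ρ', (∀ r < d, ρ r = ρ' r) → y a ρ = y a ρ') :
    Ev Rep Z d fun a ρ => if b a ρ ≠ 0 then y a ρ else 0 := by
  refine ⟨fun a ρ ρ' h => by simp only [hb.1 a ρ ρ' h, hl a ρ ρ' h], fun d' hd' => ?_⟩
  obtain ⟨p, C, hp⟩ := hb.2 d' hd'
  obtain ⟨q, D, hq⟩ := hx.2 d' hd'
  refine ⟨.seq p (.branch (.reg d') (.seq q (.assign d' (.read A (.reg d'))))
    (.assign d' (.const 0))), C + (2 + (D + 3 + 1) + 1) + 1, fun a s hs => ?_⟩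
  refine ((hp a s hs).seq (R := fun s' => _) fun s' h => Runs.branch (fun hb => ?_)
    (fun hb => ?_)).mono (add_le_pow_add_two le_rfl (add_le_pow_add_two (le_pow_add_two _ 2)
      (add_le_pow_add_two (t₁ := (Z a + 2) ^ D) le_rfl (le_pow_add_two _ 3)))) fun _ h => h
  · obtain ⟨h1, h2, h3⟩ := h
    refine (hq a s' (by rw [h1]; exact hs)).seq (T₂ := 3) fun s'' h' => Runs.assign ?_
    obtain ⟨k1, k2, k3⟩ := h'
    refine ⟨k1.trans h1, ?_, fun r hr => ?_⟩
    · have hb' : b a s.reg ≠ 0 := by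
        rw [← h2]
        exact hb
      simp only [State.setReg_reg, Function.update_self, Expr.eval, k1, k2, h1]
      rw [if_pos hb', hx.1 a s'.reg s.reg fun r hr => h3 r (by omega)]
      exact hy a s.reg s.arr hs hb'
    · simp [Function.update_of_ne hr.ne, k3 r hr, h3 r hr]
  · obtain ⟨h1, h2, h3⟩ := h
    refine (Runs.assign ?_).mono (T := 2) (by omega) fun _ h => h
    refine ⟨h1, ?_, fun r hr => ?_⟩
    · have hb' : ¬b a s.reg ≠ 0 := by
        rw [← h2]
        exact fun h => h hb
      simp [if_neg hb', Expr.eval]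
    · simp [Function.update_of_ne hr.ne, h3 r hr]

theorem Ev.read {d : ℕ} (A : ℕ) {x y : α → (ℕ → ℕ) → ℕ} (hx : Ev Rep Z d x)
    (hy : ∀ a ρ arr, Rep a arr → arr A (x a ρ) = y a ρ)
    (hl : ∀ a ρ ρ', (∀ r < d, ρ r = ρ' r) → y a ρ = y a ρ') : Ev Rep Z d y :=
  (Ev.readIf A (Ev.const 1) hx (fun a ρ arr h _ => hy a ρ arr h) hl).congr fun _ _ =>
    if_pos one_ne_zero

/-- The second operand is evaluated into register `d' + 1`, so the first one survives in `d'`. This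
nesting is why `Ev` asks for arbitrary target registers. -/
theorem Ev.binop {d : ℕ} {x y : α → (ℕ → ℕ) → ℕ} (hx : Ev Rep Z d x) (hy : Ev Rep Z d y)
    (op : Expr → Expr → Expr) (o : ℕ → ℕ → ℕ)
    (hop : ∀ s e e', (op e e').eval s = o (e.eval s) (e'.eval s))
    (hc : ∀ r r', (op (.reg r) (.reg r')).cost = 3) :
    Ev Rep Z d fun a ρ => o (x a ρ) (y a ρ) := by
  refine ⟨fun a ρ ρ' h => by simp only [hx.1 a ρ ρ' h, hy.1 a ρ ρ' h], fun d' hd' => ?_⟩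
  obtain ⟨p, C, hp⟩ := hx.2 d' hd'
  obtain ⟨q, D, hq⟩ := hy.2 (d' + 1) (by omega)
  refine ⟨.seq p (.seq q (.assign d' (op (.reg d') (.reg (d' + 1))))), C + (D + 4 + 1) + 1,
    fun a s hs => ?_⟩
  refine ((hp a s hs).seq (R := fun s' => _) fun s' h =>
    ((hq a s' (by rw [h.1]; exact hs)).seq (T₂ := 4) (R := fun s' => _) fun s'' h' =>
      (Runs.assign ?_).mono (by rw [hc]) fun _ h => h)).mono
    (add_le_pow_add_two le_rfl (add_le_pow_add_two le_rfl (le_pow_add_two _ 4))) fun _ h => h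
  obtain ⟨h1, h2, h3⟩ := h
  obtain ⟨h1', h2', h3'⟩ := h'
  refine ⟨h1'.trans h1, ?_, fun r hr => ?_⟩
  · simp only [State.setReg_reg, Function.update_self, hop, Expr.eval, h2']
    rw [h3' d' (by omega), h2, hy.1 a s'.reg s.reg fun r hr => h3 r (by omega)]
  · simp [Function.update_of_ne hr.ne, h3' r (by omega), h3 r hr]

theorem Ev.add {d : ℕ} {x y : α → (ℕ → ℕ) → ℕ} (hx : Ev Rep Z d x) (hy : Ev Rep Z d y) :
    Ev Rep Z d fun a ρ => x a ρ + y a ρ :=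
  hx.binop hy .add (· + ·) (fun _ _ _ => rfl) fun _ _ => rfl

theorem Ev.sub {d : ℕ} {x y : α → (ℕ → ℕ) → ℕ} (hx : Ev Rep Z d x) (hy : Ev Rep Z d y) :
    Ev Rep Z d fun a ρ => x a ρ - y a ρ :=
  hx.binop hy .sub (· - ·) (fun _ _ _ => rfl) fun _ _ => rfl

theorem Ev.cond {d : ℕ} {b x y : α → (ℕ → ℕ) → ℕ} (hb : Ev Rep Z d b) (hx : Ev Rep Z d x)
    (hy : Ev Rep Z d y) : Ev Rep Z d fun a ρ => if b a ρ ≠ 0 then x a ρ else y a ρ := by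
  refine ⟨fun a ρ ρ' h => by simp only [hb.1 a ρ ρ' h, hx.1 a ρ ρ' h, hy.1 a ρ ρ' h], fun d' hd' => ?_⟩
  obtain ⟨p, C, hp⟩ := hb.2 d' hd'
  obtain ⟨q, D, hq⟩ := hx.2 d' hd'
  obtain ⟨q', D', hq'⟩ := hy.2 d' hd'
  refine ⟨.seq p (.branch (.reg d') q q'), C + (2 + (D + D' + 1) + 1) + 1, fun a s hs => ?_⟩
  refine ((hp a s hs).seq (R := fun s' => _) fun s' h => Runs.branch (fun hb => ?_)
    (fun hb => ?_)).mono (add_le_pow_add_two le_rfl (add_le_pow_add_two (le_pow_add_two _ 2)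
      (add_le_pow_add_two (t₁ := (Z a + 2) ^ D) (t₂ := (Z a + 2) ^ D') le_rfl le_rfl)))
      fun _ h => h
  · obtain ⟨h1, h2, h3⟩ := h
    refine (hq a s' (by rw [h1]; exact hs)).mono (by omega) fun s'' h' => ⟨h'.1.trans h1, ?_,
      fun r hr => (h'.2.2 r hr).trans (h3 r hr)⟩
    rw [h'.2.1, hx.1 a s'.reg s.reg fun r hr => h3 r (by omega)]
    refine (if_pos ?_).symm
    rw [← h2]
    exact hb
  · obtain ⟨h1, h2, h3⟩ := h
    refine (hq' a s' (by rw [h1]; exact hs)).mono (by omega) fun s'' h' => ⟨h'.1.trans h1, ?_,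
      fun r hr => (h'.2.2 r hr).trans (h3 r hr)⟩
    rw [h'.2.1, hy.1 a s'.reg s.reg fun r hr => h3 r (by omega)]
    refine (if_neg ?_).symm
    rw [← h2]
    exact fun h => h hb

/-- Bounded sums.  The body is given for an arbitrary value `v` of the summation index. -/
theorem Ev.sum {d : ℕ} {x : α → (ℕ → ℕ) → ℕ} {g : ℕ → α → (ℕ → ℕ) → ℕ} (hx : Ev Rep Z d x)
    (hb : ∀ a ρ, x a ρ ≤ Z a)
    (hg : ∀ D ≥ d, ∀ v, Ev Rep Z D v → Ev Rep Z D fun a ρ => g (v a ρ) a ρ) :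
    Ev Rep Z d fun a ρ => ∑ i ∈ Finset.range (x a ρ), g i a ρ := by
  have gl : ∀ i a ρ ρ', (∀ r < d, ρ r = ρ' r) → g i a ρ = g i a ρ' := fun i =>
    (hg d le_rfl (fun _ _ => i) (Ev.const i)).1
  refine ⟨fun a ρ ρ' h => ?_, fun d' hd' => ?_⟩
  · simp only [hx.1 a ρ ρ' h]
    exact Finset.sum_congr rfl fun i _ => gl i a ρ ρ' h
  obtain ⟨p, C, hp⟩ := hx.2 (d' + 1) (by omega)
  -- Register `d'` holds the partial sum, `d' + 1` the number of terms, `d' + 2` the index and `d' +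
  -- 3` the current term.
  obtain ⟨q, D, hq⟩ := (hg (d' + 3) (by omega) (fun _ ρ => ρ (d' + 2))
    (Ev.var (by omega))).2 (d' + 3) le_rfl
  refine ⟨.seq p (.seq (.assign d' (.const 0)) (.seq (.assign (d' + 2) (.const 0))
    (.loop (.sub (.reg (d' + 1)) (.reg (d' + 2)))
      (.seq q (.seq (.assign d' (.add (.reg d') (.reg (d' + 3))))
        (.assign (d' + 2) (.add (.reg (d' + 2)) (.const 1)))))))),
    C + (2 + (2 + (1 + (D + 12 + 1) + 4 + 1) + 1) + 1) + 1, fun a s hs => ?_⟩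
  refine ((hp a s hs).seq (R := fun s' => _) fun s' h => (Runs.assign (Q := fun s'' =>
    s'' = s'.setReg d' 0) rfl).seq (R := fun s' => _) fun s'' h' => (Runs.assign (Q := fun s3 =>
    s3 = s''.setReg (d' + 2) 0) rfl).seq (R := fun s' => _) fun s3 h3 => ?_).mono
    (add_le_pow_add_two le_rfl (add_le_pow_add_two (le_pow_add_two _ 2) (add_le_pow_add_two
      (le_pow_add_two _ 2)
      (add_le_pow_add_two (mul_le_pow_add_two (t₁ := x a s.reg) (c₁ := 1)
        (by have := hb a s.reg; rw [pow_one]; omega)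
      (add_le_pow_add_two (t₁ := (Z a + 2) ^ D) le_rfl (le_pow_add_two _ 12)))
      (le_pow_add_two _ 4))))) fun _ h => h
  obtain ⟨e1, e2, e3⟩ := h
  refine (Runs.loop (m := x a s.reg) (T := (Z a + 2) ^ D + 8) (fun j s' => s'.arr = s.arr ∧
    s'.reg (d' + 1) = x a s.reg ∧ s'.reg (d' + 2) = j ∧
    s'.reg d' = ∑ i ∈ Finset.range j, g i a s.reg ∧ ∀ r < d', s'.reg r = s.reg r)
    ?_ ?_ ?_).mono ?_ ?_
  · rintro j s' ⟨-, h2, h3, -⟩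
    simp only [Expr.eval, h2, h3]
    omega
  · rintro j s' hj ⟨h1, h2, h3, h4, h5⟩
    refine ((hq a s' (by rw [h1]; exact hs)).seq fun s'' h => (Runs.assign (Q := fun s4 =>
      s4 = s''.setReg d' (s''.reg d' + s''.reg (d' + 3))) rfl).seq
      fun s4 h4 => Runs.assign ?_).mono (T := (Z a + 2) ^ D + (4 + 4)) (by omega) fun _ h => h
    obtain ⟨k1, k2, k3⟩ := h
    subst h4
    refine ⟨k1.trans h1, ?_, ?_, ?_, fun r hr => ?_⟩
    · simp [k3, h2]
    · simp [k3, h3, Expr.eval]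
    · simp only [State.setReg_reg, ne_eq, Nat.left_eq_add, OfNat.ofNat_ne_zero,
        not_false_eq_true, Function.update_of_ne, Function.update_self, Finset.sum_range_succ, k2,
        k3 d' (by omega), h4, h3]
      congr 1
      exact gl j a _ _ fun r hr => h5 r (by omega)
    · have := k3 r (by omega)
      have := h5 r hr
      simp [Function.update_of_ne, hr.ne, show r ≠ d' + 2 by omega, *]
  · subst h3 h'
    refine ⟨e1, ?_, ?_, ?_, fun r hr => ?_⟩
    · simp [e2]
    · simp
    · simp
    · simp [Function.update_of_ne, hr.ne, show r ≠ d' + 2 by omega, e3 r (by omega)]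
  · refine le_of_eq ?_
    simp only [Expr.cost]
  · rintro s' ⟨h1, -, -, h4, h5⟩
    exact ⟨h1, h4, h5⟩

/-- Filling an array: after the program, cell `j` of the array `A` holds `f a j`, for all
`j < m a`.  While cell `i` is computed the smaller cells and the counter `i`, which stands in cell
`0` of the array `B`, may be read. -/
theorem exists_fill {A B : ℕ} (hAB : A ≠ B) {m : α → ℕ} {f : α → ℕ → ℕ}
    (hRep : ∀ a arr arr', Rep a arr → (∀ b, b ≠ A → b ≠ B → arr' b = arr b) → Rep a arr')
    (hm : Ev Rep Z 0 fun a _ => m a) (hb : ∀ a, m a ≤ Z a)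
    (hf : Ev (fun (q : α × ℕ) arr => Rep q.1 arr ∧ q.2 < m q.1 ∧ arr B 0 = q.2 ∧
      ∀ j < q.2, arr A j = f q.1 j) (fun q => Z q.1) 0 fun q _ => f q.1 q.2) :
    ∃ p C, ∀ a s, Rep a s.arr → Runs p s ((Z a + 2) ^ C) fun s' =>
      Rep a s'.arr ∧ ∀ j < m a, s'.arr A j = f a j := by
  obtain ⟨p, C, hp⟩ := hm.2 0 le_rfl
  -- Target `1` protects register `0`, which holds the number of cells. The counter is kept in an
  -- array because the body sees it as part of its data `(a, j)`.
  obtain ⟨q, D, hq⟩ := hf.2 1 (by omega)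
  refine ⟨.seq p (.seq (.write B (.const 0) (.const 0))
    (.loop (.sub (.reg 0) (.read B (.const 0)))
      (.seq q (.seq (.write A (.read B (.const 0)) (.reg 1))
        (.write B (.const 0) (.add (.read B (.const 0)) (.const 1))))))),
    C + (3 + (1 + (D + 15 + 1) + 5 + 1) + 1) + 1, fun a s hs => ?_⟩
  refine ((hp a s hs).seq (R := fun s' => _) fun s' h => (Runs.write (Q := fun s'' =>
    s'' = s'.setArr B 0 0) rfl).seq (R := fun s' => _) fun s'' h' => ?_).mono
    (add_le_pow_add_two le_rfl (add_le_pow_add_two (le_pow_add_two _ 3)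
      (add_le_pow_add_two (mul_le_pow_add_two (t₁ := m a) (c₁ := 1)
        (by have := hb a; rw [pow_one]; omega)
      (add_le_pow_add_two (t₁ := (Z a + 2) ^ D) le_rfl (le_pow_add_two _ 15)))
      (le_pow_add_two _ 5)))) fun _ h => h
  obtain ⟨e1, e2, e3⟩ := h
  refine (Runs.loop (m := m a) (T := (Z a + 2) ^ D + 10) (fun j s' => Rep a s'.arr ∧
    s'.reg 0 = m a ∧ s'.arr B 0 = j ∧ ∀ i < j, s'.arr A i = f a i) ?_ ?_ ?_).mono ?_ ?_
  · rintro j s' ⟨-, h2, h3, -⟩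
    simp only [Expr.eval, h2, h3]
    omega
  · rintro j s' hj ⟨h1, h2, h3, h4⟩
    refine ((hq (a, j) s' ⟨h1, hj, h3, h4⟩).seq fun s'' h => (Runs.write (Q := fun s4 =>
      s4 = s''.setArr A (s''.arr B 0) (s''.reg 1)) rfl).seq fun s4 h5 => Runs.write ?_).mono
      (T := (Z a + 2) ^ D + (4 + 6)) (by omega) fun _ h => h
    obtain ⟨k1, k2, k3⟩ := h
    subst h5
    refine ⟨hRep a s'.arr _ h1 fun b hA hB => ?_, ?_, ?_, fun i hi => ?_⟩
    · simp [hA, hB, k1]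
    · simpa [h2] using k3 0 (by omega)
    · simp [Expr.eval, hAB.symm, k1, h3]
    · by_cases hij : i = j
      · subst hij
        simp [hAB, k1, h3, k2]
      · simp [hAB, k1, h3, hij, h4 i (by omega)]
  · subst h'
    refine ⟨hRep a s.arr _ hs fun b hA hB => ?_, by simpa using e2, by simp, by simp⟩
    simp [hB, e1]
  · refine le_of_eq ?_
    simp only [Expr.cost]
  · rintro s' ⟨h1, -, -, h4⟩
    exact ⟨h1, h4⟩

end Poly

end RAM

/-! ## Consecutive pairs of a list -/

/-- The indicator of a proposition. -/
noncomputable def ind (P : Prop) : ℕ := open Classical in if P then 1 else 0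

theorem ind_of {P : Prop} (h : P) : ind P = 1 := if_pos h

theorem ind_of_not {P : Prop} (h : ¬P) : ind P = 0 := if_neg h

theorem ind_congr {P Q : Prop} (h : P ↔ Q) : ind P = ind Q := by rw [propext h]

theorem ind_le_one (P : Prop) : ind P ≤ 1 := by
  by_cases h : P <;> simp [ind, h]

theorem ind_and (P Q : Prop) : ind (P ∧ Q) = ind P * ind Q := by
  by_cases h : P <;> by_cases h' : Q <;> simp [ind, h, h']

/-- Replaces iterated exchange arguments: an object extremal for a suitable potential is chosen, and
a single exchange contradicts its choice. -/
theorem exists_argmin {X : Type*} {P : X → Prop} (f : X → ℕ) (h : ∃ x, P x) :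
    ∃ x, P x ∧ ∀ y, P y → f x ≤ f y := by
  classical
  have hex : ∃ m, ∃ x, P x ∧ f x = m := by
    obtain ⟨x, hx⟩ := h
    exact ⟨_, x, hx, rfl⟩
  obtain ⟨x, hx, hf⟩ := Nat.find_spec hex
  exact ⟨x, hx, fun y hy => hf.le.trans (Nat.find_min' hex ⟨y, hy, rfl⟩)⟩

/-- `u` is immediately followed by `v` in `p`. -/
def Hop (p : List ℕ) (u v : ℕ) : Prop := [u, v] <:+: p

/-- The sum of `f u v` over the pairs of consecutive entries `u, v`. -/
def hopSum (f : ℕ → ℕ → ℕ) : List ℕ → ℕ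
  | u :: v :: l => f u v + hopSum f (v :: l)
  | _ => 0

theorem Hop.mem_left {p : List ℕ} {u v : ℕ} (h : Hop p u v) : u ∈ p :=
  h.subset (by simp)

theorem Hop.mem_right {p : List ℕ} {u v : ℕ} (h : Hop p u v) : v ∈ p :=
  h.subset (by simp)

theorem not_hop_nil (u v : ℕ) : ¬Hop [] u v := fun h => by simpa using h.mem_left

theorem not_hop_singleton (x u v : ℕ) : ¬Hop [x] u v := fun h => by
  have := h.length_le
  simp at this

theorem hop_cons_cons {x y u v : ℕ} {l : List ℕ} :
    Hop (x :: y :: l) u v ↔ (u = x ∧ v = y) ∨ Hop (y :: l) u v := by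
  simp [Hop, List.infix_cons_iff, List.prefix_cons_iff]

/-- Both hops together would repeat a vertex. In particular a path never crosses itself. -/
theorem Hop.not_symm {p : List ℕ} (hp : p.Nodup) {u v : ℕ} (h : Hop p u v) : ¬Hop p v u := by
  induction p with
  | nil => exact not_hop_nil _ _
  | cons x p ih =>
    cases p with
    | nil => exact not_hop_singleton _ _ _
    | cons y l =>
      obtain ⟨hx, hp⟩ := List.nodup_cons.1 hp
      rw [hop_cons_cons] at h ⊢
      rintro (⟨rfl, rfl⟩ | h')
      · rcases h with ⟨h, -⟩ | h
        · exact hx (by simp [h])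
        · exact hx h.mem_right
      · rcases h with ⟨rfl, rfl⟩ | h
        · exact hx h'.mem_right
        · exact ih hp h h'

theorem Hop.chain {S : ℕ → ℕ → Prop} {p : List ℕ} (hp : p.IsChain S) {u v : ℕ} (h : Hop p u v) :
    S u v := by
  simpa using hp.infix h

theorem hop_middle (l₁ l₂ : List ℕ) (u v : ℕ) : Hop (l₁ ++ u :: v :: l₂) u v :=
  ⟨l₁, l₂, by simp⟩

theorem hop_map_equiv (φ : Equiv.Perm ℕ) (p : List ℕ) (u v : ℕ) :
    Hop (p.map φ) (φ u) (φ v) ↔ Hop p u v := by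
  unfold Hop
  rw [List.infix_map_iff]
  constructor
  · rintro ⟨l, hl, h⟩
    obtain rfl : [u, v] = l := List.map_injective_iff.2 φ.injective (by simpa using h)
    exact hl
  · intro h
    exact ⟨_, h, by simp⟩

theorem hopSum_split (f : ℕ → ℕ → ℕ) (l₁ l₂ : List ℕ) (a : ℕ) :
    hopSum f (l₁ ++ a :: l₂) = hopSum f (l₁ ++ [a]) + hopSum f (a :: l₂) := by
  induction l₁ with
  | nil => simp [hopSum]
  | cons x l ih =>
    cases l with
    | nil => simp [hopSum]
    | cons y l =>
      simp only [List.cons_append, hopSum] at ih ⊢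
      omega

/-- Weights that vanish on pairs leaving the first and on pairs entering the last entry. -/
theorem hopSum_ends {f : ℕ → ℕ → ℕ} {s t : ℕ} (hs : ∀ v, f s v = 0) (ht : ∀ u, f u t = 0)
    (p : List ℕ) : hopSum f (s :: p ++ [t]) = hopSum f p := by
  have hlast : ∀ p : List ℕ, hopSum f (p ++ [t]) = hopSum f p := by
    intro p
    induction p with
    | nil => rfl
    | cons x l ih =>
      cases l with
      | nil => simp [hopSum, ht]
      | cons y l => simpa [hopSum] using ih
  cases p with
  | nil => simp [hopSum, hs]
  | cons x l =>
    have := hlast (x :: l)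
    simp only [List.cons_append, hopSum, hs, zero_add] at this ⊢
    exact this

/-- Without repetitions a pair is consecutive at most once, so the indicator loses no multiplicity.
-/
theorem sum_hop (n : ℕ) (f : ℕ → ℕ → ℕ) {p : List ℕ} (hp : p.Nodup) (hn : ∀ x ∈ p, x < n) :
    ∑ u ∈ Finset.range n, ∑ v ∈ Finset.range n, ind (Hop p u v) * f u v = hopSum f p := by
  induction p with
  | nil => simp [ind_of_not (not_hop_nil _ _), hopSum]
  | cons x p ih =>
    cases p with
    | nil => simp [ind_of_not (not_hop_singleton _ _ _), hopSum]
    | cons y l =>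
      obtain ⟨hx, hp⟩ := List.nodup_cons.1 hp
      have key : ∀ u v, ind (Hop (x :: y :: l) u v) * f u v =
          (if u = x then if v = y then f u v else 0 else 0) + ind (Hop (y :: l) u v) * f u v := by
        intro u v
        by_cases h : u = x ∧ v = y
        · obtain ⟨rfl, rfl⟩ := h
          rw [ind_of (hop_cons_cons.2 (.inl ⟨rfl, rfl⟩)), ind_of_not fun h => hx h.mem_left]
          simp
        · rw [ind_congr (Q := Hop (y :: l) u v) (by rw [hop_cons_cons]; tauto)]
          by_cases hu : u = x <;> by_cases hv : v = y <;> simp_all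
      simp only [key, Finset.sum_add_distrib]
      rw [ih hp fun z hz => hn z (List.mem_cons_of_mem _ hz)]
      have hx' := hn x (by simp)
      have hy' := hn y (by simp)
      have : ∑ u ∈ Finset.range n, ∑ v ∈ Finset.range n,
          (if u = x then if v = y then f u v else 0 else 0) = f x y := by
        rw [Finset.sum_eq_single x, Finset.sum_eq_single y]
        · simp
        · intro b _ hb
          simp [hb]
        · simp [hy']
        · intro b _ hb
          simp [hb]
        · simp [hx']
      rw [this, hopSum]

/-- Isolates the part of a pairwise cost that changes when only the agents in `D` are rerouted. -/
theorem sum_sq_split {R D : Finset ℕ} (hD : D ⊆ R) (κ : ℕ → ℕ → ℕ) (hκ : ∀ i j, κ i j = κ j i) :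
    ∑ i ∈ R, ∑ j ∈ R, κ i j = ∑ i ∈ R \ D, ∑ j ∈ R \ D, κ i j +
      2 * ∑ i ∈ D, ∑ j ∈ R \ D, κ i j + ∑ i ∈ D, ∑ j ∈ D, κ i j := by
  have h1 : ∀ i, ∑ j ∈ R, κ i j = ∑ j ∈ R \ D, κ i j + ∑ j ∈ D, κ i j := fun i =>
    (Finset.sum_sdiff hD).symm
  rw [← Finset.sum_sdiff hD]
  simp only [h1, Finset.sum_add_distrib]
  have h2 : ∑ i ∈ R \ D, ∑ j ∈ D, κ i j = ∑ i ∈ D, ∑ j ∈ R \ D, κ i j := by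
    rw [Finset.sum_comm]
    exact Finset.sum_congr rfl fun i _ => Finset.sum_congr rfl fun j _ => hκ j i
  omega

/-- Entries outside `C` are never adjacent, so they exceed the entries in `C` by at most one. -/
theorem length_le_of_cover (C : Finset ℕ) {p : List ℕ} (hp : p.Nodup)
    (hC : p.IsChain fun u v => u ∈ C ∨ v ∈ C) : p.length ≤ 2 * C.card + 1 := by
  -- The bound that is better by one for lists starting in `C` is what the induction needs when a
  -- head outside `C` is added.
  have key : ∀ p : List ℕ, (p.IsChain fun u v => u ∈ C ∨ v ∈ C) →
      p.length ≤ 2 * p.countP (· ∈ C) + 1 ∧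
      ∀ x l, p = x :: l → x ∈ C → p.length ≤ 2 * p.countP (· ∈ C) := by
    intro p
    induction p with
    | nil => simp
    | cons x p ih =>
      intro h
      cases p with
      | nil =>
        by_cases hx : x ∈ C
        · simp [hx]
        · simp only [List.length_singleton, le_add_iff_nonneg_left, zero_le, true_and]
          rintro _ _ ⟨⟩ h
          exact absurd h hx
      | cons y l =>
        obtain ⟨hxy, h⟩ := List.isChain_cons_cons.1 h
        obtain ⟨i1, i2⟩ := ih h
        have i2 := i2 y l rfl
        rw [List.countP_cons (a := x)]
        simp only [List.length_cons (a := x), decide_eq_true_eq]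
        by_cases hx : x ∈ C
        · simp only [hx, if_true]
          constructor
          · omega
          · intros
            omega
        · simp only [hx, if_false]
          have hy : y ∈ C := hxy.resolve_left hx
          have := i2 hy
          constructor
          · omega
          · rintro _ _ ⟨⟩ h
            exact absurd h hx
  have h1 := (key p hC).1
  have h2 : p.countP (· ∈ C) ≤ C.card := by
    rw [List.countP_eq_length_filter, ← List.toFinset_card_of_nodup (hp.filter _)]
    refine Finset.card_le_card fun x hx => ?_
    simpa using (List.mem_filter.1 (List.mem_toFinset.1 hx)).2
  omega

/-! ## Families of paths in a network -/

/-- Vertices `0, …, n - 1`, undirected edges `E`, possible steps `St`, and a set `rep` of sources,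
the source `r` having the destination `T r`. -/
structure Net where
  n : ℕ
  E : ℕ → ℕ → Prop
  St : ℕ → ℕ → Prop
  rep : ℕ → Prop
  T : ℕ → ℕ

namespace Net

/-- Every vertex belongs to exactly one terminal pair. -/
structure Ok (Γ : Net) : Prop where
  E_symm : ∀ u v, Γ.E u v → Γ.E v u
  E_St : ∀ u v, Γ.E u v → Γ.St u v
  St_ne : ∀ u v, Γ.St u v → u ≠ v
  St_lt : ∀ u v, Γ.St u v → u < Γ.n ∧ v < Γ.n
  rep_lt : ∀ r, Γ.rep r → r < Γ.n
  T_lt : ∀ r, Γ.rep r → Γ.T r < Γ.n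
  T_eq : ∀ r r', Γ.rep r → Γ.rep r' → Γ.T r = r' → r = r'
  T_inj : ∀ r r', Γ.rep r → Γ.rep r' → Γ.T r = Γ.T r' → r = r'
  cover : ∀ v < Γ.n, ∃ r, Γ.rep r ∧ (v = r ∨ v = Γ.T r)

variable (Γ : Net)

def IsP (s t : ℕ) (p : List ℕ) : Prop :=
  p.head? = some s ∧ p.getLast? = some t ∧ p.Nodup ∧ p.IsChain Γ.St

def Sol (Q : ℕ → List ℕ) : Prop := ∀ r, Γ.rep r → Γ.IsP r (Γ.T r) (Q r)

open Classical in
noncomputable def reps : Finset ℕ := {r ∈ Finset.range Γ.n | Γ.rep r}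

noncomputable def load (Q : ℕ → List ℕ) (u v : ℕ) : ℕ := ∑ r ∈ Γ.reps, ind (Hop (Q r) u v)

/-- Twice the crossing cost. -/
noncomputable def cost2 (Q : ℕ → List ℕ) : ℕ :=
  ∑ u ∈ Finset.range Γ.n, ∑ v ∈ Finset.range Γ.n, ind (Γ.E u v) * (Γ.load Q u v * Γ.load Q v u)

def Opt (Q : ℕ → List ℕ) : Prop := Γ.Sol Q ∧ ∀ Q', Γ.Sol Q' → Γ.cost2 Q ≤ Γ.cost2 Q'

/-- The number of edges that are used by `p` and by `q` in opposite directions. -/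
noncomputable def cross (p q : List ℕ) : ℕ :=
  ∑ u ∈ Finset.range Γ.n, ∑ v ∈ Finset.range Γ.n,
    ind (Γ.E u v) * (ind (Hop p u v) * ind (Hop q v u))

variable {Γ}

/-! ### Cost as a sum of pairwise crossings; endpoints of paths -/

theorem mem_reps (h : Γ.Ok) {r : ℕ} : r ∈ Γ.reps ↔ Γ.rep r := by
  simp only [reps, Finset.mem_filter, Finset.mem_range, and_iff_right_iff_imp]
  exact h.rep_lt r

/-- Multiplying out the two loads gives a sum over ordered pairs of agents, so rerouting affects
only the terms of the rerouted agents. -/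
theorem cost2_eq (Q : ℕ → List ℕ) :
    Γ.cost2 Q = ∑ r ∈ Γ.reps, ∑ r' ∈ Γ.reps, Γ.cross (Q r) (Q r') := by
  have hl : ∀ u v, Γ.load Q u v * Γ.load Q v u =
      ∑ r ∈ Γ.reps, ∑ r' ∈ Γ.reps, ind (Hop (Q r) u v) * ind (Hop (Q r') v u) := fun u v =>
    Finset.sum_mul_sum _ _ _ _
  unfold cost2 cross
  simp only [hl, Finset.mul_sum]
  simp_rw [Finset.sum_comm (s := Finset.range Γ.n) (t := Γ.reps)]

theorem cross_symm (h : Γ.Ok) (p q : List ℕ) : Γ.cross p q = Γ.cross q p := by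
  unfold cross
  rw [Finset.sum_comm]
  refine Finset.sum_congr rfl fun u _ => Finset.sum_congr rfl fun v _ => ?_
  rw [ind_congr ⟨h.E_symm v u, h.E_symm u v⟩, mul_comm (ind (Hop q _ _))]

theorem cross_self {p : List ℕ} (hp : p.Nodup) : Γ.cross p p = 0 := by
  refine Finset.sum_eq_zero fun u _ => Finset.sum_eq_zero fun v _ => ?_
  by_cases h : Hop p u v
  · simp [ind_of_not (h.not_symm hp)]
  · simp [ind_of_not h]

/-- Against fixed other paths the cost of `p` is additive over its hops, so a local change of `p`
has a local effect. -/
theorem sum_cross {p : List ℕ} (hp : p.Nodup) (hn : ∀ x ∈ p, x < Γ.n) (A : Finset ℕ)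
    (Q : ℕ → List ℕ) : ∑ r ∈ A, Γ.cross p (Q r) =
      hopSum (fun u v => ind (Γ.E u v) * ∑ r ∈ A, ind (Hop (Q r) v u)) p := by
  rw [← sum_hop Γ.n _ hp hn]
  unfold cross
  rw [Finset.sum_comm]
  refine Finset.sum_congr rfl fun u _ => ?_
  rw [Finset.sum_comm]
  refine Finset.sum_congr rfl fun v _ => ?_
  simp only [Finset.mul_sum]
  refine Finset.sum_congr rfl fun r _ => ?_
  ring

theorem IsP.lt (h : Γ.Ok) {s t : ℕ} {p : List ℕ} (hp : Γ.IsP s t p) (hs : s < Γ.n) :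
    ∀ x ∈ p, x < Γ.n := by
  obtain ⟨h1, -, -, h4⟩ := hp
  induction p generalizing s with
  | nil => simp
  | cons y p ih =>
    obtain rfl : y = s := by simpa using h1
    cases p with
    | nil => simpa using hs
    | cons z l =>
      rw [List.isChain_cons_cons] at h4
      have := ih (h.St_lt _ _ h4.1).2 rfl h4.2
      simpa [hs] using this

/-- A longer list would contain `s` at both ends. Hence degenerate pairs have no inner vertices and
no hops. -/
theorem IsP.eq_singleton {s : ℕ} {p : List ℕ} (hp : Γ.IsP s s p) : p = [s] := by
  obtain ⟨h1, h2, h3, -⟩ := hp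
  cases p with
  | nil => simp at h1
  | cons y p =>
    obtain rfl : y = s := by simpa using h1
    rcases List.eq_nil_or_concat p with rfl | ⟨q, z, rfl⟩
    · rfl
    · obtain rfl : z = y := by simpa [List.getLast?_cons] using h2
      simp at h3

/-- The inner vertices of a path. -/
def inner (p : List ℕ) : List ℕ := p.tail.dropLast

theorem inner_ends (s t : ℕ) (p : List ℕ) : inner (s :: p ++ [t]) = p := by
  simp [inner]

theorem IsP.eq_ends {s t : ℕ} {p : List ℕ} (hp : Γ.IsP s t p) (hst : s ≠ t) :
    p = s :: inner p ++ [t] := by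
  obtain ⟨h1, h2, h3, -⟩ := hp
  cases p with
  | nil => simp at h1
  | cons y p =>
    obtain rfl : y = s := by simpa using h1
    rcases List.eq_nil_or_concat p with rfl | ⟨q, z, rfl⟩
    · simp at h2
      contradiction
    · obtain rfl : z = t := by simpa [List.getLast?_cons] using h2
      simp [inner]

theorem Opt.of_le {Q Q' : ℕ → List ℕ} (hQ : Γ.Opt Q) (hQ' : Γ.Sol Q')
    (hc : Γ.cost2 Q' ≤ Γ.cost2 Q) : Γ.Opt Q' :=
  ⟨hQ', fun Q'' h => hc.trans (hQ.2 Q'' h)⟩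

/-- The set of all inner vertices of a family of paths. -/
noncomputable def used (Γ : Net) (Q : ℕ → List ℕ) : Finset ℕ :=
  Γ.reps.biUnion fun r => (inner (Q r)).toFinset

theorem mem_used {Q : ℕ → List ℕ} {w : ℕ} :
    w ∈ Γ.used Q ↔ ∃ r ∈ Γ.reps, w ∈ inner (Q r) := by
  simp [used]

/-! ### Few inner vertices suffice -/

/-- What a path pays for passing `w` on the way from `a` to `b`. -/
noncomputable def passCost (Γ : Net) (Q : ℕ → List ℕ) (a b w : ℕ) : ℕ :=
  ind (Γ.E a w) * Γ.load Q w a + ind (Γ.E w b) * Γ.load Q b w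

/-- Splitting off the agent `r`, only the mixed terms change, since neither path crosses itself. The
additive form avoids subtraction. -/
theorem cost2_update (h : Γ.Ok) {Q : ℕ → List ℕ} {r : ℕ} (hr : Γ.rep r) {p : List ℕ}
    (hp : p.Nodup) (hr' : (Q r).Nodup) :
    Γ.cost2 (Function.update Q r p) + 2 * ∑ r' ∈ Γ.reps \ {r}, Γ.cross (Q r) (Q r') =
      Γ.cost2 Q + 2 * ∑ r' ∈ Γ.reps \ {r}, Γ.cross p (Q r') := by
  have hsub : {r} ⊆ Γ.reps := by simpa using (mem_reps h).2 hr
  rw [cost2_eq, cost2_eq, sum_sq_split hsub _ fun i j => cross_symm h (Q i) (Q j),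
    sum_sq_split hsub _ fun i j => cross_symm h (Function.update Q r p i) _]
  simp only [Finset.sum_singleton, Function.update_self, cross_self hp, cross_self hr']
  have hne : ∀ x ∈ Γ.reps \ {r}, Function.update Q r p x = Q x := fun x hx => by
    have : x ≠ r := by simpa using (Finset.mem_sdiff.1 hx).2
    simp [this]
  have h1 : ∑ i ∈ Γ.reps \ {r}, ∑ j ∈ Γ.reps \ {r},
      Γ.cross (Function.update Q r p i) (Function.update Q r p j) =
      ∑ i ∈ Γ.reps \ {r}, ∑ j ∈ Γ.reps \ {r}, Γ.cross (Q i) (Q j) :=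
    Finset.sum_congr rfl fun i hi => Finset.sum_congr rfl fun j hj => by rw [hne i hi, hne j hj]
  have h2 : ∑ j ∈ Γ.reps \ {r}, Γ.cross p (Function.update Q r p j) =
      ∑ j ∈ Γ.reps \ {r}, Γ.cross p (Q j) :=
    Finset.sum_congr rfl fun j hj => by rw [hne j hj]
  rw [h1, h2]
  omega

/-- Replacing one inner vertex of one path. -/
theorem exchange (h : Γ.Ok) {Q : ℕ → List ℕ} (hQ : Γ.Sol Q) {r : ℕ} (hr : Γ.rep r)
    {l₁ l₂ : List ℕ} {a w b x : ℕ} (hw : Q r = l₁ ++ a :: w :: b :: l₂) (hx : x ∉ Q r)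
    (hax : Γ.St a x) (hxb : Γ.St x b) :
    Γ.Sol (Function.update Q r (l₁ ++ a :: x :: b :: l₂)) ∧
    Γ.cost2 (Function.update Q r (l₁ ++ a :: x :: b :: l₂)) + 2 * Γ.passCost Q a b w =
      Γ.cost2 Q + 2 * Γ.passCost Q a b x := by
  obtain ⟨p1, p2, p3, p4⟩ := hQ r hr
  have hP := hQ r hr
  have hnew : Γ.IsP r (Γ.T r) (l₁ ++ a :: x :: b :: l₂) := by
    refine ⟨?_, ?_, ?_, ?_⟩
    · rw [← p1, hw]
      cases l₁ <;> rfl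
    · rw [← p2, hw]
      simp [List.getLast?_append, List.getLast?_cons]
    · rw [hw] at p3 hx
      simp only [List.nodup_append, List.nodup_cons, List.mem_cons, List.mem_append, ne_eq] at *
      grind
    · rw [hw, List.isChain_split] at p4
      rw [List.isChain_split]
      refine ⟨p4.1, ?_⟩
      simp only [List.isChain_cons_cons] at p4 ⊢
      exact ⟨hax, hxb, p4.2.2.2⟩
  constructor
  · intro r' hr'
    by_cases e : r' = r
    · subst e
      simpa using hnew
    · simpa [e] using hQ r' hr'
  have hc := cost2_update h hr hnew.2.2.1 p3
  rw [sum_cross p3 (hP.lt h (h.rep_lt r hr)), sum_cross hnew.2.2.1 (hnew.lt h (h.rep_lt r hr))]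
    at hc
  rw [hw] at hc
  set f : ℕ → ℕ → ℕ := fun u v => ind (Γ.E u v) * ∑ r' ∈ Γ.reps \ {r}, ind (Hop (Q r') v u)
    with hf
  rw [hopSum_split f l₁ (w :: b :: l₂) a, hopSum_split f l₁ (x :: b :: l₂) a] at hc
  simp only [hopSum] at hc
  -- The path of `r` passes `w` forwards and avoids `x`, so it adds nothing to the reverse loads in
  -- `passCost`; these are the loads of the other agents.
  have hload : ∀ u v, ¬Hop (Q r) u v →
      Γ.load Q u v = ∑ r' ∈ Γ.reps \ {r}, ind (Hop (Q r') u v) := by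
    intro u v hn
    unfold load
    rw [← Finset.sum_sdiff (s₁ := {r}) (s₂ := Γ.reps) (by simpa using (mem_reps h).2 hr),
      Finset.sum_singleton, ind_of_not hn, add_zero]
  have haw : Hop (Q r) a w := by
    rw [hw]
    exact hop_middle _ _ _ _
  have hwb : Hop (Q r) w b := by
    rw [hw]
    exact ⟨l₁ ++ [a], l₂, by simp⟩
  have e1 : Γ.passCost Q a b w = f a w + f w b := by
    rw [passCost, hload _ _ (haw.not_symm p3), hload _ _ (hwb.not_symm p3)]
  have e2 : Γ.passCost Q a b x = f a x + f x b := by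
    rw [passCost, hload _ _ fun h => hx h.mem_left, hload _ _ fun h => hx h.mem_right]
  omega

open Classical in
/-- There is an optimal family that uses few inner vertices. -/
theorem exists_opt_used_le (h : Γ.Ok) {C : Finset ℕ} (hC : ∀ u v, Γ.St u v → u ∈ C ∨ v ∈ C)
    (hs : ∃ Q, Γ.Sol Q) :
    ∃ Q, Γ.Opt Q ∧ (Γ.used Q).card ≤ C.card + C.card * C.card * (2 * C.card + 1) := by
  -- The label sum breaks ties: an exchange of equal cost cannot lower it, which makes the
  -- comparison in `hex` strict.
  obtain ⟨Q, hQ, hmin⟩ := exists_argmin (P := Γ.Opt) (fun Q => ∑ r ∈ Γ.reps, (Q r).sum) (by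
    obtain ⟨Q, hQ, h'⟩ := exists_argmin (P := Γ.Sol) Γ.cost2 hs
    exact ⟨Q, hQ, h'⟩)
  refine ⟨Q, hQ, ?_⟩
  have hex : ∀ r, Γ.rep r → ∀ l₁ l₂ a w b x, Q r = l₁ ++ a :: w :: b :: l₂ → x ∉ Q r →
      Γ.St a x → Γ.St x b → toLex (Γ.passCost Q a b w, w) < toLex (Γ.passCost Q a b x, x) := by
    intro r hr l₁ l₂ a w b x hw hx hax hxb
    obtain ⟨hsol, hcost⟩ := exchange h hQ.1 hr hw hx hax hxb
    have hle := hQ.2 _ hsol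
    rw [Prod.Lex.toLex_lt_toLex]
    simp only
    rcases Nat.lt_or_ge (Γ.passCost Q a b w) (Γ.passCost Q a b x) with hlt | hge
    · exact .inl hlt
    · refine .inr ⟨by omega, ?_⟩
      have hpot := hmin _ (hQ.of_le hsol (by omega))
      have hrR := (mem_reps h).2 hr
      rw [← Finset.add_sum_erase _ _ hrR, ← Finset.add_sum_erase _ _ hrR] at hpot
      have hrest : ∑ r' ∈ Γ.reps.erase r,
          (Function.update Q r (l₁ ++ a :: x :: b :: l₂) r').sum =
          ∑ r' ∈ Γ.reps.erase r, (Q r').sum :=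
        Finset.sum_congr rfl fun r' hr' => by
          rw [Function.update_of_ne (Finset.ne_of_mem_erase hr')]
      have hne : w ≠ x := by
        rintro rfl
        apply hx
        rw [hw]
        simp
      rw [hrest] at hpot
      simp only [hw, Function.update_self, List.sum_append, List.sum_cons] at hpot
      omega
  let W : ℕ → ℕ → Finset ℕ := fun a b =>
    {w ∈ Finset.range Γ.n | ∃ r ∈ Γ.reps, ∃ l₁ l₂, Q r = l₁ ++ a :: w :: b :: l₂}
  have hW : ∀ a b, (W a b).card ≤ 2 * C.card + 1 := by
    intro a b
    rcases (W a b).eq_empty_or_nonempty with he | hne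
    · simp [he]
    -- The path through the worst `w` contains all of `W a b`: a member off this path could replace
    -- `w`, and `hex` would make it worse than `w`.
    obtain ⟨w, hw, hmax⟩ := Finset.exists_max_image (W a b)
      (fun w => toLex (Γ.passCost Q a b w, w)) hne
    obtain ⟨-, r, hr, l₁, l₂, hl⟩ := Finset.mem_filter.1 hw
    have hr := (mem_reps h).1 hr
    have hsub : W a b ⊆ (Q r).toFinset := by
      intro x hx
      by_contra hxr
      rw [List.mem_toFinset] at hxr
      obtain ⟨-, r', hr', l₁', l₂', hl'⟩ := Finset.mem_filter.1 hx
      have hch := (hQ.1 r' ((mem_reps h).1 hr')).2.2.2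
      have h1 : Γ.St a x := Hop.chain hch (by rw [hl']; exact hop_middle _ _ _ _)
      have h2 : Γ.St x b := Hop.chain hch (by rw [hl']; exact ⟨l₁' ++ [a], l₂', by simp⟩)
      exact absurd (hex r hr l₁ l₂ a w b x hl hxr h1 h2) (not_lt.2 (hmax x hx))
    have hP := hQ.1 r hr
    exact (Finset.card_le_card hsub).trans ((List.toFinset_card_le _).trans
      (length_le_of_cover C hP.2.2.1 (hP.2.2.2.imp fun u v => hC u v)))
  -- Both neighbours on the path of an inner vertex outside the cover lie in the cover.
  have hsub : Γ.used Q ⊆ C ∪ (C ×ˢ C).biUnion fun ab => W ab.1 ab.2 := by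
    intro w hw
    obtain ⟨r, hr, hwr⟩ := mem_used.1 hw
    have hP := hQ.1 r ((mem_reps h).1 hr)
    by_cases hwC : w ∈ C
    · exact Finset.mem_union_left _ hwC
    have hst : r ≠ Γ.T r := by
      intro e
      rw [← e] at hP
      rw [hP.eq_singleton] at hwr
      simp [inner] at hwr
    have hdec := hP.eq_ends hst
    obtain ⟨m₁, m₂, hm⟩ := List.append_of_mem hwr
    rw [hm] at hdec
    obtain ⟨l₁, a, ha⟩ : ∃ l₁ a, r :: m₁ = l₁ ++ [a] :=
      ⟨_, _, (List.dropLast_append_getLast (List.cons_ne_nil _ _)).symm⟩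
    obtain ⟨b, l₂, hb⟩ : ∃ b l₂, m₂ ++ [Γ.T r] = b :: l₂ := by
      cases m₂ <;> simp
    have hl : Q r = l₁ ++ a :: w :: b :: l₂ := by
      have e : r :: (m₁ ++ w :: m₂) ++ [Γ.T r] = (r :: m₁) ++ w :: (m₂ ++ [Γ.T r]) := by simp
      rw [hdec, e, ha, hb]
      simp
    have h1 : Γ.St a w := Hop.chain hP.2.2.2 (by rw [hl]; exact hop_middle _ _ _ _)
    have h2 : Γ.St w b := Hop.chain hP.2.2.2 (by rw [hl]; exact ⟨l₁ ++ [a], l₂, by simp⟩)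
    refine Finset.mem_union_right _ (Finset.mem_biUnion.2 ⟨(a, b), ?_, ?_⟩)
    · exact Finset.mem_product.2 ⟨(hC _ _ h1).resolve_right hwC, (hC _ _ h2).resolve_left hwC⟩
    · exact Finset.mem_filter.2 ⟨Finset.mem_range.2 (h.St_lt _ _ h1).2, r, hr, l₁, l₂, hl⟩
  refine (Finset.card_le_card hsub).trans ((Finset.card_union_le _ _).trans ?_)
  refine Nat.add_le_add_left ?_ _
  refine Finset.card_biUnion_le.trans ((Finset.sum_le_card_nsmul _ _ _ fun ab _ =>
    hW ab.1 ab.2).trans ?_)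
  simp [Finset.card_product]

end Net

namespace Net

/-! ### Exchanging similar terminal pairs -/

/-- `u` and `v` have the same neighbours. -/
def twin (Γ : Net) (u v : ℕ) : Prop :=
  ∀ w < Γ.n, (Γ.E u w ↔ Γ.E v w) ∧ (Γ.St u w ↔ Γ.St v w) ∧ (Γ.St w u ↔ Γ.St w v)

/-- The terminal pairs of `r` and `r'` are interchangeable. -/
def cls (Γ : Net) (r r' : ℕ) : Prop :=
  Γ.twin r r' ∧ Γ.twin (Γ.T r) (Γ.T r') ∧ (Γ.T r = r ↔ Γ.T r' = r')

/-- The number of smaller sources of the same class. -/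
noncomputable def rank (Γ : Net) (r : ℕ) : ℕ :=
  ∑ i ∈ Finset.range Γ.n, ind (i < r ∧ Γ.rep i ∧ Γ.cls i r)

/-- The terminals of the first `K` pairs of each class. -/
def hub (Γ : Net) (K v : ℕ) : Prop :=
  ∃ r < Γ.n, Γ.rep r ∧ Γ.rank r < K ∧ (v = r ∨ v = Γ.T r)

variable {Γ : Net}

theorem sum_ind (n : ℕ) (P : ℕ → Prop) [DecidablePred P] :
    ∑ i ∈ Finset.range n, ind (P i) = ((Finset.range n).filter P).card := by
  rw [Finset.card_filter]
  refine Finset.sum_congr rfl fun i _ => ?_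
  by_cases h : P i <;> simp [ind, h]

theorem twin.symm {u v : ℕ} (h : Γ.twin u v) : Γ.twin v u := fun w hw =>
  ⟨(h w hw).1.symm, (h w hw).2.1.symm, (h w hw).2.2.symm⟩

theorem twin.trans {u v x : ℕ} (h : Γ.twin u v) (h' : Γ.twin v x) : Γ.twin u x := fun w hw =>
  ⟨(h w hw).1.trans (h' w hw).1, (h w hw).2.1.trans (h' w hw).2.1,
    (h w hw).2.2.trans (h' w hw).2.2⟩

theorem twin.refl (u : ℕ) : Γ.twin u u := fun _ _ => ⟨Iff.rfl, Iff.rfl, Iff.rfl⟩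

theorem cls.symm {u v : ℕ} (h : Γ.cls u v) : Γ.cls v u :=
  ⟨h.1.symm, h.2.1.symm, h.2.2.symm⟩

theorem cls.trans {u v x : ℕ} (h : Γ.cls u v) (h' : Γ.cls v x) : Γ.cls u x :=
  ⟨h.1.trans h'.1, h.2.1.trans h'.2.1, h.2.2.trans h'.2.2⟩

theorem cls.refl (u : ℕ) : Γ.cls u u := ⟨twin.refl u, twin.refl _, Iff.rfl⟩

theorem twin.St_left (h : Γ.Ok) {u v : ℕ} (ht : Γ.twin u v) (w : ℕ) : Γ.St u w ↔ Γ.St v w :=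
  ⟨fun hw => (ht w (h.St_lt _ _ hw).2).2.1.1 hw, fun hw => (ht w (h.St_lt _ _ hw).2).2.1.2 hw⟩

theorem twin.St_right (h : Γ.Ok) {u v : ℕ} (ht : Γ.twin u v) (w : ℕ) : Γ.St w u ↔ Γ.St w v :=
  ⟨fun hw => (ht w (h.St_lt _ _ hw).1).2.2.1 hw, fun hw => (ht w (h.St_lt _ _ hw).1).2.2.2 hw⟩

theorem twin.E_left (h : Γ.Ok) {u v : ℕ} (ht : Γ.twin u v) (w : ℕ) : Γ.E u w ↔ Γ.E v w :=
  ⟨fun hw => (ht w (h.St_lt _ _ (h.E_St _ _ hw)).2).1.1 hw,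
    fun hw => (ht w (h.St_lt _ _ (h.E_St _ _ hw)).2).1.2 hw⟩

/-- By irreflexivity, `hl` and `hr` also force `u` and `v` to be unrelated, so the transposition
preserves `S`. -/
theorem rel_swap {S : ℕ → ℕ → Prop} (hS : ∀ u, ¬S u u) {u v : ℕ} (hl : ∀ w, S u w ↔ S v w)
    (hr : ∀ w, S w u ↔ S w v) (a b : ℕ) :
    S (Equiv.swap u v a) (Equiv.swap u v b) ↔ S a b := by
  rw [Equiv.swap_apply_def, Equiv.swap_apply_def]
  split_ifs <;> subst_vars <;> grind

open Classical in
/-- The sources of the class of `r` have the ranks `0, 1, 2, …`. -/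
theorem rank_image (r : ℕ) :
    (({i ∈ Finset.range Γ.n | i < r ∧ Γ.rep i ∧ Γ.cls i r} : Finset ℕ).image Γ.rank) =
      Finset.range (Γ.rank r) ∧
    Set.InjOn Γ.rank {i | Γ.rep i ∧ Γ.cls i r ∧ i < Γ.n} := by
  have hlt : ∀ i j, Γ.rep i → Γ.cls i r → i < Γ.n → Γ.cls j r → i < j → Γ.rank i < Γ.rank j := by
    intro i j hi hir hin hjr hij
    unfold rank
    rw [sum_ind, sum_ind]
    refine Finset.card_lt_card ⟨fun x hx => ?_, fun hsub => ?_⟩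
    · simp only [Finset.mem_filter, Finset.mem_range] at hx ⊢
      exact ⟨hx.1, hx.2.1.trans hij, hx.2.2.1, hx.2.2.2.trans (hir.trans hjr.symm)⟩
    · have : i ∈ ({x ∈ Finset.range Γ.n | x < j ∧ Γ.rep x ∧ Γ.cls x j} : Finset ℕ) := by
        simp only [Finset.mem_filter, Finset.mem_range]
        exact ⟨hin, hij, hi, hir.trans hjr.symm⟩
      have := hsub this
      simp at this
  have hinj : Set.InjOn Γ.rank {i | Γ.rep i ∧ Γ.cls i r ∧ i < Γ.n} := by
    rintro i ⟨hi, hir, hin⟩ j ⟨hj, hjr, hjn⟩ hij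
    rcases lt_trichotomy i j with h | h | h
    · have := hlt i j hi hir hin hjr h
      omega
    · exact h
    · have := hlt j i hj hjr hjn hir h
      omega
  refine ⟨?_, hinj⟩
  -- Within a class ranks increase strictly, so they map the `rank r` smaller members injectively
  -- into a set of the same size.
  refine Finset.eq_of_subset_of_card_le (fun t ht => ?_) ?_
  · obtain ⟨i, hi, rfl⟩ := Finset.mem_image.1 ht
    simp only [Finset.mem_filter, Finset.mem_range] at hi ⊢
    exact hlt i r hi.2.2.1 hi.2.2.2 hi.1 (cls.refl r) hi.2.1
  · rw [Finset.card_image_of_injOn, Finset.card_range, rank, sum_ind]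
    refine hinj.mono fun i hi => ?_
    simp only [Finset.coe_filter, Finset.mem_range, Set.mem_ofPred_eq] at hi
    exact ⟨hi.2.2.1, hi.2.2.2, hi.1⟩

theorem rank_inj {r r' : ℕ} (h : Γ.Ok) (hr : Γ.rep r) (hr' : Γ.rep r') (hc : Γ.cls r' r)
    (he : Γ.rank r' = Γ.rank r) : r' = r :=
  (rank_image r).2 ⟨hr', hc, h.rep_lt r' hr'⟩ ⟨hr, cls.refl r, h.rep_lt r hr⟩ he

theorem exists_rank_eq {r t : ℕ} (hr : Γ.rep r) (ht : t ≤ Γ.rank r) :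
    ∃ i, Γ.rep i ∧ Γ.cls i r ∧ Γ.rank i = t := by
  classical
  rcases ht.eq_or_lt with rfl | ht
  · exact ⟨r, hr, cls.refl r, rfl⟩
  · have := (rank_image r).1 ▸ Finset.mem_range.2 ht
    obtain ⟨i, hi, he⟩ := Finset.mem_image.1 this
    simp only [Finset.mem_filter] at hi
    exact ⟨i, hi.2.2.1, hi.2.2.2, he⟩

/-- Terminal pairs are disjoint, so a terminal determines its pair and hence the rank. -/
theorem not_hub {K r : ℕ} (h : Γ.Ok) (hr : Γ.rep r) (hK : K ≤ Γ.rank r) :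
    ¬Γ.hub K r ∧ ¬Γ.hub K (Γ.T r) := by
  constructor
  · rintro ⟨u, -, hu, hlt, rfl | e⟩
    · omega
    · obtain rfl := h.T_eq u r hu hr e.symm
      omega
  · rintro ⟨u, -, hu, hlt, e | e⟩
    · obtain rfl := h.T_eq r u hr hu e
      omega
    · obtain rfl := h.T_inj r u hr hu e
      omega

/-- A symmetry of the network. -/
structure Symm (Γ : Net) (φ : Equiv.Perm ℕ) : Prop where
  lt : ∀ v, φ v < Γ.n ↔ v < Γ.n
  E : ∀ u v, Γ.E (φ u) (φ v) ↔ Γ.E u v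
  St : ∀ u v, Γ.St (φ u) (φ v) ↔ Γ.St u v
  rep : ∀ r, Γ.rep (φ r) ↔ Γ.rep r
  T : ∀ r, Γ.rep r → Γ.T (φ r) = φ (Γ.T r)

/-- Twins can be transposed, so the symmetry swaps sources and destinations. Degenerate pairs are
treated apart, since there the second swap would undo the first. -/
theorem exists_symm (h : Γ.Ok) {r r' : ℕ} (hr : Γ.rep r) (hr' : Γ.rep r') (hc : Γ.cls r r')
    (hne : r ≠ r') : ∃ φ, Γ.Symm φ ∧ φ r = r' ∧ φ (Γ.T r) = Γ.T r' ∧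
      ∀ v, v ≠ r → v ≠ Γ.T r → v ≠ r' → v ≠ Γ.T r' → φ v = v := by
  have hE : ∀ u, ¬Γ.E u u := fun u hu => h.St_ne u u (h.E_St u u hu) rfl
  have hS : ∀ u, ¬Γ.St u u := fun u hu => h.St_ne u u hu rfl
  have hEs : ∀ u v, Γ.E u v ↔ Γ.E v u := fun u v => ⟨h.E_symm u v, h.E_symm v u⟩
  have sE : ∀ {u v}, Γ.twin u v → ∀ a b, Γ.E (Equiv.swap u v a) (Equiv.swap u v b) ↔ Γ.E a b :=
    fun {u v} ht => rel_swap hE (ht.E_left h) fun w => by rw [hEs, ht.E_left h, hEs]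
  have sS : ∀ {u v}, Γ.twin u v → ∀ a b, Γ.St (Equiv.swap u v a) (Equiv.swap u v b) ↔ Γ.St a b :=
    fun {u v} ht => rel_swap hS (ht.St_left h) (ht.St_right h)
  have l1 := h.rep_lt r hr
  have l2 := h.rep_lt r' hr'
  have l3 := h.T_lt r hr
  have l4 := h.T_lt r' hr'
  have i1 := h.T_eq
  have i2 := h.T_inj
  by_cases ht : Γ.T r = r
  · have ht' := hc.2.2.1 ht
    refine ⟨Equiv.swap r r', ⟨?_, sE hc.1, sS hc.1, ?_, ?_⟩, ?_, ?_, ?_⟩ <;>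
      intros <;> simp only [Equiv.swap_apply_def] <;> grind
  · have ht' := fun e => ht (hc.2.2.2 e)
    have n1 : r ≠ Γ.T r' := fun e => hne (i1 r' r hr' hr e.symm).symm
    have n2 : r' ≠ Γ.T r := fun e => hne (i1 r r' hr hr' e.symm)
    have n3 : Γ.T r ≠ Γ.T r' := fun e => hne (i2 r r' hr hr' e)
    have n4 : ¬Γ.rep (Γ.T r) := fun e => ht (i1 r _ hr e rfl).symm
    have n5 : ¬Γ.rep (Γ.T r') := fun e => ht' (i1 r' _ hr' e rfl).symm
    refine ⟨(Equiv.swap r r').trans (Equiv.swap (Γ.T r) (Γ.T r')), ⟨?_, ?_, ?_, ?_, ?_⟩, ?_, ?_, ?_⟩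
    · intro v
      simp only [Equiv.trans_apply, Equiv.swap_apply_def]
      grind
    · intro u v
      rw [Equiv.trans_apply, Equiv.trans_apply, sE hc.2.1, sE hc.1]
    · intro u v
      rw [Equiv.trans_apply, Equiv.trans_apply, sS hc.2.1, sS hc.1]
    · intro v
      simp only [Equiv.trans_apply, Equiv.swap_apply_def]
      grind
    · intro v hv
      have := i1 v r hv hr
      have := i1 v r' hv hr'
      have := i2 v r hv hr
      have := i2 v r' hv hr'
      simp only [Equiv.trans_apply, Equiv.swap_apply_def]
      grind
    · simp only [Equiv.trans_apply, Equiv.swap_apply_def]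
      grind
    · simp only [Equiv.trans_apply, Equiv.swap_apply_def]
      grind
    · intro v
      simp only [Equiv.trans_apply, Equiv.swap_apply_def]
      grind

theorem Symm.mem_reps {φ : Equiv.Perm ℕ} (hφ : Γ.Symm φ) (h : Γ.Ok) (r : ℕ) :
    r ∈ Γ.reps ↔ φ r ∈ Γ.reps := by
  rw [Net.mem_reps h, Net.mem_reps h, hφ.rep]

/-- Carrying a family of paths along a symmetry. -/
def move (φ : Equiv.Perm ℕ) (Q : ℕ → List ℕ) (r : ℕ) : List ℕ := (Q (φ.symm r)).map φ

theorem Symm.sol {φ : Equiv.Perm ℕ} (hφ : Γ.Symm φ) {Q : ℕ → List ℕ} (hQ : Γ.Sol Q) :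
    Γ.Sol (move φ Q) := by
  intro r hr
  have hr' : Γ.rep (φ.symm r) := by rw [← hφ.rep]; simpa using hr
  obtain ⟨h1, h2, h3, h4⟩ := hQ _ hr'
  refine ⟨?_, ?_, h3.map φ.injective, ?_⟩
  · simp [move, h1]
  · have := hφ.T _ hr'
    simp only [Equiv.apply_symm_apply] at this
    simp [move, h2, this]
  · rw [move, List.isChain_map]
    exact h4.imp fun u v => (hφ.St u v).2

theorem Symm.load {φ : Equiv.Perm ℕ} (h : Γ.Ok) (hφ : Γ.Symm φ) (Q : ℕ → List ℕ) (u v : ℕ) :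
    Γ.load (move φ Q) (φ u) (φ v) = Γ.load Q u v := by
  unfold Net.load
  refine (Finset.sum_equiv φ (hφ.mem_reps h) fun r _ => ?_).symm
  rw [move, Equiv.symm_apply_apply, ind_congr (hop_map_equiv φ (Q r) u v)]

theorem Symm.cost2 {φ : Equiv.Perm ℕ} (h : Γ.Ok) (hφ : Γ.Symm φ) (Q : ℕ → List ℕ) :
    Γ.cost2 (move φ Q) = Γ.cost2 Q := by
  unfold Net.cost2
  refine (Finset.sum_equiv φ (by simp [hφ.lt]) fun u _ => ?_).symm
  refine Finset.sum_equiv φ (by simp [hφ.lt]) fun v _ => ?_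
  rw [hφ.load h, hφ.load h, ind_congr (hφ.E u v)]

theorem Symm.used {φ : Equiv.Perm ℕ} (h : Γ.Ok) (hφ : Γ.Symm φ) (Q : ℕ → List ℕ) :
    Γ.used (move φ Q) = (Γ.used Q).image φ := by
  ext w
  simp only [mem_used, Finset.mem_image, move, inner, ← List.map_tail, ← List.map_dropLast,
    List.mem_map]
  constructor
  · rintro ⟨r, hr, v, hv, rfl⟩
    exact ⟨v, ⟨φ.symm r, (hφ.mem_reps h _).2 (by simpa using hr), hv⟩, rfl⟩
  · rintro ⟨v, ⟨r, hr, hv⟩, rfl⟩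
    exact ⟨φ r, (hφ.mem_reps h _).1 hr, v, by simpa using hv, rfl⟩

/-- There is an optimal family all of whose inner vertices are hubs. -/
theorem exists_opt_hub (h : Γ.Ok) {K : ℕ} (hK : ∃ Q, Γ.Opt Q ∧ (Γ.used Q).card < K) :
    ∃ Q, Γ.Opt Q ∧ ∀ w ∈ Γ.used Q, Γ.hub K w := by
  classical
  obtain ⟨Q, ⟨hQ, hcard⟩, hmin⟩ := exists_argmin
    (fun Q => ((Γ.used Q).filter fun w => ¬Γ.hub K w).card) hK
  refine ⟨Q, hQ, ?_⟩
  by_contra! hcon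
  obtain ⟨w, hw, hwK⟩ := hcon
  obtain ⟨r, hr, hwr⟩ : ∃ r, Γ.rep r ∧ (w = r ∨ w = Γ.T r) := by
    obtain ⟨r₀, hr₀, hw₀⟩ := mem_used.1 hw
    refine h.cover w ((hQ.1 r₀ ((mem_reps h).1 hr₀)).lt h (h.rep_lt _ ((mem_reps h).1 hr₀)) w ?_)
    exact List.mem_of_mem_tail (List.mem_of_mem_dropLast hw₀)
  have hrank : K ≤ Γ.rank r := by
    by_contra! hlt
    exact hwK ⟨r, h.rep_lt r hr, hr, hlt, hwr⟩
  -- The class of `r` contains pairs of all ranks below `K`. They are disjoint, and fewer than `K`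
  -- vertices are used, so one of them is unused.
  obtain ⟨r', hr', hc, hlt, hu1, hu2⟩ : ∃ r', Γ.rep r' ∧ Γ.cls r' r ∧ Γ.rank r' < K ∧
      r' ∉ Γ.used Q ∧ Γ.T r' ∉ Γ.used Q := by
    by_contra! hall
    choose! i hi using fun t (ht : t ≤ Γ.rank r) => exists_rank_eq hr ht
    have : (Finset.range K).card ≤ (Γ.used Q).card := by
      refine Finset.card_le_card_of_injOn
        (fun t => if i t ∈ Γ.used Q then i t else Γ.T (i t)) (fun t ht => ?_) ?_
      · have ht : t < K := by simpa using ht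
        obtain ⟨i1, i2, i3⟩ := hi t (by omega)
        have := hall (i t) i1 i2 (by omega)
        simp only
        split_ifs with hif
        · exact hif
        · exact this hif
      · intro t ht t' ht' he
        have ht : t < K := by simpa using ht
        have ht' : t' < K := by simpa using ht'
        obtain ⟨i1, -, i3⟩ := hi t (by omega)
        obtain ⟨j1, -, j3⟩ := hi t' (by omega)
        have : i t = i t' := by
          simp only at he
          split_ifs at he
          · exact he
          · exact (h.T_eq _ _ j1 i1 he.symm).symm
          · exact h.T_eq _ _ i1 j1 he
          · exact h.T_inj _ _ i1 j1 he
        rw [← i3, ← j3, this]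
    rw [Finset.card_range] at this
    omega
  have hne : r ≠ r' := by
    rintro rfl
    omega
  obtain ⟨φ, hφ, f1, f2, f3⟩ := exists_symm h hr hr' hc.symm hne
  have hused := hφ.used h Q
  have hcard' : (Γ.used (move φ Q)).card < K := by
    rw [hused, Finset.card_image_of_injective _ φ.injective]
    exact hcard
  -- The swap sends the used terminals of `r` to hubs and creates no new used non-hub, so the number
  -- of used non-hubs drops.
  refine absurd (hmin _ ⟨hQ.of_le (hφ.sol hQ.1) (hφ.cost2 h Q).le, hcard'⟩) (not_le.2 ?_)
  have hh1 : Γ.hub K r' := ⟨r', h.rep_lt r' hr', hr', hlt, .inl rfl⟩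
  have hh2 : Γ.hub K (Γ.T r') := ⟨r', h.rep_lt r' hr', hr', hlt, .inr rfl⟩
  have key : ∀ v ∈ Γ.used (move φ Q), ¬Γ.hub K v → v ∈ Γ.used Q ∧ v ≠ r ∧ v ≠ Γ.T r := by
    intro v hv hvK
    rw [hused] at hv
    obtain ⟨x, hx, rfl⟩ := Finset.mem_image.1 hv
    have x1 : x ≠ r := by
      rintro rfl
      exact hvK (f1 ▸ hh1)
    have x2 : x ≠ Γ.T r := by
      rintro rfl
      exact hvK (f2 ▸ hh2)
    rw [f3 x x1 x2 (fun e => hu1 (e ▸ hx)) (fun e => hu2 (e ▸ hx))]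
    exact ⟨hx, x1, x2⟩
  refine Finset.card_lt_card ⟨fun v hv => ?_, fun hsub => ?_⟩
  · rw [Finset.mem_filter] at hv ⊢
    exact ⟨(key v hv.1 hv.2).1, hv.2⟩
  · have hv := Finset.mem_filter.1 (hsub (Finset.mem_filter.2 ⟨hw, hwK⟩))
    obtain ⟨-, k1, k2⟩ := key w hv.1 hv.2
    rcases hwr with rfl | rfl
    · exact k1 rfl
    · exact k2 rfl

/-! ### Copying inner paths within a class -/

/-- The terminals of `x` are not hubs, hence not inner vertices, and they are not ends of another
pair either. -/
theorem notMem_path (h : Γ.Ok) {K : ℕ} {Q : ℕ → List ℕ} (hQ : Γ.Sol Q)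
    (hK : ∀ w ∈ Γ.used Q, Γ.hub K w) {x r : ℕ} (hx : Γ.rep x) (hxK : K ≤ Γ.rank x)
    (hr : Γ.rep r) (hne : r ≠ x) : x ∉ Q r ∧ Γ.T x ∉ Q r := by
  obtain ⟨n1, n2⟩ := not_hub h hx hxK
  have hin : ∀ v ∈ inner (Q r), Γ.hub K v := fun v hv =>
    hK v (mem_used.2 ⟨r, (mem_reps h).2 hr, hv⟩)
  have hsub : ∀ v ∈ Q r, v = r ∨ v = Γ.T r ∨ v ∈ inner (Q r) := by
    intro v hv
    by_cases e : r = Γ.T r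
    · have hp := hQ r hr
      rw [← e] at hp
      rw [hp.eq_singleton] at hv
      exact .inl (by simpa using hv)
    · rw [(hQ r hr).eq_ends e] at hv
      simp only [List.cons_append, List.mem_cons, List.mem_append, List.not_mem_nil,
        or_false] at hv
      tauto
  constructor
  · intro hv
    rcases hsub _ hv with e | e | e
    · exact hne e.symm
    · exact hne (h.T_eq r x hr hx e.symm)
    · exact n1 (hin _ e)
  · intro hv
    rcases hsub _ hv with e | e | e
    · exact hne (h.T_eq x r hx hr e).symm
    · exact hne (h.T_inj x r hx hr e).symm
    · exact n2 (hin _ e)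

/-- The interaction of a path whose terminals are not used otherwise depends on its inner part. -/
theorem sum_cross_inner (h : Γ.Ok) {K : ℕ} {Q : ℕ → List ℕ} (hQ : Γ.Sol Q)
    (hK : ∀ w ∈ Γ.used Q, Γ.hub K w) {x : ℕ} (hx : Γ.rep x) (hxK : K ≤ Γ.rank x) {p : List ℕ}
    (hp : Γ.IsP x (Γ.T x) (x :: p ++ [Γ.T x])) {A : Finset ℕ} (hA : ∀ r ∈ A, Γ.rep r ∧ r ≠ x) :
    ∑ r ∈ A, Γ.cross (x :: p ++ [Γ.T x]) (Q r) =
      hopSum (fun u v => ind (Γ.E u v) * ∑ r ∈ A, ind (Hop (Q r) v u)) p := by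
  rw [sum_cross hp.2.2.1 (hp.lt h (h.rep_lt x hx)), hopSum_ends]
  · intro v
    refine mul_eq_zero_of_right _ (Finset.sum_eq_zero fun r hr => ind_of_not fun hh => ?_)
    exact (notMem_path h hQ hK hx hxK (hA r hr).1 (hA r hr).2).1 hh.mem_right
  · intro v
    refine mul_eq_zero_of_right _ (Finset.sum_eq_zero fun r hr => ind_of_not fun hh => ?_)
    exact (notMem_path h hQ hK hx hxK (hA r hr).1 (hA r hr).2).2 hh.mem_left

/-- The first and last steps survive because twins have the same neighbours. -/
theorem IsP.change_ends (h : Γ.Ok) {s t s' t' : ℕ} {p : List ℕ} (hp : Γ.IsP s t (s :: p ++ [t]))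
    (hs : Γ.twin s s') (ht : Γ.twin t t') (hst : s' ≠ t') (hs' : s' ∉ p) (ht' : t' ∉ p) :
    Γ.IsP s' t' (s' :: p ++ [t']) := by
  obtain ⟨-, -, h3, h4⟩ := hp
  refine ⟨by simp, by simp [List.getLast?_cons], ?_, ?_⟩
  · simp only [List.cons_append, List.nodup_cons, List.nodup_append, List.mem_append,
      List.mem_singleton] at h3 ⊢
    grind
  · have e1 : (s' :: (p ++ [t])).IsChain Γ.St := by
      rw [List.cons_append, List.isChain_cons] at h4
      rw [List.isChain_cons]
      exact ⟨fun y hy => (hs.St_left h y).1 (h4.1 y hy), h4.2⟩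
    rw [← List.cons_append, List.isChain_append] at e1
    rw [List.isChain_append]
    refine ⟨e1.1, by simp, fun x hx y hy => ?_⟩
    obtain rfl : t' = y := by simpa using hy
    exact (ht.St_right h x).1 (e1.2.2 x hx t (by simp))

/-- There is an optimal family in which all inner vertices are hubs and all but the first `K` paths
of a class have the same inner part. -/
theorem exists_opt_uniform (h : Γ.Ok) {K : ℕ} (hK : ∃ Q, Γ.Opt Q ∧ ∀ w ∈ Γ.used Q, Γ.hub K w) :
    ∃ Q, Γ.Opt Q ∧ (∀ w ∈ Γ.used Q, Γ.hub K w) ∧ ∀ r r', Γ.rep r → Γ.rep r' → Γ.cls r r' →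
      K ≤ Γ.rank r → K ≤ Γ.rank r' → inner (Q r) = inner (Q r') := by
  classical
  -- The potential counts ordered pairs of high rank in a common class with different inner parts;
  -- making one class uniform lowers it.
  obtain ⟨Q, ⟨hQ, hhub⟩, hmin⟩ := exists_argmin (fun Q => ((Γ.reps ×ˢ Γ.reps).filter fun q =>
    Γ.cls q.1 q.2 ∧ K ≤ Γ.rank q.1 ∧ K ≤ Γ.rank q.2 ∧ inner (Q q.1) ≠ inner (Q q.2)).card) hK
  refine ⟨Q, hQ, hhub, ?_⟩
  by_contra! hcon
  obtain ⟨r₀, r₁, hr₀, hr₁, hc, hk₀, hk₁, hdiff⟩ := hcon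
  set D : Finset ℕ := {r ∈ Γ.reps | Γ.cls r r₀ ∧ K ≤ Γ.rank r} with hD
  have hDmem : ∀ {r}, r ∈ D ↔ Γ.rep r ∧ Γ.cls r r₀ ∧ K ≤ Γ.rank r := fun {r} => by
    rw [hD, Finset.mem_filter, mem_reps h]
  have hDR : D ⊆ Γ.reps := Finset.filter_subset _ _
  have hT₀ : Γ.T r₀ ≠ r₀ := by
    intro e
    have e' := hc.2.2.1 e
    have p₀ := hQ.1 r₀ hr₀
    have p₁ := hQ.1 r₁ hr₁
    rw [e] at p₀
    rw [e'] at p₁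
    rw [p₀.eq_singleton, p₁.eq_singleton] at hdiff
    exact hdiff rfl
  have hT : ∀ r ∈ D, r ≠ Γ.T r := fun r hr e => hT₀ ((hDmem.1 hr).2.1.2.2.1 e.symm)
  -- The model `x` is the member of `D` that pays least against the paths outside `D`; by
  -- `sum_cross_inner` each copy of its inner part pays the same.
  obtain ⟨x, hx, hxmin⟩ := exists_argmin (P := fun r => r ∈ D)
    (fun r => ∑ r' ∈ Γ.reps \ D, Γ.cross (Q r) (Q r')) ⟨r₀, hDmem.2 ⟨hr₀, cls.refl _, hk₀⟩⟩
  obtain ⟨hx1, hx2, hx3⟩ := hDmem.1 hx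
  set p := inner (Q x) with hp
  have hpx : Q x = x :: p ++ [Γ.T x] := (hQ.1 x hx1).eq_ends (hT x hx)
  have hpu : ∀ w ∈ p, w ∈ Γ.used Q := fun w hw => mem_used.2 ⟨x, hDR hx, hw⟩
  set Q' : ℕ → List ℕ := fun r => if r ∈ D then r :: p ++ [Γ.T r] else Q r with hQ'
  have hQD : ∀ r ∈ D, Q' r = r :: p ++ [Γ.T r] := fun r hr => if_pos hr
  have hQD' : ∀ r, r ∉ D → Q' r = Q r := fun r hr => if_neg hr
  have hpath : ∀ r ∈ D, Γ.IsP r (Γ.T r) (r :: p ++ [Γ.T r]) := by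
    intro r hr
    obtain ⟨hr1, hr2, hr3⟩ := hDmem.1 hr
    have hP := hQ.1 x hx1
    rw [hpx] at hP
    have hcl : Γ.cls x r := hx2.trans hr2.symm
    obtain ⟨n1, n2⟩ := not_hub h hr1 hr3
    exact hP.change_ends h hcl.1 hcl.2.1 (hT r hr) (fun e => n1 (hhub _ (hpu _ e)))
      fun e => n2 (hhub _ (hpu _ e))
  have hsol : Γ.Sol Q' := by
    intro r hr
    by_cases hrD : r ∈ D
    · rw [hQD r hrD]
      exact hpath r hrD
    · rw [hQD' r hrD]
      exact hQ.1 r hr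
  have hinD : ∀ r ∈ D, inner (Q' r) = p := fun r hr => by rw [hQD r hr, inner_ends]
  have hhub' : ∀ w ∈ Γ.used Q', Γ.hub K w := by
    intro w hw
    obtain ⟨r, hr, hwr⟩ := mem_used.1 hw
    by_cases hrD : r ∈ D
    · rw [hinD r hrD] at hwr
      exact hhub w (hpu w hwr)
    · rw [hQD' r hrD] at hwr
      exact hhub w (mem_used.2 ⟨r, hr, hwr⟩)
  have hrest : ∀ r ∈ D, ∀ q ∈ Γ.reps \ D, Γ.rep q ∧ q ≠ r := by
    intro r hr q hq
    rw [Finset.mem_sdiff, mem_reps h] at hq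
    exact ⟨hq.1, fun e => hq.2 (e ▸ hr)⟩
  have hcost : Γ.cost2 Q' ≤ Γ.cost2 Q := by
    rw [cost2_eq, cost2_eq, sum_sq_split hDR _ fun i j => cross_symm h (Q i) (Q j),
      sum_sq_split hDR _ fun i j => cross_symm h (Q' i) (Q' j)]
    have c1 : ∑ i ∈ Γ.reps \ D, ∑ j ∈ Γ.reps \ D, Γ.cross (Q' i) (Q' j) =
        ∑ i ∈ Γ.reps \ D, ∑ j ∈ Γ.reps \ D, Γ.cross (Q i) (Q j) :=
      Finset.sum_congr rfl fun i hi => Finset.sum_congr rfl fun j hj => by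
        rw [hQD' i (Finset.mem_sdiff.1 hi).2, hQD' j (Finset.mem_sdiff.1 hj).2]
    have c2 : ∑ i ∈ D, ∑ j ∈ Γ.reps \ D, Γ.cross (Q' i) (Q' j) ≤
        ∑ i ∈ D, ∑ j ∈ Γ.reps \ D, Γ.cross (Q i) (Q j) := by
      refine Finset.sum_le_sum fun i hi => le_trans (le_of_eq ?_) (hxmin i hi)
      obtain ⟨hi1, hi2, hi3⟩ := hDmem.1 hi
      rw [Finset.sum_congr rfl (g := fun j => Γ.cross (i :: p ++ [Γ.T i]) (Q j)) fun j hj => by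
        rw [hQD' j (Finset.mem_sdiff.1 hj).2, hQD i hi]]
      rw [hpx, sum_cross_inner h hQ.1 hhub hi1 hi3 (hpath i hi) (hrest i hi),
        sum_cross_inner h hQ.1 hhub hx1 hx3 (hpath x hx) (hrest x hx)]
    -- The copies run through the common inner part in the same direction, and their terminals lie
    -- on no other path.
    have c3 : ∑ i ∈ D, ∑ j ∈ D, Γ.cross (Q' i) (Q' j) = 0 := by
      refine Finset.sum_eq_zero fun i hi => Finset.sum_eq_zero fun j hj => ?_
      by_cases hij : j = i
      · subst hij
        exact cross_self (hsol j (hDmem.1 hj).1).2.2.1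
      obtain ⟨hi1, hi2, hi3⟩ := hDmem.1 hi
      have := sum_cross_inner h hsol hhub' hi1 hi3 (hpath i hi) (A := {j})
        (by simpa using ⟨(hDmem.1 hj).1, hij⟩)
      simp only [Finset.sum_singleton] at this
      rw [hQD i hi, this]
      have hpn : p.Nodup := ((hpath x hx).2.2.1.sublist (List.sublist_append_left _ _)).of_cons
      rw [← sum_hop Γ.n _ hpn fun w hw => (hpath x hx).lt h (h.rep_lt x hx1) w (by simp [hw])]
      refine Finset.sum_eq_zero fun u _ => Finset.sum_eq_zero fun v _ => ?_
      by_cases hp : Hop p u v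
      · have : Hop (Q' j) u v := by
          rw [hQD j hj]
          exact List.IsInfix.trans hp ⟨[j], [Γ.T j], by simp⟩
        rw [ind_of_not (this.not_symm (hsol j (hDmem.1 hj).1).2.2.1), mul_zero, mul_zero]
      · rw [ind_of_not hp, zero_mul]
    omega
  refine absurd (hmin _ ⟨hQ.of_le hsol hcost, hhub'⟩) (not_le.2 ?_)
  refine Finset.card_lt_card ⟨fun q hq => ?_, fun hsub => ?_⟩
  · obtain ⟨q1, q2, q3, q4, q5⟩ := Finset.mem_filter.1 hq
    refine Finset.mem_filter.2 ⟨q1, q2, q3, q4, ?_⟩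
    obtain ⟨m1, m2⟩ := Finset.mem_product.1 q1
    by_cases hqD : q.1 ∈ D
    · have hqD' : q.2 ∈ D :=
        hDmem.2 ⟨(mem_reps h).1 m2, q2.symm.trans (hDmem.1 hqD).2.1, q4⟩
      rw [hinD _ hqD, hinD _ hqD'] at q5
      exact absurd rfl q5
    · have hqD' : q.2 ∉ D := fun e =>
        hqD (hDmem.2 ⟨(mem_reps h).1 m1, q2.trans (hDmem.1 e).2.1, q3⟩)
      rwa [hQD' _ hqD, hQD' _ hqD'] at q5
  · have hq := hsub (Finset.mem_filter (a := (r₀, r₁)).2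
      ⟨Finset.mem_product.2 ⟨(mem_reps h).2 hr₀, (mem_reps h).2 hr₁⟩, hc, hk₀, hk₁, hdiff⟩)
    have q5 := (Finset.mem_filter.1 hq).2.2.2.2
    rw [hinD _ (hDmem.2 ⟨hr₀, cls.refl _, hk₀⟩), hinD _ (hDmem.2 ⟨hr₁, hc.symm, hk₁⟩)] at q5
    exact q5 rfl

theorem exists_structured (h : Γ.Ok) {C : Finset ℕ} (hC : ∀ u v, Γ.St u v → u ∈ C ∨ v ∈ C)
    {K : ℕ} (hK : C.card + C.card * C.card * (2 * C.card + 1) < K) (hs : ∃ Q, Γ.Sol Q) :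
    ∃ Q, Γ.Opt Q ∧ (∀ w ∈ Γ.used Q, Γ.hub K w) ∧ ∀ r r', Γ.rep r → Γ.rep r' → Γ.cls r r' →
      K ≤ Γ.rank r → K ≤ Γ.rank r' → inner (Q r) = inner (Q r') := by
  obtain ⟨Q, hQ, hcard⟩ := exists_opt_used_le h hC hs
  exact exists_opt_uniform h (exists_opt_hub h ⟨Q, hQ, by omega⟩)

end Net

/-! ## Elementary counting -/

/-- The number of `i < n` with `i < v` and `P i`. -/
noncomputable def countBelow (n : ℕ) (P : ℕ → Prop) (v : ℕ) : ℕ :=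
  ∑ i ∈ Finset.range n, ind (i < v ∧ P i)

theorem countBelow_lt {n : ℕ} {P : ℕ → Prop} {v : ℕ} (hv : P v) (hn : v < n) :
    countBelow n P v < ∑ i ∈ Finset.range n, ind (P i) := by
  refine Finset.sum_lt_sum (fun i _ => ?_) ⟨v, Finset.mem_range.2 hn, ?_⟩
  · rw [ind_and]
    exact (Nat.mul_le_mul_right _ (ind_le_one _)).trans (one_mul _).le
  · rw [ind_of hv, ind_of_not (by omega)]
    omega

theorem countBelow_strict {n : ℕ} {P : ℕ → Prop} {u v : ℕ} (hu : P u) (hn : u < n) (huv : u < v) :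
    countBelow n P u < countBelow n P v := by
  refine Finset.sum_lt_sum (fun i _ => ?_) ⟨u, Finset.mem_range.2 hn, ?_⟩
  · by_cases h : i < u ∧ P i
    · rw [ind_of h, ind_of ⟨h.1.trans huv, h.2⟩]
    · rw [ind_of_not h]
      omega
  · rw [ind_of_not (P := u < u ∧ P u) fun h => lt_irrefl _ h.1, ind_of ⟨huv, hu⟩]
    exact one_pos

theorem countBelow_inj {n : ℕ} {P : ℕ → Prop} {u v : ℕ} (hu : P u) (hun : u < n) (hv : P v)
    (hvn : v < n) (h : countBelow n P u = countBelow n P v) : u = v := by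
  rcases lt_trichotomy u v with e | e | e
  · have := countBelow_strict hu hun e
    omega
  · exact e
  · have := countBelow_strict hv hvn e
    omega

/-- Expresses "the unique `u` with `P u`" as a bounded sum. -/
theorem sum_ind_mul_eq {n : ℕ} {P : ℕ → Prop} {v : ℕ} (hv : P v) (hn : v < n)
    (hu : ∀ u < n, P u → u = v) : ∑ u ∈ Finset.range n, ind (P u) * u = v := by
  rw [Finset.sum_eq_single v, ind_of hv, one_mul]
  · intro u hun hne
    rw [ind_of_not fun h => hne (hu u (Finset.mem_range.1 hun) h), zero_mul]
  · simp [hn]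

/-- Counting an initial segment is how minima, quotients and least witnesses become bounded sums. -/
theorem sum_ind_lt {n q : ℕ} {P : ℕ → Prop} (hq : q ≤ n) (h : ∀ i < n, P i ↔ i < q) :
    ∑ i ∈ Finset.range n, ind (P i) = q := by
  classical
  rw [Net.sum_ind]
  have : (Finset.range n).filter P = Finset.range q := by
    ext i
    simp only [Finset.mem_filter, Finset.mem_range]
    exact ⟨fun hi => (h i hi.1).1 hi.2, fun hi => ⟨by omega, (h i (by omega)).2 hi⟩⟩
  rw [this, Finset.card_range]

/-- The product `x * y`, provided that `x ≤ m`. -/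
noncomputable def capMul (m x y : ℕ) : ℕ := ∑ t ∈ Finset.range m, ind (t < x) * y

theorem capMul_eq {m x : ℕ} (y : ℕ) (h : x ≤ m) : capMul m x y = x * y := by
  rw [capMul, ← Finset.sum_mul, sum_ind_lt h fun _ _ => Iff.rfl]

/-- The quotient counts the positive multiples of `b` up to `N`. -/
theorem sum_ind_lt_div {m b N : ℕ} (hb : 0 < b) (hN : N ≤ m) :
    ∑ i ∈ Finset.range m, ind (capMul m (i + 1) b ≤ N) = N / b := by
  refine sum_ind_lt ((Nat.div_le_self _ _).trans hN) fun i hi => ?_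
  rw [capMul_eq _ (by omega), ← Nat.le_div_iff_mul_le hb, Nat.succ_le_iff]

theorem exists_digits {B : ℕ} (d : ℕ → ℕ) (hd : ∀ t, d t < B) (L : ℕ) :
    ∃ N < B ^ L, ∀ t < L, N / B ^ t % B = d t := by
  have hB : 0 < B := (Nat.zero_le _).trans_lt (hd 0)
  induction L with
  | zero => exact ⟨0, by simp, by simp⟩
  | succ L ih =>
    obtain ⟨N, hN, h⟩ := ih
    refine ⟨N + B ^ L * d L, ?_, fun t ht => ?_⟩
    · calc N + B ^ L * d L < B ^ L + B ^ L * d L := by omega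
        _ = B ^ L * (d L + 1) := by ring
        _ ≤ B ^ (L + 1) := by
          rw [pow_succ]
          exact Nat.mul_le_mul_left _ (hd L)
    · rcases Nat.lt_succ_iff_lt_or_eq.1 ht with ht | rfl
      · rw [← h t ht]
        obtain ⟨e, rfl⟩ := Nat.exists_eq_add_of_lt ht
        have : N + B ^ (t + e + 1) * d (t + e + 1) =
            N + B ^ t * (B * (B ^ e * d (t + e + 1))) := by ring
        rw [this, Nat.add_mul_div_left _ _ (pow_pos hB t), Nat.add_mul_mod_self_left]
      · rw [Nat.add_mul_div_left _ _ (pow_pos hB t), Nat.div_eq_of_lt hN, zero_add,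
          Nat.mod_eq_of_lt (hd t)]

namespace Net

variable (Γ : Net)

/-! ## A vertex cover -/

def Nbr (u v : ℕ) : Prop := Γ.St u v ∨ Γ.St v u

noncomputable def deg (v : ℕ) : ℕ := ∑ w ∈ Finset.range Γ.n, ind (Γ.Nbr v w)

/-- The vertices of degree above `x` and those with a neighbour of degree at most `x`. -/
def InCov (x v : ℕ) : Prop := x < Γ.deg v ∨ ∃ w < Γ.n, Γ.Nbr v w ∧ Γ.deg w ≤ x

noncomputable def covSize (x : ℕ) : ℕ := ∑ v ∈ Finset.range Γ.n, ind (Γ.InCov x v)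

/-- The least size of a cover `InCov x`. -/
noncomputable def covNum : ℕ :=
  ∑ m ∈ Finset.range Γ.n, ind (∀ x < Γ.n + 1, m < Γ.covSize x)

variable {Γ}

theorem covSize_le (x : ℕ) : Γ.covSize x ≤ Γ.n :=
  (Finset.sum_le_card_nsmul _ _ 1 fun _ _ => ind_le_one _).trans (by simp)

theorem covNum_spec : (∃ x, Γ.covSize x = Γ.covNum) ∧ ∀ x ≤ Γ.n, Γ.covNum ≤ Γ.covSize x := by
  obtain ⟨x, hx, hmin⟩ := exists_argmin (P := fun x => x ≤ Γ.n) Γ.covSize ⟨0, by omega⟩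
  have : Γ.covNum = Γ.covSize x := sum_ind_lt (covSize_le x) fun i _ =>
    ⟨fun h => h x (by omega), fun h y hy => h.trans_le (hmin y (by omega))⟩
  exact ⟨⟨x, this.symm⟩, fun y hy => this ▸ hmin y hy⟩

theorem covNum_le : Γ.covNum ≤ Γ.n := (covNum_spec.2 0 (Nat.zero_le _)).trans (covSize_le _)

/-- Each `InCov x` covers a step from `u` to `v`: if `deg v ≤ x`, then `u` has a neighbour of degree
at most `x`. -/
theorem exists_cover (h : Γ.Ok) :
    ∃ C : Finset ℕ, C.card = Γ.covNum ∧ ∀ u v, Γ.St u v → u ∈ C ∨ v ∈ C := by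
  classical
  obtain ⟨x, hx⟩ := (covNum_spec (Γ := Γ)).1
  refine ⟨{v ∈ Finset.range Γ.n | Γ.InCov x v}, by rw [← hx, covSize, sum_ind], fun u v huv => ?_⟩
  obtain ⟨hu, hv⟩ := h.St_lt u v huv
  simp only [Finset.mem_filter, Finset.mem_range, hu, hv, true_and]
  rcases Nat.lt_or_ge x (Γ.deg v) with hd | hd
  · exact .inr (.inl hd)
  · exact .inl (.inr ⟨v, hv, .inl huv, hd⟩)

/-- Take the threshold `X.card`. A vertex outside `X` has all its neighbours in `X`, so its degree
is at most the threshold, and it is selected only as a neighbour of a low-degree vertex of `X`. Each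
of those has at most `X.card` neighbours. -/
theorem covNum_le_of_cover {X : Finset ℕ} (hX : ∀ u v, Γ.St u v → u ∈ X ∨ v ∈ X)
    (hn : X.card ≤ Γ.n) : Γ.covNum ≤ X.card + X.card * X.card := by
  classical
  refine (covNum_spec.2 _ hn).trans ?_
  have hN : ∀ u v, Γ.Nbr u v → u ∉ X → v ∈ X := by
    rintro u v (h | h) hu
    · exact (hX _ _ h).resolve_left hu
    · exact (hX _ _ h).resolve_right hu
  have hdeg : ∀ u, Γ.deg u = ((Finset.range Γ.n).filter (Γ.Nbr u)).card := fun u => sum_ind _ _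
  rw [covSize, sum_ind]
  have hsub : (Finset.range Γ.n).filter (Γ.InCov X.card) ⊆ X ∪ (X.filter fun w =>
      Γ.deg w ≤ X.card).biUnion fun w => (Finset.range Γ.n).filter (Γ.Nbr w) := by
    intro v hv
    obtain ⟨hvn, hv⟩ := Finset.mem_filter.1 hv
    by_cases hvX : v ∈ X
    · exact Finset.mem_union_left _ hvX
    refine Finset.mem_union_right _ ?_
    rcases hv with hv | ⟨w, hw, hvw, hd⟩
    · exfalso
      refine absurd hv (not_lt.2 ?_)
      rw [hdeg]
      exact Finset.card_le_card fun w hw => hN _ _ (Finset.mem_filter.1 hw).2 hvX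
    · exact Finset.mem_biUnion.2 ⟨w, Finset.mem_filter.2 ⟨hN _ _ hvw hvX, hd⟩,
        Finset.mem_filter.2 ⟨hvn, hvw.symm⟩⟩
  refine (Finset.card_le_card hsub).trans ((Finset.card_union_le _ _).trans ?_)
  refine Nat.add_le_add_left (Finset.card_biUnion_le.trans ?_) _
  refine (Finset.sum_le_card_nsmul _ _ X.card fun w hw => ?_).trans ?_
  · rw [← hdeg]
    exact (Finset.mem_filter.1 hw).2
  · rw [smul_eq_mul]
    exact Nat.mul_le_mul_right _ (Finset.card_filter_le _ _)

/-! ## Certificates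

A number `N < M` describes a family of paths by its digits to the base `B`. -/

variable (Γ)

/-- The number of special pairs in each class. -/
noncomputable def bigK : ℕ := Γ.covNum + Γ.covNum * (Γ.covNum * (2 * Γ.covNum + 1)) + 1

/-- The number of digits per inner part, sufficient by `length_le_of_cover`. -/
noncomputable def ell : ℕ := 2 * Γ.covNum + 1

/-- The sources whose inner path is read off from the certificate. -/
def Reader (r : ℕ) : Prop := Γ.rep r ∧ Γ.rank r ≤ Γ.bigK

/-- One digit value for each hub, and the value `0` for the absence of a vertex. -/
noncomputable def base : ℕ := ∑ v ∈ Finset.range Γ.n, ind (Γ.hub Γ.bigK v) + 1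

noncomputable def digits : ℕ := (∑ r ∈ Finset.range Γ.n, ind (Γ.Reader r)) * Γ.ell

noncomputable def numCert : ℕ := Γ.base ^ Γ.digits

/-- The cutoff lets a finite table determine the function at all arguments. -/
noncomputable def pw (j : ℕ) : ℕ := ind (j < Γ.digits + 1) * Γ.base ^ j

noncomputable def quot (N j : ℕ) : ℕ :=
  ∑ i ∈ Finset.range Γ.numCert, ind (capMul Γ.numCert (i + 1) (Γ.pw j) ≤ N)

/-- The constant sum is a product carried out by repeated addition, so the difference is a remainder
modulo the base. -/
noncomputable def dig (N j : ℕ) : ℕ := Γ.quot N j - ∑ _i ∈ Finset.range Γ.base, Γ.quot N (j + 1)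

/-- The source from which `r` copies its inner path. -/
noncomputable def model (r : ℕ) : ℕ :=
  if Γ.rank r < Γ.bigK then r
  else ∑ u ∈ Finset.range Γ.n, ind (Γ.rep u ∧ Γ.cls u r ∧ Γ.rank u = Γ.bigK) * u

noncomputable def pos (r : ℕ) : ℕ := countBelow Γ.n Γ.Reader (Γ.model r)

noncomputable def digAt (N r p : ℕ) : ℕ :=
  Γ.dig N ((∑ _i ∈ Finset.range Γ.ell, Γ.pos r) + p)

noncomputable def hubAt (d : ℕ) : ℕ :=
  ∑ v ∈ Finset.range Γ.n,
    ind (Γ.hub Γ.bigK v ∧ countBelow Γ.n (Γ.hub Γ.bigK) v + 1 = d) * v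

/-- The length of the path of `r`. -/
noncomputable def len (N r : ℕ) : ℕ :=
  if Γ.T r = r then 1 else ∑ p ∈ Finset.range Γ.ell, ind (Γ.digAt N r p ≠ 0) + 2

noncomputable def entry (N r q : ℕ) : ℕ :=
  if q = 0 then r else if q + 1 < Γ.len N r then Γ.hubAt (Γ.digAt N r (q - 1)) else Γ.T r

noncomputable def path (N r : ℕ) : List ℕ := (List.range (Γ.len N r)).map (Γ.entry N r)

/-- The bounds `ell + 2` lose nothing by `len_le`; they keep the quantifiers bounded. -/
def Valid (N : ℕ) : Prop := ∀ r < Γ.n, Γ.rep r →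
  (∀ q < Γ.ell + 2, ∀ q' < Γ.ell + 2, q < q' → q' < Γ.len N r →
    Γ.entry N r q ≠ Γ.entry N r q') ∧
  ∀ q < Γ.ell + 2, q + 1 < Γ.len N r → Γ.St (Γ.entry N r q) (Γ.entry N r (q + 1))

noncomputable def certLoad (N u v : ℕ) : ℕ := ∑ r ∈ Finset.range Γ.n,
  ind (Γ.rep r ∧ ∃ q < Γ.ell + 2, q + 1 < Γ.len N r ∧ Γ.entry N r q = u ∧
    Γ.entry N r (q + 1) = v)

/-- The cap `n` is harmless, since a load is at most the number of sources. -/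
noncomputable def certCost (N : ℕ) : ℕ :=
  ∑ u ∈ Finset.range Γ.n, ∑ v ∈ Finset.range Γ.n,
    ind (Γ.E u v) * capMul Γ.n (Γ.certLoad N u v) (Γ.certLoad N v u)

def Best (N : ℕ) : Prop :=
  Γ.Valid N ∧ ∀ N' < Γ.numCert, Γ.Valid N' → Γ.certCost N ≤ Γ.certCost N'

/-- The least best certificate. -/
noncomputable def cert : ℕ :=
  ∑ N ∈ Finset.range Γ.numCert, ind (∀ N' < Γ.numCert, N' ≤ N → ¬Γ.Best N')

variable {Γ}

/-! ### Decoding certificates -/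

theorem base_pos : 0 < Γ.base := Nat.succ_pos _

theorem quot_eq {N j : ℕ} (hN : N < Γ.numCert) (hj : j ≤ Γ.digits) :
    Γ.quot N j = N / Γ.base ^ j := by
  have : Γ.pw j = Γ.base ^ j := by rw [pw, ind_of (by omega), one_mul]
  rw [quot, this]
  exact sum_ind_lt_div (pow_pos base_pos _) hN.le

theorem dig_eq {N j : ℕ} (hN : N < Γ.numCert) (hj : j < Γ.digits) :
    Γ.dig N j = N / Γ.base ^ j % Γ.base := by
  rw [dig, Finset.sum_const, Finset.card_range, smul_eq_mul, quot_eq hN hj.le, quot_eq hN hj,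
    pow_succ, ← Nat.div_div_eq_div_mul]
  have := Nat.div_add_mod (N / Γ.base ^ j) Γ.base
  omega

theorem hubAt_eq {v : ℕ} (hv : Γ.hub Γ.bigK v) (hn : v < Γ.n) :
    Γ.hubAt (countBelow Γ.n (Γ.hub Γ.bigK) v + 1) = v :=
  sum_ind_mul_eq ⟨hv, rfl⟩ hn fun _ hu h =>
    countBelow_inj h.1 hu hv hn (Nat.succ_injective h.2)

/-- Ranks in a class have no gaps and no repetitions, so a pair of rank at least `bigK` finds
exactly one pair of rank `bigK` to copy from. -/
theorem model_spec (h : Γ.Ok) {r : ℕ} (hr : Γ.rep r) : Γ.Reader (Γ.model r) ∧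
    (Γ.model r = r ∨ Γ.cls (Γ.model r) r ∧ Γ.bigK ≤ Γ.rank r ∧
      Γ.bigK ≤ Γ.rank (Γ.model r)) := by
  by_cases hlt : Γ.rank r < Γ.bigK
  · have : Γ.model r = r := if_pos hlt
    rw [this]
    exact ⟨⟨hr, hlt.le⟩, .inl rfl⟩
  · obtain ⟨u, h1, h2, h3⟩ := exists_rank_eq hr (not_lt.1 hlt)
    have : Γ.model r = u := by
      rw [model, if_neg hlt]
      exact sum_ind_mul_eq ⟨h1, h2, h3⟩ (h.rep_lt u h1) fun v _ hv =>
        rank_inj h h1 hv.1 (hv.2.1.trans h2.symm) (hv.2.2.trans h3.symm)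
    rw [this]
    exact ⟨⟨h1, h3.le⟩, .inr ⟨h2, not_lt.1 hlt, h3.ge⟩⟩

theorem len_le (N r : ℕ) : Γ.len N r ≤ Γ.ell + 2 := by
  unfold len
  split_ifs
  · omega
  · have : ∑ p ∈ Finset.range Γ.ell, ind (Γ.digAt N r p ≠ 0) ≤ Γ.ell :=
      (Finset.sum_le_card_nsmul _ _ 1 fun _ _ => ind_le_one _).trans (by simp)
    omega

theorem len_pos (N r : ℕ) : 0 < Γ.len N r := by
  unfold len
  split_ifs <;> omega

theorem valid_iff (h : Γ.Ok) (N : ℕ) : Γ.Valid N ↔ Γ.Sol (Γ.path N) := by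
  have key : ∀ r, Γ.rep r → (Γ.path N r).head? = some r ∧
      (Γ.path N r).getLast? = some (Γ.T r) := by
    intro r hr
    have hp := len_pos (Γ := Γ) N r
    constructor
    · rw [path, List.head?_map, List.head?_range, if_neg hp.ne']
      simp [entry]
    · rw [path, List.getLast?_map, List.getLast?_range, if_neg hp.ne']
      simp only [Option.map_some, Option.some.injEq, entry]
      by_cases hT : Γ.T r = r
      · have hl : Γ.len N r = 1 := if_pos hT
        simp [hl, hT]
      · have hl : Γ.len N r = _ + 2 := if_neg hT
        rw [if_neg (by omega), if_neg (by omega)]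
  have hl := fun r => len_le (Γ := Γ) N r
  constructor
  · intro hv r hr
    obtain ⟨v1, v2⟩ := hv r (h.rep_lt r hr) hr
    refine ⟨(key r hr).1, (key r hr).2, ?_, ?_⟩
    · rw [List.Nodup, List.pairwise_iff_getElem]
      intro i j hi hj hij
      simp only [path, List.length_map, List.length_range] at hi hj
      simp only [path, List.getElem_map, List.getElem_range]
      exact v1 i (hi.trans_le (hl r)) j (hj.trans_le (hl r)) hij hj
    · rw [List.isChain_iff_getElem]
      intro i hi
      simp only [path, List.length_map, List.length_range] at hi
      simp only [path, List.getElem_map, List.getElem_range]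
      exact v2 i (by have := hl r; omega) hi
  · intro hs r _ hr
    obtain ⟨-, -, h3, h4⟩ := hs r hr
    rw [List.Nodup, List.pairwise_iff_getElem] at h3
    rw [List.isChain_iff_getElem] at h4
    simp only [path, List.length_map, List.length_range, List.getElem_map,
      List.getElem_range] at h3 h4
    exact ⟨fun q _ q' _ hlt hq' => h3 q q' (by omega) hq' hlt, fun q _ hq => h4 q hq⟩

theorem hop_path (N r u v : ℕ) : Hop (Γ.path N r) u v ↔
    ∃ q < Γ.ell + 2, q + 1 < Γ.len N r ∧ Γ.entry N r q = u ∧ Γ.entry N r (q + 1) = v := by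
  have hl := len_le (Γ := Γ) N r
  unfold Hop
  rw [List.infix_iff_getElem?]
  simp only [path, List.length_cons, List.length_nil, List.length_map, List.length_range]
  constructor
  · rintro ⟨q, hq, hg⟩
    have g0 := hg 0 (by omega)
    have g1 := hg 1 (by omega)
    rw [List.getElem?_map, List.getElem?_range (by omega)] at g0 g1
    simp only [Option.map_some, Option.some.injEq] at g0 g1
    refine ⟨q, by omega, by omega, by simpa using g0, ?_⟩
    rw [add_comm]
    simpa using g1
  · rintro ⟨q, -, hq, rfl, rfl⟩
    refine ⟨q, by omega, fun i hi => ?_⟩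
    interval_cases i
    · rw [List.getElem?_map, List.getElem?_range (by omega)]
      simp
    · rw [List.getElem?_map, List.getElem?_range (by omega), add_comm]
      simp

theorem certLoad_eq (N u v : ℕ) : Γ.certLoad N u v = Γ.load (Γ.path N) u v := by
  classical
  rw [certLoad, load, reps, Finset.sum_filter]
  refine Finset.sum_congr rfl fun r _ => ?_
  rw [ind_and, ind_congr (hop_path N r u v)]
  by_cases h : Γ.rep r <;> simp [h, ind]

theorem certCost_eq (N : ℕ) : Γ.certCost N = Γ.cost2 (Γ.path N) := by
  unfold certCost cost2
  refine Finset.sum_congr rfl fun u _ => Finset.sum_congr rfl fun v _ => ?_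
  rw [capMul_eq, certLoad_eq, certLoad_eq]
  exact (Finset.sum_le_card_nsmul _ _ 1 fun _ _ => ind_le_one _).trans (by simp)

/-- Every uniform family is described by some certificate. -/
theorem exists_cert (h : Γ.Ok) {C : Finset ℕ} (hC : ∀ u v, Γ.St u v → u ∈ C ∨ v ∈ C)
    (hc : C.card = Γ.covNum) {Q : ℕ → List ℕ} (hQ : Γ.Sol Q)
    (hh : ∀ w ∈ Γ.used Q, Γ.hub Γ.bigK w) (hu : ∀ r r', Γ.rep r → Γ.rep r' → Γ.cls r r' →
      Γ.bigK ≤ Γ.rank r → Γ.bigK ≤ Γ.rank r' → inner (Q r) = inner (Q r')) :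
    ∃ N < Γ.numCert, ∀ r, Γ.rep r → Γ.path N r = Q r := by
  classical
  set H := Γ.hub Γ.bigK with hH
  -- Hubs are numbered from `1`; positions after the end of the inner part get the digit `0`.
  let code : ℕ → ℕ → ℕ := fun r p =>
    if hp : p < (inner (Q r)).length then countBelow Γ.n H (inner (Q r))[p] + 1 else 0
  have hhub : ∀ r, Γ.rep r → ∀ w ∈ inner (Q r), H w ∧ w < Γ.n := fun r hr w hw =>
    ⟨hh w (mem_used.2 ⟨r, (mem_reps h).2 hr, hw⟩), (hQ r hr).lt h (h.rep_lt r hr) w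
      (List.mem_of_mem_tail (List.mem_of_mem_dropLast hw))⟩
  have hcode : ∀ r, Γ.rep r → ∀ p, code r p < Γ.base := by
    intro r hr p
    simp only [code]
    split_ifs with hp
    · obtain ⟨w1, w2⟩ := hhub r hr _ (List.getElem_mem hp)
      exact Nat.succ_lt_succ (countBelow_lt w1 w2)
    · exact base_pos
  have hell : 0 < Γ.ell := Nat.succ_pos _
  -- Digit `t` describes position `t % ell` in the path of the reader with number `t / ell`.
  let d : ℕ → ℕ := fun t =>
    if ht : ∃ r, Γ.Reader r ∧ countBelow Γ.n Γ.Reader r = t / Γ.ell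
    then code ht.choose (t % Γ.ell) else 0
  obtain ⟨N, hN, hdig⟩ := exists_digits (B := Γ.base) d (fun t => by
    simp only [d]
    split_ifs with ht
    · exact hcode _ ht.choose_spec.1.1 _
    · exact base_pos) Γ.digits
  refine ⟨N, hN, fun r hr => ?_⟩
  obtain ⟨hm, hcopy⟩ := model_spec h hr
  have hin : inner (Q (Γ.model r)) = inner (Q r) := by
    rcases hcopy with e | ⟨e1, e2, e3⟩
    · rw [e]
    · exact hu _ _ hm.1 hr e1 e3 e2
  have hmn := h.rep_lt _ hm.1
  have hdigAt : ∀ p < Γ.ell, Γ.digAt N r p = code r p := by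
    intro p hp
    rw [digAt, Finset.sum_const, Finset.card_range, smul_eq_mul]
    have hlt : Γ.ell * Γ.pos r + p < Γ.digits := by
      have : Γ.pos r < ∑ r ∈ Finset.range Γ.n, ind (Γ.Reader r) := countBelow_lt hm hmn
      calc Γ.ell * Γ.pos r + p < Γ.ell * Γ.pos r + Γ.ell := by omega
        _ = (Γ.pos r + 1) * Γ.ell := by ring
        _ ≤ Γ.digits := Nat.mul_le_mul_right _ this
    rw [dig_eq hN hlt, hdig _ hlt]
    have hdiv : (Γ.ell * Γ.pos r + p) / Γ.ell = Γ.pos r := by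
      rw [Nat.mul_add_div hell, Nat.div_eq_of_lt hp, add_zero]
    have hmod : (Γ.ell * Γ.pos r + p) % Γ.ell = p := by
      rw [Nat.mul_add_mod, Nat.mod_eq_of_lt hp]
    have hex : ∃ r', Γ.Reader r' ∧
        countBelow Γ.n Γ.Reader r' = (Γ.ell * Γ.pos r + p) / Γ.ell := ⟨_, hm, hdiv.symm⟩
    simp only [d]
    rw [dif_pos hex, hmod]
    have hch : hex.choose = Γ.model r :=
      countBelow_inj hex.choose_spec.1 (h.rep_lt _ hex.choose_spec.1.1) hm hmn
        (hex.choose_spec.2.trans hdiv)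
    rw [hch]
    simp only [code, hin]
  by_cases hT : Γ.T r = r
  · have hp := hQ r hr
    rw [hT] at hp
    rw [hp.eq_singleton, path, len, if_pos hT]
    simp [entry]
  have hlen : (inner (Q r)).length < Γ.ell := by
    have := length_le_of_cover C (hQ r hr).2.2.1 ((hQ r hr).2.2.2.imp fun u v => hC u v)
    rw [(hQ r hr).eq_ends fun e => hT e.symm] at this
    simp only [List.cons_append, List.length_cons, List.length_append, List.length_nil, hc] at this
    unfold ell
    omega
  -- The nonzero digits form an initial segment, so counting them gives the inner length.
  have hlenN : Γ.len N r = (inner (Q r)).length + 2 := by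
    rw [len, if_neg hT, sum_ind_lt hlen.le]
    intro p hp
    rw [hdigAt p hp]
    simp only [code]
    split_ifs with h <;> simp [h]
  rw [(hQ r hr).eq_ends fun e => hT e.symm]
  refine List.ext_getElem (by simp [path, hlenN]) fun q h1 h2 => ?_
  simp only [path, List.length_map, List.length_range, hlenN] at h1
  simp only [path, List.getElem_map, List.getElem_range]
  cases q with
  | zero => simp [entry]
  | succ q =>
    simp only [entry, Nat.add_eq_zero_iff, one_ne_zero, and_false, if_false, hlenN,
      Nat.add_sub_cancel, List.cons_append, List.getElem_cons_succ]
    by_cases hq : q < (inner (Q r)).length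
    · rw [if_pos (by omega), List.getElem_append_left hq, hdigAt q (by omega)]
      simp only [code, hq, dif_pos]
      obtain ⟨w1, w2⟩ := hhub r hr _ (List.getElem_mem hq)
      exact hubAt_eq w1 w2
    · obtain rfl : q = (inner (Q r)).length := by omega
      rw [if_neg (by omega)]
      simp

/-- Some certificate describes a structured optimum, and every valid one describes a solution, so a
cheapest valid certificate is optimal. -/
theorem opt_cert (h : Γ.Ok) (hs : ∃ Q, Γ.Sol Q) : Γ.Opt (Γ.path Γ.cert) := by
  obtain ⟨C, hc, hC⟩ := exists_cover h
  obtain ⟨Q, hQ, hh, hu⟩ := exists_structured h hC (K := Γ.bigK)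
    (by rw [hc, bigK, mul_assoc]; omega) hs
  obtain ⟨N₀, hN₀, hpath⟩ := exists_cert h hC hc hQ.1 hh hu
  have hcongr : ∀ Q', (∀ r, Γ.rep r → Γ.path N₀ r = Q' r) →
      Γ.cost2 (Γ.path N₀) = Γ.cost2 Q' := by
    intro Q' hQ'
    rw [cost2_eq, cost2_eq]
    exact Finset.sum_congr rfl fun i hi => Finset.sum_congr rfl fun j hj => by
      rw [hQ' i ((mem_reps h).1 hi), hQ' j ((mem_reps h).1 hj)]
  have hsol₀ : Γ.Sol (Γ.path N₀) := fun r hr => by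
    rw [hpath r hr]
    exact hQ.1 r hr
  obtain ⟨N₁, ⟨hN₁, hv₁⟩, hmin⟩ := exists_argmin (P := fun N => N < Γ.numCert ∧ Γ.Valid N)
    Γ.certCost ⟨N₀, hN₀, (valid_iff h N₀).2 hsol₀⟩
  obtain ⟨N₂, ⟨hN₂, hb₂⟩, hleast⟩ := exists_argmin
    (P := fun N => N < Γ.numCert ∧ Γ.Best N) id
    ⟨N₁, hN₁, hv₁, fun N hN hv => hmin N ⟨hN, hv⟩⟩
  -- The sum defining `cert` counts the numbers below the least best certificate.
  have hcert : Γ.cert = N₂ := by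
    refine sum_ind_lt hN₂.le fun i hi => ⟨fun hi' => ?_, fun hi' N hN hNi hb => ?_⟩
    · by_contra! hle
      exact hi' N₂ hN₂ hle hb₂
    · have := hleast N ⟨hN, hb⟩
      simp only [id] at this
      omega
  rw [hcert]
  refine ⟨(valid_iff h _).1 hb₂.1, fun Q' hQ' => ?_⟩
  calc Γ.cost2 (Γ.path N₂) = Γ.certCost N₂ := (certCost_eq _).symm
    _ ≤ Γ.certCost N₀ := hb₂.2 N₀ hN₀ ((valid_iff h N₀).2 hsol₀)
    _ = Γ.cost2 Q := by rw [certCost_eq, hcongr Q hpath]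
    _ ≤ Γ.cost2 Q' := hQ.2 Q' hQ'

end Net

namespace RAM

variable {α : Type} {Rep : α → (ℕ → ℕ → ℕ) → Prop} {Z : α → ℕ} {d : ℕ}

/-! ## Decidable properties -/

/-- A property whose indicator is evaluated in polynomial time. -/
def EvP (Rep : α → (ℕ → ℕ → ℕ) → Prop) (Z : α → ℕ) (d : ℕ) (P : α → (ℕ → ℕ) → Prop) : Prop :=
  Ev Rep Z d fun a ρ => ind (P a ρ)

variable {P Q : α → (ℕ → ℕ) → Prop} {x y m : α → (ℕ → ℕ) → ℕ}

theorem EvP.mono {D : ℕ} (h : EvP Rep Z d P) (hd : d ≤ D) : EvP Rep Z D P := Ev.mono h hd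

theorem EvP.congr (h : EvP Rep Z d P) (e : ∀ a ρ, P a ρ ↔ Q a ρ) : EvP Rep Z d Q :=
  Ev.congr h fun a ρ => ind_congr (e a ρ)

/-- With truncated subtraction, `1 - (1 - (y - x))` is the indicator of `x < y`. -/
theorem EvP.lt (hx : Ev Rep Z d x) (hy : Ev Rep Z d y) :
    EvP Rep Z d fun a ρ => x a ρ < y a ρ := by
  refine ((Ev.const 1).sub ((Ev.const 1).sub (hy.sub hx))).congr fun a ρ => ?_
  by_cases h : x a ρ < y a ρ
  · rw [ind_of h]
    omega
  · rw [ind_of_not h]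
    omega

theorem EvP.not (h : EvP Rep Z d P) : EvP Rep Z d fun a ρ => ¬P a ρ := by
  refine ((Ev.const 1).sub h).congr fun a ρ => ?_
  by_cases h : P a ρ <;> simp [ind, h]

theorem EvP.and (h : EvP Rep Z d P) (h' : EvP Rep Z d Q) :
    EvP Rep Z d fun a ρ => P a ρ ∧ Q a ρ := by
  refine (Ev.cond h h' (Ev.const 0)).congr fun a ρ => ?_
  by_cases h : P a ρ <;> by_cases h' : Q a ρ <;> simp [ind, h, h']

theorem EvP.or (h : EvP Rep Z d P) (h' : EvP Rep Z d Q) :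
    EvP Rep Z d fun a ρ => P a ρ ∨ Q a ρ :=
  (h.not.and h'.not).not.congr fun a ρ => by tauto

theorem EvP.imp (h : EvP Rep Z d P) (h' : EvP Rep Z d Q) :
    EvP Rep Z d fun a ρ => P a ρ → Q a ρ :=
  (h.not.or h').congr fun a ρ => by tauto

theorem EvP.iff (h : EvP Rep Z d P) (h' : EvP Rep Z d Q) :
    EvP Rep Z d fun a ρ => P a ρ ↔ Q a ρ :=
  ((h.imp h').and (h'.imp h)).congr fun a ρ => by tauto

theorem EvP.le (hx : Ev Rep Z d x) (hy : Ev Rep Z d y) :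
    EvP Rep Z d fun a ρ => x a ρ ≤ y a ρ :=
  (EvP.lt hy hx).not.congr fun _ _ => not_lt

theorem EvP.eq (hx : Ev Rep Z d x) (hy : Ev Rep Z d y) :
    EvP Rep Z d fun a ρ => x a ρ = y a ρ :=
  ((EvP.le hx hy).and (EvP.le hy hx)).congr fun _ _ => by omega

theorem Ev.sumInd {R : ℕ → α → (ℕ → ℕ) → Prop} (hm : Ev Rep Z d m) (hb : ∀ a ρ, m a ρ ≤ Z a)
    (hR : ∀ D ≥ d, ∀ v, Ev Rep Z D v → EvP Rep Z D fun a ρ => R (v a ρ) a ρ) :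
    Ev Rep Z d fun a ρ => ∑ i ∈ Finset.range (m a ρ), ind (R i a ρ) :=
  Ev.sum hm hb hR

theorem EvP.ex {R : ℕ → α → (ℕ → ℕ) → Prop} (hm : Ev Rep Z d m) (hb : ∀ a ρ, m a ρ ≤ Z a)
    (hR : ∀ D ≥ d, ∀ v, Ev Rep Z D v → EvP Rep Z D fun a ρ => R (v a ρ) a ρ) :
    EvP Rep Z d fun a ρ => ∃ i < m a ρ, R i a ρ := by
  refine (EvP.lt (Ev.const 0) (Ev.sum (g := fun i a ρ => ind (R i a ρ)) hm hb hR)).congr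
    fun a ρ => ?_
  simp [ind, Finset.filter_nonempty_iff]

theorem EvP.all {R : ℕ → α → (ℕ → ℕ) → Prop} (hm : Ev Rep Z d m) (hb : ∀ a ρ, m a ρ ≤ Z a)
    (hR : ∀ D ≥ d, ∀ v, Ev Rep Z D v → EvP Rep Z D fun a ρ => R (v a ρ) a ρ) :
    EvP Rep Z d fun a ρ => ∀ i < m a ρ, R i a ρ :=
  (EvP.ex hm hb (R := fun i a ρ => ¬R i a ρ) fun D hD v hv => (hR D hD v hv).not).not.congr
    fun a ρ => by push Not; rfl

theorem Ev.ite [∀ a ρ, Decidable (P a ρ)] (h : EvP Rep Z d P) (hx : Ev Rep Z d x)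
    (hy : Ev Rep Z d y) : Ev Rep Z d fun a ρ => if P a ρ then x a ρ else y a ρ := by
  refine (Ev.cond h hx hy).congr fun a ρ => ?_
  by_cases h : P a ρ <;> simp [ind, h]

theorem EvP.indMul (h : EvP Rep Z d P) (hx : Ev Rep Z d x) :
    Ev Rep Z d fun a ρ => ind (P a ρ) * x a ρ := by
  refine (Ev.cond h hx (Ev.const 0)).congr fun a ρ => ?_
  by_cases h : P a ρ <;> simp [ind, h]

/-- Repeated addition: only the first factor counts rounds, so the second need not be bounded. -/
theorem Ev.mul (hx : Ev Rep Z d x) (hb : ∀ a ρ, x a ρ ≤ Z a) (hy : Ev Rep Z d y) :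
    Ev Rep Z d fun a ρ => x a ρ * y a ρ :=
  (Ev.sum (g := fun _ a ρ => y a ρ) hx hb fun _ hD _ _ => hy.mono hD).congr fun a ρ => by simp

theorem Ev.capMul (hm : Ev Rep Z d m) (hb : ∀ a ρ, m a ρ ≤ Z a) (hx : Ev Rep Z d x)
    (hy : Ev Rep Z d y) : Ev Rep Z d fun a ρ => capMul (m a ρ) (x a ρ) (y a ρ) :=
  Ev.sum hm hb fun _ hD _ hv => (EvP.lt hv (hx.mono hD)).indMul (hy.mono hD)

theorem Ev.countBelow {R : ℕ → α → (ℕ → ℕ) → Prop} (hm : Ev Rep Z d m) (hb : ∀ a ρ, m a ρ ≤ Z a)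
    (hR : ∀ D ≥ d, ∀ v, Ev Rep Z D v → EvP Rep Z D fun a ρ => R (v a ρ) a ρ)
    (hx : Ev Rep Z d x) :
    Ev Rep Z d fun a ρ => countBelow (m a ρ) (fun i => R i a ρ) (x a ρ) :=
  Ev.sum hm hb fun D hD v hv => (EvP.lt hv (hx.mono hD)).and (hR D hD v hv)

/-! ## The search for the best certificate runs in polynomial time -/

/-- The elementary data of a network can be evaluated. -/
structure Inp (Rep : α → (ℕ → ℕ → ℕ) → Prop) (Z : α → ℕ) (Γ : α → Net) : Prop where
  n : ∀ {d}, Ev Rep Z d fun a _ => (Γ a).n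
  E : ∀ {d u v}, Ev Rep Z d u → Ev Rep Z d v → EvP Rep Z d fun a ρ => (Γ a).E (u a ρ) (v a ρ)
  St : ∀ {d u v}, Ev Rep Z d u → Ev Rep Z d v → EvP Rep Z d fun a ρ => (Γ a).St (u a ρ) (v a ρ)
  rep : ∀ {d u}, Ev Rep Z d u → EvP Rep Z d fun a ρ => (Γ a).rep (u a ρ)
  T : ∀ {d u}, Ev Rep Z d u → Ev Rep Z d fun a ρ => (Γ a).T (u a ρ)
  le : ∀ a, 2 * (Γ a).n + 3 ≤ Z a

namespace Inp

variable {Γ : α → Net} (h : Inp Rep Z Γ) {u v : α → (ℕ → ℕ) → ℕ}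
include h

theorem n_le (a : α) (_ : ℕ → ℕ) : (Γ a).n ≤ Z a := by
  have := h.le a
  omega

theorem succ_n_le (a : α) (_ : ℕ → ℕ) : (Γ a).n + 1 ≤ Z a := by
  have := h.le a
  omega

theorem nbr (hu : Ev Rep Z d u) (hv : Ev Rep Z d v) :
    EvP Rep Z d fun a ρ => (Γ a).Nbr (u a ρ) (v a ρ) :=
  (h.St hu hv).or (h.St hv hu)

theorem deg (hv : Ev Rep Z d v) : Ev Rep Z d fun a ρ => (Γ a).deg (v a ρ) :=
  Ev.sum h.n h.n_le fun _ hD _ hw => h.nbr (hv.mono hD) hw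

theorem inCov (hx : Ev Rep Z d x) (hv : Ev Rep Z d v) :
    EvP Rep Z d fun a ρ => (Γ a).InCov (x a ρ) (v a ρ) :=
  (EvP.lt hx (h.deg hv)).or (EvP.ex h.n h.n_le fun _ hD _ hw =>
    (h.nbr (hv.mono hD) hw).and (EvP.le (h.deg hw) (hx.mono hD)))

theorem covSize (hx : Ev Rep Z d x) : Ev Rep Z d fun a ρ => (Γ a).covSize (x a ρ) :=
  Ev.sum h.n h.n_le fun _ hD _ hw => h.inCov (hx.mono hD) hw

theorem covNum : Ev Rep Z d fun a _ => (Γ a).covNum :=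
  Ev.sum h.n h.n_le fun _ _ _ hm => EvP.all (h.n.add (Ev.const 1)) h.succ_n_le fun _ hD _ hx =>
    EvP.lt (hm.mono hD) (h.covSize hx)

theorem covNum_le (a : α) (_ : ℕ → ℕ) : (Γ a).covNum ≤ Z a :=
  Net.covNum_le.trans (h.n_le a id)

theorem ell : Ev Rep Z d fun a _ => (Γ a).ell :=
  (Ev.mul (Ev.const 2) (fun a _ => by have := h.le a; omega) h.covNum).add (Ev.const 1)

theorem bigK : Ev Rep Z d fun a _ => (Γ a).bigK :=
  (h.covNum.add (Ev.mul h.covNum h.covNum_le (Ev.mul h.covNum h.covNum_le h.ell))).add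
    (Ev.const 1)

theorem ell_add_two_le (a : α) (_ : ℕ → ℕ) : (Γ a).ell + 2 ≤ Z a := by
  have h1 := h.le a
  have h2 := Net.covNum_le (Γ := Γ a)
  unfold Net.ell
  omega

theorem ell_le (a : α) (ρ : ℕ → ℕ) : (Γ a).ell ≤ Z a :=
  (Nat.le_add_right _ 2).trans (h.ell_add_two_le a ρ)

theorem twin (hu : Ev Rep Z d u) (hv : Ev Rep Z d v) :
    EvP Rep Z d fun a ρ => (Γ a).twin (u a ρ) (v a ρ) :=
  EvP.all h.n h.n_le fun _ hD _ hw =>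
    ((h.E (hu.mono hD) hw).iff (h.E (hv.mono hD) hw)).and
      (((h.St (hu.mono hD) hw).iff (h.St (hv.mono hD) hw)).and
        ((h.St hw (hu.mono hD)).iff (h.St hw (hv.mono hD))))

theorem cls (hu : Ev Rep Z d u) (hv : Ev Rep Z d v) :
    EvP Rep Z d fun a ρ => (Γ a).cls (u a ρ) (v a ρ) :=
  (h.twin hu hv).and ((h.twin (h.T hu) (h.T hv)).and
    ((EvP.eq (h.T hu) hu).iff (EvP.eq (h.T hv) hv)))

theorem rank (hu : Ev Rep Z d u) : Ev Rep Z d fun a ρ => (Γ a).rank (u a ρ) :=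
  Ev.sum h.n h.n_le fun _ hD _ hi =>
    (EvP.lt hi (hu.mono hD)).and ((h.rep hi).and (h.cls hi (hu.mono hD)))

theorem hub (hv : Ev Rep Z d v) : EvP Rep Z d fun a ρ => (Γ a).hub (Γ a).bigK (v a ρ) :=
  EvP.ex h.n h.n_le fun _ hD _ hr => (h.rep hr).and ((EvP.lt (h.rank hr) h.bigK).and
    ((EvP.eq (hv.mono hD) hr).or (EvP.eq (hv.mono hD) (h.T hr))))

theorem reader (hu : Ev Rep Z d u) : EvP Rep Z d fun a ρ => (Γ a).Reader (u a ρ) :=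
  (h.rep hu).and (EvP.le (h.rank hu) h.bigK)

theorem base : Ev Rep Z d fun a _ => (Γ a).base :=
  (Ev.sumInd h.n h.n_le fun _ _ _ hv => h.hub hv).add (Ev.const 1)

theorem base_le (a : α) (_ : ℕ → ℕ) : (Γ a).base ≤ Z a := by
  have h1 := h.le a
  have h2 : ∑ v ∈ Finset.range (Γ a).n, ind ((Γ a).hub (Γ a).bigK v) ≤ (Γ a).n :=
    (Finset.sum_le_card_nsmul _ _ 1 fun _ _ => ind_le_one _).trans (by simp)
  unfold Net.base
  omega

theorem digits : Ev Rep Z d fun a _ => (Γ a).digits :=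
  Ev.mul (Ev.sum h.n h.n_le fun _ _ _ hv => h.reader hv)
    (fun a ρ => ((Finset.sum_le_card_nsmul _ _ 1 fun _ _ => ind_le_one _).trans
      (by simp)).trans (h.n_le a ρ)) h.ell

theorem model (hu : Ev Rep Z d u) : Ev Rep Z d fun a ρ => (Γ a).model (u a ρ) :=
  Ev.ite (EvP.lt (h.rank hu) h.bigK) hu (Ev.sum h.n h.n_le fun _ hD _ hv =>
    ((h.rep hv).and ((h.cls hv (hu.mono hD)).and (EvP.eq (h.rank hv) h.bigK))).indMul hv)

theorem pos (hu : Ev Rep Z d u) : Ev Rep Z d fun a ρ => (Γ a).pos (u a ρ) :=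
  Ev.countBelow (R := fun i a _ => (Γ a).Reader i) h.n h.n_le (fun _ _ _ hv => h.reader hv)
    (h.model hu)

theorem hubAt (hu : Ev Rep Z d u) : Ev Rep Z d fun a ρ => (Γ a).hubAt (u a ρ) :=
  Ev.sum h.n h.n_le fun _ hD _ hv => ((h.hub hv).and (EvP.eq ((Ev.countBelow
    (R := fun i a _ => (Γ a).hub (Γ a).bigK i) h.n h.n_le (fun _ _ _ hv => h.hub hv) hv).add
      (Ev.const 1)) (hu.mono hD))).indMul hv

end Inp

/-- In addition, the powers of the base can be evaluated. -/
structure InpPw (Rep : α → (ℕ → ℕ → ℕ) → Prop) (Z : α → ℕ) (Γ : α → Net) : Prop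
    extends Inp Rep Z Γ where
  pw : ∀ {d u}, Ev Rep Z d u → Ev Rep Z d fun a ρ => (Γ a).pw (u a ρ)
  cert_le : ∀ a, (Γ a).numCert ≤ Z a

namespace InpPw

variable {Γ : α → Net} (h : InpPw Rep Z Γ) {N u v : α → (ℕ → ℕ) → ℕ}
include h

theorem numCert : Ev Rep Z d fun a _ => (Γ a).numCert :=
  (h.pw h.digits).congr fun a _ => by rw [Net.pw, ind_of (by omega), one_mul]; rfl

theorem numCert_le (a : α) (_ : ℕ → ℕ) : (Γ a).numCert ≤ Z a := h.cert_le a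

theorem quot (hN : Ev Rep Z d N) (hu : Ev Rep Z d u) :
    Ev Rep Z d fun a ρ => (Γ a).quot (N a ρ) (u a ρ) :=
  Ev.sum h.numCert h.numCert_le fun _ hD _ hv =>
    EvP.le (Ev.capMul h.numCert h.numCert_le (hv.add (Ev.const 1)) (h.pw (hu.mono hD)))
      (hN.mono hD)

theorem dig (hN : Ev Rep Z d N) (hu : Ev Rep Z d u) :
    Ev Rep Z d fun a ρ => (Γ a).dig (N a ρ) (u a ρ) :=
  (h.quot hN hu).sub (Ev.sum h.base h.base_le fun _ hD _ _ =>
    h.quot (hN.mono hD) ((hu.mono hD).add (Ev.const 1)))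

theorem digAt (hN : Ev Rep Z d N) (hu : Ev Rep Z d u) (hv : Ev Rep Z d v) :
    Ev Rep Z d fun a ρ => (Γ a).digAt (N a ρ) (u a ρ) (v a ρ) :=
  h.dig hN ((Ev.sum h.ell h.ell_le fun _ hD _ _ => h.pos (hu.mono hD)).add hv)

theorem len (hN : Ev Rep Z d N) (hu : Ev Rep Z d u) :
    Ev Rep Z d fun a ρ => (Γ a).len (N a ρ) (u a ρ) :=
  Ev.ite (EvP.eq (h.T hu) hu) (Ev.const 1) ((Ev.sumInd h.ell h.ell_le fun _ hD _ hp =>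
    (EvP.eq (h.digAt (hN.mono hD) (hu.mono hD) hp) (Ev.const 0)).not).add (Ev.const 2))

theorem entry (hN : Ev Rep Z d N) (hu : Ev Rep Z d u) (hv : Ev Rep Z d v) :
    Ev Rep Z d fun a ρ => (Γ a).entry (N a ρ) (u a ρ) (v a ρ) :=
  Ev.ite (EvP.eq hv (Ev.const 0)) hu (Ev.ite (EvP.lt (hv.add (Ev.const 1)) (h.len hN hu))
    (h.hubAt (h.digAt hN hu (hv.sub (Ev.const 1)))) (h.T hu))

theorem ell_add_two : Ev Rep Z d fun a _ => (Γ a).ell + 2 := h.ell.add (Ev.const 2)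

theorem valid (hN : Ev Rep Z d N) : EvP Rep Z d fun a ρ => (Γ a).Valid (N a ρ) :=
  EvP.all h.n h.n_le fun _ hD _ hr => (h.rep hr).imp <|
    EvP.and
      (EvP.all h.ell_add_two h.ell_add_two_le fun _ hD₁ _ hq =>
        EvP.all h.ell_add_two h.ell_add_two_le fun _ hD₂ _ hq' =>
          (EvP.lt (hq.mono hD₂) hq').imp <|
          (EvP.lt hq' (h.len (((hN.mono hD).mono hD₁).mono hD₂) ((hr.mono hD₁).mono hD₂))).imp <|
          (EvP.eq (h.entry (((hN.mono hD).mono hD₁).mono hD₂) ((hr.mono hD₁).mono hD₂)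
            (hq.mono hD₂))
            (h.entry (((hN.mono hD).mono hD₁).mono hD₂) ((hr.mono hD₁).mono hD₂) hq')).not)
      (EvP.all h.ell_add_two h.ell_add_two_le fun _ hD₁ _ hq =>
        (EvP.lt (hq.add (Ev.const 1)) (h.len ((hN.mono hD).mono hD₁) (hr.mono hD₁))).imp <|
        h.St (h.entry ((hN.mono hD).mono hD₁) (hr.mono hD₁) hq)
          (h.entry ((hN.mono hD).mono hD₁) (hr.mono hD₁) (hq.add (Ev.const 1))))

theorem certLoad (hN : Ev Rep Z d N) (hu : Ev Rep Z d u) (hv : Ev Rep Z d v) :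
    Ev Rep Z d fun a ρ => (Γ a).certLoad (N a ρ) (u a ρ) (v a ρ) :=
  Ev.sum h.n h.n_le fun _ hD _ hr => (h.rep hr).and <|
    EvP.ex h.ell_add_two h.ell_add_two_le fun _ hD₁ _ hq =>
      (EvP.lt (hq.add (Ev.const 1)) (h.len ((hN.mono hD).mono hD₁) (hr.mono hD₁))).and <|
      (EvP.eq (h.entry ((hN.mono hD).mono hD₁) (hr.mono hD₁) hq) ((hu.mono hD).mono hD₁)).and <|
      EvP.eq (h.entry ((hN.mono hD).mono hD₁) (hr.mono hD₁) (hq.add (Ev.const 1)))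
        ((hv.mono hD).mono hD₁)

theorem certCost (hN : Ev Rep Z d N) : Ev Rep Z d fun a ρ => (Γ a).certCost (N a ρ) :=
  Ev.sum h.n h.n_le fun _ hD _ hu => Ev.sum h.n h.n_le fun _ hD₁ _ hv =>
    (h.E (hu.mono hD₁) hv).indMul <| Ev.capMul h.n h.n_le
      (h.certLoad ((hN.mono hD).mono hD₁) (hu.mono hD₁) hv)
      (h.certLoad ((hN.mono hD).mono hD₁) hv (hu.mono hD₁))

theorem best (hN : Ev Rep Z d N) : EvP Rep Z d fun a ρ => (Γ a).Best (N a ρ) :=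
  (h.valid hN).and <| EvP.all h.numCert h.numCert_le fun _ hD _ hv => (h.valid hv).imp <|
    EvP.le (h.certCost (hN.mono hD)) (h.certCost hv)

theorem cert : Ev Rep Z d fun a _ => (Γ a).cert :=
  Ev.sum h.numCert h.numCert_le fun _ _ _ hN => EvP.all h.numCert h.numCert_le fun _ hD _ hv =>
    (EvP.le hv (hN.mono hD)).imp (h.best hv).not

end InpPw

end RAM

/-! ## Instances as networks -/

namespace CCMAR

variable (Γ : CCMAR)

def adjN (u v : ℕ) : Prop := ∃ (hu : u < Γ.n) (hv : v < Γ.n), Γ.graph.edges.Adj ⟨u, hu⟩ ⟨v, hv⟩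

def arcN (u v : ℕ) : Prop := ∃ (hu : u < Γ.n) (hv : v < Γ.n), Γ.graph.arc ⟨u, hu⟩ ⟨v, hv⟩

def srcN (i : ℕ) : ℕ := if h : i < Γ.k then Γ.src ⟨i, h⟩ else 0

def dstN (i : ℕ) : ℕ := if h : i < Γ.k then Γ.dst ⟨i, h⟩ else 0

/-- The network of an instance.  A vertex that is not a terminal forms a terminal pair with
itself. -/
noncomputable def net : Net where
  n := Γ.n
  E := Γ.adjN
  St u v := u ≠ v ∧ (Γ.adjN u v ∨ Γ.arcN u v)
  rep u := u < Γ.n ∧ ¬∃ i < Γ.k, Γ.dstN i = u ∧ Γ.srcN i ≠ u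
  T u := ∑ i ∈ Finset.range Γ.k, ind (Γ.srcN i = u) * Γ.dstN i +
    ind (¬∃ i < Γ.k, Γ.srcN i = u) * u

variable {Γ}

@[simp] theorem net_n : Γ.net.n = Γ.n := rfl

@[simp] theorem srcN_val (i : Fin Γ.k) : Γ.srcN i = Γ.src i := by simp [srcN]

@[simp] theorem dstN_val (i : Fin Γ.k) : Γ.dstN i = Γ.dst i := by simp [dstN]

theorem adjN_val (u v : Fin Γ.n) : Γ.adjN u v ↔ Γ.graph.edges.Adj u v := by simp [adjN]

theorem St_val (u v : Fin Γ.n) : Γ.net.St u v ↔ u ≠ v ∧ Γ.graph.Step u v := by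
  simp [net, adjN, arcN, MixedGraph.Step, Fin.val_inj]

theorem T_src (hΓ : Γ.NoOverlap) (i : Fin Γ.k) : Γ.net.T (Γ.src i) = Γ.dst i := by
  have h : ∃ j < Γ.k, Γ.srcN j = Γ.src i := ⟨i, i.2, srcN_val i⟩
  simp only [net]
  rw [ind_of_not (not_not.2 h), zero_mul, add_zero, Finset.sum_range, Finset.sum_eq_single i]
  · simp [ind_of]
  · intro j _ hj
    rw [ind_of_not, zero_mul]
    intro e
    rw [srcN_val] at e
    exact hj (hΓ (Γ.src i) j i (.inl (Fin.ext e.symm)) (.inl rfl))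
  · simp

theorem T_of_ne {u : ℕ} (h : ∀ i : Fin Γ.k, (Γ.src i : ℕ) ≠ u) : Γ.net.T u = u := by
  have h' : ¬∃ j < Γ.k, Γ.srcN j = u := by
    rintro ⟨j, hj, e⟩
    exact h ⟨j, hj⟩ (by rw [← e]; exact (srcN_val ⟨j, hj⟩).symm)
  simp only [net]
  rw [ind_of h', one_mul, Nat.add_eq_right]
  refine Finset.sum_eq_zero fun i hi => ?_
  rw [ind_of_not fun e => h' ⟨i, Finset.mem_range.1 hi, e⟩, zero_mul]

theorem rep_iff {u : ℕ} :
    Γ.net.rep u ↔ u < Γ.n ∧ ∀ i : Fin Γ.k, (Γ.dst i : ℕ) = u → (Γ.src i : ℕ) = u := by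
  simp only [net, not_exists, not_and, not_not, Fin.forall_iff]
  refine and_congr_right fun _ => forall_congr' fun i => forall_congr' fun hi => ?_
  rw [← srcN_val ⟨i, hi⟩, ← dstN_val ⟨i, hi⟩]

theorem rep_src (hΓ : Γ.NoOverlap) (i : Fin Γ.k) : Γ.net.rep (Γ.src i) := by
  refine rep_iff.2 ⟨(Γ.src i).2, fun j hj => ?_⟩
  rw [hΓ (Γ.src i) i j (.inl rfl) (.inr (Fin.ext hj.symm))]

theorem src_inj (hΓ : Γ.NoOverlap) {i j : Fin Γ.k} (h : (Γ.src i : ℕ) = Γ.src j) : i = j :=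
  hΓ (Γ.src i) i j (.inl rfl) (.inl (Fin.ext h))

/-- Given terminal pairs are disjoint by `NoOverlap`. Every other vertex represents itself, and a
destination different from its source is not a representative. -/
theorem net_ok (hΓ : Γ.NoOverlap) : Γ.net.Ok where
  E_symm u v := fun ⟨hu, hv, h⟩ => ⟨hv, hu, h.symm⟩
  E_St u v := fun ⟨hu, hv, h⟩ => ⟨by rintro rfl; exact h.ne rfl, .inl ⟨hu, hv, h⟩⟩
  St_ne u v h := h.1
  St_lt u v h := by
    rcases h.2 with ⟨hu, hv, -⟩ | ⟨hu, hv, -⟩ <;> exact ⟨hu, hv⟩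
  rep_lt r h := h.1
  T_lt r h := by
    by_cases hr : ∃ i : Fin Γ.k, (Γ.src i : ℕ) = r
    · obtain ⟨i, rfl⟩ := hr
      rw [T_src hΓ]
      exact (Γ.dst i).2
    · rw [T_of_ne fun i e => hr ⟨i, e⟩]
      exact h.1
  T_eq r r' h h' e := by
    by_cases hr : ∃ i : Fin Γ.k, (Γ.src i : ℕ) = r
    · obtain ⟨i, rfl⟩ := hr
      rw [T_src hΓ] at e
      exact (rep_iff.1 h').2 i e
    · rwa [T_of_ne fun i e => hr ⟨i, e⟩] at e
  T_inj r r' h h' e := by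
    by_cases hr : ∃ i : Fin Γ.k, (Γ.src i : ℕ) = r
    · obtain ⟨i, rfl⟩ := hr
      rw [T_src hΓ] at e
      by_cases hr' : ∃ j : Fin Γ.k, (Γ.src j : ℕ) = r'
      · obtain ⟨j, rfl⟩ := hr'
        rw [T_src hΓ] at e
        rw [hΓ (Γ.dst i) i j (.inr rfl) (.inr (Fin.ext e))]
      · rw [T_of_ne fun i e => hr' ⟨i, e⟩] at e
        exact (rep_iff.1 h').2 i e
    · rw [T_of_ne fun i e => hr ⟨i, e⟩] at e
      by_cases hr' : ∃ j : Fin Γ.k, (Γ.src j : ℕ) = r'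
      · obtain ⟨j, rfl⟩ := hr'
        rw [T_src hΓ] at e
        exact ((rep_iff.1 h).2 j e.symm).symm
      · rwa [T_of_ne fun i e => hr' ⟨i, e⟩] at e
  cover v hv := by
    by_cases hr : Γ.net.rep v
    · exact ⟨v, hr, .inl rfl⟩
    · have : ∃ i : Fin Γ.k, (Γ.dst i : ℕ) = v := by
        by_contra! hne
        exact hr (rep_iff.2 ⟨hv, fun i e => absurd e (hne i)⟩)
      obtain ⟨i, rfl⟩ := this
      exact ⟨Γ.src i, rep_src hΓ i, .inr (T_src hΓ i).symm⟩

/-! ### Paths and costs -/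

/-- The network drops loops among the arcs; a path without repetitions never uses one. -/
theorem isPath_iff (s t : Fin Γ.n) (p : List (Fin Γ.n)) :
    Γ.graph.IsPath s t p ↔ Γ.net.IsP s t (p.map Fin.val) := by
  have hinj := Fin.val_injective (n := Γ.n)
  unfold MixedGraph.IsPath Net.IsP
  rw [List.head?_map, List.getLast?_map, List.nodup_map_iff hinj, List.isChain_map]
  have h1 : ∀ (o : Option (Fin Γ.n)) (s : Fin Γ.n), o.map Fin.val = some (s : ℕ) ↔ o = some s := by
    intro o s
    cases o <;> simp [Fin.val_inj]
  rw [h1, h1]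
  refine and_congr_right fun _ => and_congr_right fun _ => and_congr_right fun hn => ?_
  simp only [St_val, List.isChain_iff_getElem]
  refine forall_congr' fun i => forall_congr' fun hi => ?_
  rw [and_iff_right]
  intro e
  have := (hn.getElem_inj_iff (hi := by omega) (hj := by omega)).1 e
  omega

/-- `Q` is the family of paths of the profile `P`. -/
def Describes (Q : ℕ → List ℕ) (P : Γ.Profile) : Prop := ∀ i, Q (Γ.src i) = (P i).map Fin.val

theorem isSolution_of_sol (hΓ : Γ.NoOverlap) {Q : ℕ → List ℕ} {P : Γ.Profile}
    (hd : Describes Q P) (hQ : Γ.net.Sol Q) : Γ.IsSolution P := fun i => by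
  have := hQ _ (rep_src hΓ i)
  rw [T_src hΓ, hd i] at this
  exact (isPath_iff _ _ _).2 this

theorem exists_describes (hΓ : Γ.NoOverlap) {P : Γ.Profile} (hP : Γ.IsSolution P) :
    ∃ Q, Γ.net.Sol Q ∧ Describes Q P := by
  classical
  let Q : ℕ → List ℕ := fun u =>
    if h : ∃ i : Fin Γ.k, (Γ.src i : ℕ) = u then (P h.choose).map Fin.val else [u]
  have hd : Describes Q P := by
    intro i
    have h : ∃ j : Fin Γ.k, (Γ.src j : ℕ) = Γ.src i := ⟨i, rfl⟩
    have hQ : Q (Γ.src i) = (P h.choose).map Fin.val := dif_pos h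
    rw [hQ, src_inj hΓ h.choose_spec]
  refine ⟨Q, fun r hr => ?_, hd⟩
  by_cases h : ∃ i : Fin Γ.k, (Γ.src i : ℕ) = r
  · obtain ⟨i, rfl⟩ := h
    rw [T_src hΓ, hd i]
    exact (isPath_iff _ _ _).1 (hP i)
  · rw [T_of_ne fun i e => h ⟨i, e⟩]
    have : Q r = [r] := dif_neg h
    rw [this]
    exact ⟨rfl, rfl, by simp, by simp⟩

theorem exists_profile (hΓ : Γ.NoOverlap) {Q : ℕ → List ℕ} (hQ : Γ.net.Sol Q) :
    ∃ P : Γ.Profile, Describes Q P := by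
  have hlt : ∀ i : Fin Γ.k, ∀ x ∈ Q (Γ.src i), x < Γ.n := fun i =>
    (hQ _ (rep_src hΓ i)).lt (net_ok hΓ) (Γ.src i).2
  refine ⟨fun i => (Q (Γ.src i)).pmap Fin.mk (hlt i), fun i => ?_⟩
  rw [List.map_pmap]
  simp

/-- The added pairs are degenerate, so their paths are single vertices and carry no load. -/
theorem load_eq (hΓ : Γ.NoOverlap) {Q : ℕ → List ℕ} {P : Γ.Profile} (hd : Describes Q P)
    (hQ : Γ.net.Sol Q) (u v : Fin Γ.n) : Γ.net.load Q u v = Γ.load P u v := by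
  classical
  have hhop : ∀ i, Hop (Q (Γ.src i)) u v ↔ [u, v] <:+: P i := by
    intro i
    rw [hd i]
    unfold Hop
    rw [List.infix_map_iff]
    constructor
    · rintro ⟨l, hl, e⟩
      obtain rfl : [u, v] = l := List.map_injective_iff.2 Fin.val_injective (by simpa using e)
      exact hl
    · intro h
      exact ⟨_, h, by simp⟩
  unfold load Net.load
  rw [Nat.card_eq_fintype_card, Fintype.card_subtype, Finset.card_filter]
  have himg : (Finset.univ.image fun i : Fin Γ.k => (Γ.src i : ℕ)) ⊆ Γ.net.reps := by
    intro x hx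
    obtain ⟨i, -, rfl⟩ := Finset.mem_image.1 hx
    exact (Net.mem_reps (net_ok hΓ)).2 (rep_src hΓ i)
  rw [← Finset.sum_subset himg, Finset.sum_image fun i _ j _ h => src_inj hΓ h]
  · refine Finset.sum_congr rfl fun i _ => ?_
    rw [ind_congr (hhop i)]
    by_cases h : [u, v] <:+: P i <;> simp [ind, h]
  · intro r hr hne
    have hT : Γ.net.T r = r := T_of_ne fun i e => hne (Finset.mem_image.2 ⟨i, by simp, e⟩)
    have hp := hQ r ((Net.mem_reps (net_ok hΓ)).1 hr)
    rw [hT] at hp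
    rw [hp.eq_singleton, ind_of_not (not_hop_singleton _ _ _)]

-- Adjacent ordered pairs are darts, and each edge carries two of them.
open Classical in
theorem two_mul_sum_edges {V : Type} [Fintype V] (G : SimpleGraph V) (f : Sym2 V → ℕ) :
    2 * ∑ e ∈ G.edgeFinset, f e = ∑ u, ∑ v, ind (G.Adj u v) * f s(u, v) := by
  have h1 : ∑ d : G.Dart, f d.edge = 2 * ∑ e ∈ G.edgeFinset, f e := by
    rw [← Finset.sum_fiberwise_of_maps_to (s := Finset.univ) (t := G.edgeFinset)
      (g := fun d : G.Dart => d.edge) (fun d _ => by simp [d.edge_mem]), Finset.mul_sum]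
    refine Finset.sum_congr rfl fun e he => ?_
    rw [Finset.sum_congr rfl (g := fun _ => f e) fun d hd => by rw [(Finset.mem_filter.1 hd).2],
      Finset.sum_const, G.dart_edge_fiber_card e (by simpa using he), smul_eq_mul]
  rw [← h1, ← Finset.sum_product', Finset.univ_product_univ]
  symm
  rw [← Finset.sum_subset (s₁ := Finset.univ.filter fun q : V × V => G.Adj q.1 q.2)
    (Finset.subset_univ _)]
  · symm
    refine Finset.sum_bij (fun d _ => d.toProd) (fun d _ => by simp [d.adj])
      (fun d _ d' _ h => SimpleGraph.Dart.ext _ _ h) (fun q hq => ?_) fun d _ => ?_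
    · exact ⟨⟨q, (Finset.mem_filter.1 hq).2⟩, by simp, rfl⟩
    · rw [ind_of d.adj, one_mul]
      rfl
  · intro q _ hq
    rw [ind_of_not (by simpa using hq), zero_mul]

theorem cost2_eq (hΓ : Γ.NoOverlap) {Q : ℕ → List ℕ} {P : Γ.Profile} (hd : Describes Q P)
    (hQ : Γ.net.Sol Q) : Γ.net.cost2 Q = 2 * Γ.cost P := by
  unfold cost Net.cost2
  rw [two_mul_sum_edges, net_n, Finset.sum_range]
  refine Finset.sum_congr rfl fun u _ => ?_
  rw [Finset.sum_range]
  refine Finset.sum_congr rfl fun v _ => ?_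
  rw [load_eq hΓ hd hQ, load_eq hΓ hd hQ]
  change ind (Γ.adjN u v) * _ = _
  rw [ind_congr (adjN_val u v)]
  rfl

theorem isOptimal_of_opt (hΓ : Γ.NoOverlap) {Q : ℕ → List ℕ} {P : Γ.Profile}
    (hd : Describes Q P) (hQ : Γ.net.Opt Q) : Γ.IsOptimal P := by
  refine ⟨isSolution_of_sol hΓ hd hQ.1, fun P' hP' => ?_⟩
  obtain ⟨Q', hQ', hd'⟩ := exists_describes hΓ hP'
  have := hQ.2 Q' hQ'
  rw [cost2_eq hΓ hd hQ.1, cost2_eq hΓ hd' hQ'] at this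
  omega

/-! ### The size of the vertex cover -/

theorem covNum_le_vc : Γ.net.covNum ≤ Γ.graph.vc + Γ.graph.vc * Γ.graph.vc := by
  classical
  obtain ⟨s, hs, hcov⟩ := SimpleGraph.vertexCoverNum_exists Γ.graph.underlying
  let X : Finset ℕ := s.toFinset.map Fin.valEmbedding
  have hX : X.card = Γ.graph.vc := by
    rw [Finset.card_map, MixedGraph.vc, ← hs, Set.encard_eq_coe_toFinset_card]
    rfl
  rw [← hX]
  refine Net.covNum_le_of_cover (fun u v h => ?_) ?_
  · obtain ⟨hu, hv⟩ : u < Γ.n ∧ v < Γ.n := by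
      rcases h.2 with ⟨hu, hv, -⟩ | ⟨hu, hv, -⟩ <;> exact ⟨hu, hv⟩
    have h' := (St_val ⟨u, hu⟩ ⟨v, hv⟩).1 h
    have hadj : Γ.graph.underlying.Adj ⟨u, hu⟩ ⟨v, hv⟩ := ⟨h'.1, .inl h'.2⟩
    refine (hcov hadj).imp (fun hm => ?_) fun hm => ?_
    · exact Finset.mem_map.2 ⟨⟨u, hu⟩, by simpa using hm, rfl⟩
    · exact Finset.mem_map.2 ⟨⟨v, hv⟩, by simpa using hm, rfl⟩
  · rw [Finset.card_map]
    exact (Finset.card_le_univ _).trans (by simp)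

end CCMAR

/-! ## The number of certificates -/

namespace Net

variable {Γ : Net}

open Classical in
/-- The neighbourhood of a vertex in `C`. -/
noncomputable def sig (Γ : Net) (C : Finset ℕ) (v : ℕ) :
    Finset ℕ × Finset ℕ × Finset ℕ × Finset ℕ :=
  (C.filter (· = v), C.filter (Γ.E v), C.filter (Γ.St v), C.filter (Γ.St · v))

/-- A vertex outside the cover has neighbours only in it, so its traces on `C` determine them. The
first component of `sig` separates the vertices of `C` themselves. -/
theorem twin_of_sig (h : Γ.Ok) {C : Finset ℕ} (hC : ∀ u v, Γ.St u v → u ∈ C ∨ v ∈ C) {u v : ℕ}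
    (e : Γ.sig C u = Γ.sig C v) : Γ.twin u v := by
  simp only [sig, Prod.mk.injEq, Finset.ext_iff, Finset.mem_filter] at e
  obtain ⟨e1, e2, e3, e4⟩ := e
  by_cases hu : u ∈ C
  · obtain rfl := ((e1 u).1 ⟨hu, rfl⟩).2
    exact twin.refl u
  by_cases hv : v ∈ C
  · obtain rfl := ((e1 v).2 ⟨hv, rfl⟩).2
    exact twin.refl v
  intro w _
  by_cases hw : w ∈ C
  · have := e2 w
    have := e3 w
    have := e4 w
    tauto
  · have a1 : ∀ x, x ∉ C → ¬Γ.St x w := fun x hx hs => (hC x w hs).elim hx hw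
    have a2 : ∀ x, x ∉ C → ¬Γ.St w x := fun x hx hs => (hC w x hs).elim hw hx
    exact ⟨iff_of_false (fun e => a1 u hu (h.E_St _ _ e)) (fun e => a1 v hv (h.E_St _ _ e)),
      iff_of_false (a1 u hu) (a1 v hv), iff_of_false (a2 u hu) (a2 v hv)⟩

/-- A bound for the number of readers in terms of the size of a vertex cover. -/
def readerBound (c : ℕ) : ℕ := 2 ^ (8 * c + 1) * (c + c * (c * (2 * c + 1)) + 1 + 1)

/-- A bound for the number of certificates in terms of the size of a vertex cover. -/
def certBound (c : ℕ) : ℕ := (2 * readerBound c + 1) ^ (readerBound c * (2 * c + 1))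

/-- A reader is determined by the signatures of its two terminals, each consisting of four subsets
of `C`, by whether they coincide, and by its rank, at most `bigK`. -/
theorem card_reader_le (h : Γ.Ok) :
    ∑ r ∈ Finset.range Γ.n, ind (Γ.Reader r) ≤ readerBound Γ.covNum := by
  classical
  obtain ⟨C, hc, hC⟩ := exists_cover h
  rw [sum_ind]
  let S : Finset (Finset ℕ × Finset ℕ × Finset ℕ × Finset ℕ) :=
    C.powerset ×ˢ C.powerset ×ˢ C.powerset ×ˢ C.powerset
  have hS : ∀ v, Γ.sig C v ∈ S := fun v => by simp [S, sig]
  have hcard : (S ×ˢ S ×ˢ (Finset.univ : Finset Bool) ×ˢ Finset.range (Γ.bigK + 1)).card =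
      readerBound Γ.covNum := by
    simp only [S, Finset.card_product, Finset.card_powerset, hc, Finset.card_univ,
      Fintype.card_bool, Finset.card_range, readerBound, bigK]
    ring
  rw [← hcard]
  refine Finset.card_le_card_of_injOn
    (fun r => (Γ.sig C r, Γ.sig C (Γ.T r), decide (Γ.T r = r), Γ.rank r)) (fun r hr => ?_) ?_
  · have hr := (Finset.mem_filter.1 hr).2.2
    simp only [Finset.coe_product, Set.mem_prod, Finset.mem_coe, hS, Finset.mem_univ,
      Finset.mem_range, true_and]
    omega
  · intro r hr r' hr' e
    simp only [Prod.mk.injEq, decide_eq_decide] at e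
    obtain ⟨e1, e2, e3, e4⟩ := e
    exact (rank_inj h (Finset.mem_filter.1 hr).2.1 (Finset.mem_filter.1 hr').2.1
      (cls.symm ⟨twin_of_sig h hC e1, twin_of_sig h hC e2, e3⟩) e4.symm).symm

theorem card_hub_le : ∑ v ∈ Finset.range Γ.n, ind (Γ.hub Γ.bigK v) ≤
    2 * ∑ r ∈ Finset.range Γ.n, ind (Γ.Reader r) := by
  classical
  rw [sum_ind, sum_ind]
  have hsub : (Finset.range Γ.n).filter (Γ.hub Γ.bigK) ⊆
      (Finset.range Γ.n).filter Γ.Reader ∪ ((Finset.range Γ.n).filter Γ.Reader).image Γ.T := by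
    intro v hv
    obtain ⟨r, hn, hr, hlt, e⟩ := (Finset.mem_filter.1 hv).2
    have hm : r ∈ (Finset.range Γ.n).filter Γ.Reader :=
      Finset.mem_filter.2 ⟨Finset.mem_range.2 hn, hr, hlt.le⟩
    rcases e with rfl | rfl
    · exact Finset.mem_union_left _ hm
    · exact Finset.mem_union_right _ (Finset.mem_image_of_mem _ hm)
  have h1 := (Finset.card_le_card hsub).trans (Finset.card_union_le _ _)
  have h2 := Finset.card_image_le (s := (Finset.range Γ.n).filter Γ.Reader) (f := Γ.T)
  omega

theorem certBound_mono {c c' : ℕ} (h : c ≤ c') : certBound c ≤ certBound c' := by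
  have hr : readerBound c ≤ readerBound c' := by
    unfold readerBound
    gcongr
    norm_num
  unfold certBound
  calc (2 * readerBound c + 1) ^ (readerBound c * (2 * c + 1))
      ≤ (2 * readerBound c' + 1) ^ (readerBound c * (2 * c + 1)) := by gcongr
    _ ≤ _ := Nat.pow_le_pow_right (by omega) (by gcongr)

theorem numCert_le (h : Γ.Ok) : Γ.numCert ≤ certBound Γ.covNum := by
  have h1 := card_reader_le h
  have h2 := card_hub_le (Γ := Γ)
  unfold numCert certBound base digits ell
  refine (Nat.pow_le_pow_left (Nat.succ_le_succ (h2.trans (Nat.mul_le_mul_left 2 h1))) _).trans ?_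
  exact Nat.pow_le_pow_right (by omega) (Nat.mul_le_mul_right _ h1)

theorem primrec_pow : Primrec₂ fun a b : ℕ => a ^ b := Primrec₂.unpaired'.1 Nat.Primrec.pow

theorem primrec_certBound : Primrec certBound := by
  have two : Primrec fun c : ℕ => 2 * c + 1 :=
    Primrec.succ.comp (Primrec.nat_mul.comp (Primrec.const 2) Primrec.id)
  have hr : Primrec readerBound := by
    refine Primrec.nat_mul.comp (primrec_pow.comp (Primrec.const 2)
      (Primrec.succ.comp (Primrec.nat_mul.comp (Primrec.const 8) Primrec.id))) ?_
    exact Primrec.succ.comp (Primrec.succ.comp (Primrec.nat_add.comp Primrec.id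
      (Primrec.nat_mul.comp Primrec.id (Primrec.nat_mul.comp Primrec.id two))))
  exact primrec_pow.comp (two.comp hr) (Primrec.nat_mul.comp hr two)

end Net

/-! ## Reading the input -/

theorem length_flatMap_finRange {β : Type} {n m : ℕ} (f : Fin n → List β)
    (hf : ∀ u, (f u).length = m) : ((List.finRange n).flatMap f).length = n * m := by
  simp [List.length_flatMap, hf]

theorem getElem?_flatMap_finRange {β : Type} {n m : ℕ} (f : Fin n → List β)
    (hf : ∀ u, (f u).length = m) (u : Fin n) {j : ℕ} (hj : j < m) :
    ((List.finRange n).flatMap f)[(u : ℕ) * m + j]? = (f u)[j]? := by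
  induction n with
  | zero => exact u.elim0
  | succ n ih =>
    rw [List.finRange_succ, List.flatMap_cons, List.flatMap_map]
    cases u using Fin.cases with
    | zero =>
      rw [List.getElem?_append_left]
      · simp
      · simpa [hf] using hj
    | succ u =>
      have e : ((u.succ : Fin (n + 1)) : ℕ) * m + j = (u : ℕ) * m + j + m := by
        rw [Fin.val_succ]
        ring
      rw [List.getElem?_append_right (by rw [hf, e]; omega), hf, e, Nat.add_sub_cancel]
      exact ih (fun i => f i.succ) (fun i => hf i.succ) u

namespace CCMAR

variable (Γ : CCMAR)

/-- The cells of the input word. -/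
noncomputable def cell (i : ℕ) : ℕ := Γ.encode.getD i 0

open Classical in
theorem encode_eq : Γ.encode = Γ.n :: Γ.k ::
    ((List.finRange Γ.n).flatMap (fun u =>
      (List.finRange Γ.n).map fun v => if Γ.graph.edges.Adj u v then 1 else 0) ++
    ((List.finRange Γ.n).flatMap (fun u =>
      (List.finRange Γ.n).map fun v => if Γ.graph.arc u v then 1 else 0) ++
    (List.finRange Γ.k).flatMap (fun i => [(Γ.src i : ℕ), (Γ.dst i : ℕ)]))) := by
  simp [encode, List.append_assoc]

theorem length_encode : Γ.encode.length = 2 + Γ.n * Γ.n + Γ.n * Γ.n + Γ.k * 2 := by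
  classical
  rw [encode_eq, List.length_cons, List.length_cons, List.length_append, List.length_append,
    length_flatMap_finRange _ (m := Γ.n) (by simp), length_flatMap_finRange _ (m := Γ.n) (by simp),
    length_flatMap_finRange _ (m := 2) (by simp)]
  ring

theorem cell_zero : Γ.cell 0 = Γ.n := by simp [cell, encode_eq]

theorem cell_one : Γ.cell 1 = Γ.k := by simp [cell, encode_eq]

theorem row_lt {n u v : ℕ} (hu : u < n) (hv : v < n) : u * n + v < n * n := by
  calc u * n + v < u * n + n := by omega
    _ = (u + 1) * n := by ring
    _ ≤ n * n := Nat.mul_le_mul_right _ hu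

theorem cell_adj {u v : ℕ} (hu : u < Γ.n) (hv : v < Γ.n) :
    Γ.cell (u * Γ.n + v + 2) = ind (Γ.adjN u v) := by
  classical
  rw [cell, encode_eq, List.getD_cons_succ, List.getD_cons_succ, List.getD_eq_getElem?_getD,
    List.getElem?_append_left (by
      rw [length_flatMap_finRange _ (m := Γ.n) (by simp)]
      exact row_lt hu hv),
    getElem?_flatMap_finRange _ (m := Γ.n) (by simp) ⟨u, hu⟩ hv]
  simp [adjN, ind, hu, hv]

theorem cell_arc {u v : ℕ} (hu : u < Γ.n) (hv : v < Γ.n) :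
    Γ.cell (Γ.n * Γ.n + (u * Γ.n + v) + 2) = ind (Γ.arcN u v) := by
  classical
  have hl : ∀ f : Fin Γ.n → List ℕ, (∀ u, (f u).length = Γ.n) →
      ((List.finRange Γ.n).flatMap f).length = Γ.n * Γ.n := fun f => length_flatMap_finRange f
  rw [cell, encode_eq, List.getD_cons_succ, List.getD_cons_succ, List.getD_eq_getElem?_getD,
    List.getElem?_append_right (by rw [hl _ (by simp)]; omega), hl _ (by simp),
    Nat.add_sub_cancel_left,
    List.getElem?_append_left (by rw [hl _ (by simp)]; exact row_lt hu hv),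
    getElem?_flatMap_finRange _ (m := Γ.n) (by simp) ⟨u, hu⟩ hv]
  simp [arcN, ind, hu, hv]

theorem cell_terminal {i j : ℕ} (hi : i < Γ.k) (hj : j < 2) :
    Γ.cell (Γ.n * Γ.n + (Γ.n * Γ.n + (i * 2 + j)) + 2) =
      [(Γ.src ⟨i, hi⟩ : ℕ), (Γ.dst ⟨i, hi⟩ : ℕ)].getD j 0 := by
  classical
  have hl : ∀ f : Fin Γ.n → List ℕ, (∀ u, (f u).length = Γ.n) →
      ((List.finRange Γ.n).flatMap f).length = Γ.n * Γ.n := fun f => length_flatMap_finRange f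
  rw [cell, encode_eq, List.getD_cons_succ, List.getD_cons_succ, List.getD_eq_getElem?_getD,
    List.getElem?_append_right (by rw [hl _ (by simp)]; omega), hl _ (by simp),
    Nat.add_sub_cancel_left,
    List.getElem?_append_right (by rw [hl _ (by simp)]; omega), hl _ (by simp),
    Nat.add_sub_cancel_left,
    getElem?_flatMap_finRange _ (m := 2) (by simp) ⟨i, hi⟩ hj, List.getD_eq_getElem?_getD]

theorem cell_src {i : ℕ} (hi : i < Γ.k) :
    Γ.cell (Γ.n * Γ.n + (Γ.n * Γ.n + (i * 2 + 0)) + 2) = Γ.srcN i := by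
  rw [cell_terminal Γ hi (by omega)]
  simp [srcN, hi]

theorem cell_dst {i : ℕ} (hi : i < Γ.k) :
    Γ.cell (Γ.n * Γ.n + (Γ.n * Γ.n + (i * 2 + 1)) + 2) = Γ.dstN i := by
  rw [cell_terminal Γ hi (by omega)]
  simp [dstN, hi]

/-! ## The output -/

noncomputable def rowLen (i : ℕ) : ℕ := Γ.net.len Γ.net.cert (Γ.srcN i) + 1

noncomputable def item (i j : ℕ) : ℕ :=
  if j = 0 then Γ.net.len Γ.net.cert (Γ.srcN i)
  else Γ.net.entry Γ.net.cert (Γ.srcN i) (j - 1)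

noncomputable def offset (i : ℕ) : ℕ := ∑ i' ∈ Finset.range Γ.k, ind (i' < i) * Γ.rowLen i'

/-- The cells of the output word. -/
noncomputable def outAt (q : ℕ) : ℕ :=
  ∑ i ∈ Finset.range Γ.k, ∑ j ∈ Finset.range (Γ.net.ell + 2 + 1),
    ind (j < Γ.rowLen i ∧ Γ.offset i + j = q) * Γ.item i j

noncomputable def outLen : ℕ := ∑ i ∈ Finset.range Γ.k, Γ.rowLen i

/-- Exactly one position `j` in one block `i` lands on cell `q`, and the double sum picks it out. So
each output cell can be computed independently of the others. -/
theorem flatMap_range_eq (k J : ℕ) (l : ℕ → ℕ) (g : ℕ → ℕ → ℕ) (hl : ∀ i, l i ≤ J) :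
    (List.range k).flatMap (fun i => (List.range (l i)).map (g i)) =
      (List.range (∑ i ∈ Finset.range k, l i)).map fun q =>
        ∑ i ∈ Finset.range k, ∑ j ∈ Finset.range J,
          ind (j < l i ∧ ∑ i' ∈ Finset.range i, l i' + j = q) * g i j := by
  induction k with
  | zero => simp
  | succ k ih =>
    rw [List.range_succ, List.flatMap_append, ih, Finset.sum_range_succ, List.range_add,
      List.map_append]
    congr 1
    · refine List.map_congr_left fun q hq => ?_
      rw [List.mem_range] at hq
      rw [Finset.sum_range_succ, Nat.left_eq_add]
      refine Finset.sum_eq_zero fun j _ => ?_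
      rw [ind_of_not (by omega), zero_mul]
    · rw [List.flatMap_singleton, List.map_map]
      refine List.map_congr_left fun q hq => ?_
      rw [List.mem_range] at hq
      simp only [Function.comp]
      rw [Finset.sum_range_succ, Finset.sum_eq_zero, zero_add, Finset.sum_eq_single q]
      · rw [ind_of ⟨hq, rfl⟩, one_mul]
      · intro j _ hj
        rw [ind_of_not (by omega), zero_mul]
      · intro hq'
        have := hl k
        simp at hq'
        omega
      · intro i hi
        rw [Finset.mem_range] at hi
        refine Finset.sum_eq_zero fun j _ => ?_
        have h1 : ∑ i' ∈ Finset.range (i + 1), l i' ≤ ∑ i' ∈ Finset.range k, l i' :=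
          Finset.sum_le_sum_of_subset (Finset.range_subset_range.2 hi)
        rw [Finset.sum_range_succ] at h1
        rw [ind_of_not (by omega), zero_mul]

variable {Γ}

theorem rowLen_le (i : ℕ) : Γ.rowLen i ≤ Γ.net.ell + 2 + 1 := Nat.succ_le_succ (Net.len_le _ _)

theorem outLen_le : Γ.outLen ≤ Γ.k * (Γ.net.ell + 3) :=
  (Finset.sum_le_card_nsmul _ _ _ fun i _ => rowLen_le i).trans (by simp)

theorem encodeProfile_eq {P : Γ.Profile} (hd : Describes (Γ.net.path Γ.net.cert) P) :
    Γ.encodeProfile P = (List.range Γ.outLen).map Γ.outAt := by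
  have h1 : Γ.encodeProfile P =
      (List.range Γ.k).flatMap (fun i => (List.range (Γ.rowLen i)).map (Γ.item i)) := by
    rw [← List.map_coe_finRange_eq_range, List.flatMap_map]
    unfold encodeProfile
    congr 1
    funext i
    rw [← hd i]
    have hlen : (P i).length = Γ.net.len Γ.net.cert (Γ.src i) := by
      have := congrArg List.length (hd i)
      simpa [Net.path] using this.symm
    rw [hlen, rowLen, List.range_succ_eq_map, List.map_cons, List.map_map, srcN_val]
    congr 1
    · simp [item]
    · unfold Net.path
      refine List.map_congr_left fun q _ => ?_
      simp [item]
  rw [h1, flatMap_range_eq Γ.k (Γ.net.ell + 2 + 1) Γ.rowLen Γ.item rowLen_le]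
  refine List.map_congr_left fun q _ => ?_
  unfold outAt
  refine Finset.sum_congr rfl fun i hi => Finset.sum_congr rfl fun j _ => ?_
  have : ∑ i' ∈ Finset.range i, Γ.rowLen i' = Γ.offset i := by
    unfold offset
    rw [← Finset.sum_subset (Finset.range_subset_range.2 (Finset.mem_range.1 hi).le)]
    · refine Finset.sum_congr rfl fun i' hi' => ?_
      rw [ind_of (Finset.mem_range.1 hi'), one_mul]
    · intro i' _ hi'
      rw [ind_of_not (by simpa using hi'), zero_mul]
  rw [this]

end CCMAR

/-! ### Evaluating instance data and output cells by programs -/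

namespace RAM

open CCMAR

variable {α : Type} {Rep : α → (ℕ → ℕ → ℕ) → Prop} {Z : α → ℕ} {d : ℕ}

/-- The input word of an instance stands in array `0`. -/
structure Input (Rep : α → (ℕ → ℕ → ℕ) → Prop) (Z : α → ℕ) (G : α → CCMAR) : Prop where
  cell : ∀ a arr, Rep a arr → arr 0 = (G a).cell
  le : ∀ a, (2 * (G a).n + (G a).k + 4) * (2 * (G a).n + (G a).k + 4) ≤ Z a

namespace Input

variable {G : α → CCMAR} (h : Input Rep Z G) {u v : α → (ℕ → ℕ) → ℕ}
include h

theorem le' (a : α) : 2 * (G a).n + (G a).k + 4 ≤ Z a := (Nat.le_mul_self _).trans (h.le a)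

theorem n : Ev Rep Z d fun a _ => (G a).n :=
  Ev.read 0 (Ev.const 0) (fun a _ arr ha => by rw [h.cell a arr ha, cell_zero])
    fun _ _ _ _ => rfl

theorem k : Ev Rep Z d fun a _ => (G a).k :=
  Ev.read 0 (Ev.const 1) (fun a _ arr ha => by rw [h.cell a arr ha, cell_one])
    fun _ _ _ _ => rfl

theorem n_le (a : α) (_ : ℕ → ℕ) : (G a).n ≤ Z a := by
  have := h.le' a
  omega

theorem k_le (a : α) (_ : ℕ → ℕ) : (G a).k ≤ Z a := by
  have := h.le' a
  omega

theorem row (hu : Ev Rep Z d u) (hv : Ev Rep Z d v) :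
    Ev Rep Z d fun a ρ => u a ρ * (G a).n + v a ρ :=
  ((Ev.mul h.n h.n_le hu).congr fun _ _ => mul_comm _ _).add hv

theorem sq : Ev Rep Z d fun a _ => (G a).n * (G a).n := Ev.mul h.n h.n_le h.n

/-- The range test comes before the read, since an index out of range may address a cell with
another meaning. -/
theorem adj (hu : Ev Rep Z d u) (hv : Ev Rep Z d v) :
    EvP Rep Z d fun a ρ => (G a).adjN (u a ρ) (v a ρ) := by
  refine (Ev.readIf (y := fun a ρ => ind ((G a).adjN (u a ρ) (v a ρ))) 0
    ((EvP.lt hu h.n).and (EvP.lt hv h.n)) ((h.row hu hv).add (Ev.const 2))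
    (fun a ρ arr ha hb => ?_) fun a ρ ρ' hρ => ?_).congr fun a ρ => ?_
  · have hb' : u a ρ < (G a).n ∧ v a ρ < (G a).n := by
      by_contra hn
      exact hb (ind_of_not hn)
    rw [h.cell a arr ha, cell_adj _ hb'.1 hb'.2]
  · simp only [hu.1 a ρ ρ' hρ, hv.1 a ρ ρ' hρ]
  · by_cases hb : u a ρ < (G a).n ∧ v a ρ < (G a).n
    · rw [ind_of hb, if_pos one_ne_zero]
    · rw [ind_of_not hb, if_neg (by simp), ind_of_not fun ⟨hu, hv, _⟩ => hb ⟨hu, hv⟩]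

theorem arc (hu : Ev Rep Z d u) (hv : Ev Rep Z d v) :
    EvP Rep Z d fun a ρ => (G a).arcN (u a ρ) (v a ρ) := by
  refine (Ev.readIf (y := fun a ρ => ind ((G a).arcN (u a ρ) (v a ρ))) 0
    ((EvP.lt hu h.n).and (EvP.lt hv h.n)) ((h.sq.add (h.row hu hv)).add (Ev.const 2))
    (fun a ρ arr ha hb => ?_) fun a ρ ρ' hρ => ?_).congr fun a ρ => ?_
  · have hb' : u a ρ < (G a).n ∧ v a ρ < (G a).n := by
      by_contra hn
      exact hb (ind_of_not hn)
    rw [h.cell a arr ha, cell_arc _ hb'.1 hb'.2]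
  · simp only [hu.1 a ρ ρ' hρ, hv.1 a ρ ρ' hρ]
  · by_cases hb : u a ρ < (G a).n ∧ v a ρ < (G a).n
    · rw [ind_of hb, if_pos one_ne_zero]
    · rw [ind_of_not hb, if_neg (by simp), ind_of_not fun ⟨hu, hv, _⟩ => hb ⟨hu, hv⟩]

theorem terminal (hu : Ev Rep Z d u) (j : ℕ) : Ev Rep Z d fun a ρ =>
    (G a).n * (G a).n + ((G a).n * (G a).n + (u a ρ * 2 + j)) + 2 :=
  (h.sq.add (h.sq.add (((hu.add hu).congr fun _ _ => (mul_two _).symm).add (Ev.const j)))).add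
    (Ev.const 2)

theorem src (hu : Ev Rep Z d u) : Ev Rep Z d fun a ρ => (G a).srcN (u a ρ) := by
  refine (Ev.readIf (y := fun a ρ => (G a).srcN (u a ρ)) 0 (EvP.lt hu h.k) (h.terminal hu 0)
    (fun a ρ arr ha hb => ?_) fun a ρ ρ' hρ => ?_).congr fun a ρ => ?_
  · have hb' : u a ρ < (G a).k := by
      by_contra hn
      exact hb (ind_of_not hn)
    rw [h.cell a arr ha, cell_src _ hb']
  · simp only [hu.1 a ρ ρ' hρ]
  · by_cases hb : u a ρ < (G a).k
    · rw [ind_of hb, if_pos one_ne_zero]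
    · rw [ind_of_not hb, if_neg (by simp), srcN, dif_neg hb]

theorem dst (hu : Ev Rep Z d u) : Ev Rep Z d fun a ρ => (G a).dstN (u a ρ) := by
  refine (Ev.readIf (y := fun a ρ => (G a).dstN (u a ρ)) 0 (EvP.lt hu h.k) (h.terminal hu 1)
    (fun a ρ arr ha hb => ?_) fun a ρ ρ' hρ => ?_).congr fun a ρ => ?_
  · have hb' : u a ρ < (G a).k := by
      by_contra hn
      exact hb (ind_of_not hn)
    rw [h.cell a arr ha, cell_dst _ hb']
  · simp only [hu.1 a ρ ρ' hρ]
  · by_cases hb : u a ρ < (G a).k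
    · rw [ind_of hb, if_pos one_ne_zero]
    · rw [ind_of_not hb, if_neg (by simp), dstN, dif_neg hb]

theorem inp : Inp Rep Z fun a => (G a).net where
  n := h.n
  E hu hv := h.adj hu hv
  St hu hv := (EvP.eq hu hv).not.and ((h.adj hu hv).or (h.arc hu hv))
  rep hu := (EvP.lt hu h.n).and (EvP.ex h.k h.k_le fun _ hD _ hi =>
    (EvP.eq (h.dst hi) (hu.mono hD)).and (EvP.eq (h.src hi) (hu.mono hD)).not).not
  T hu := (Ev.sum h.k h.k_le fun _ hD _ hi =>
    (EvP.eq (h.src hi) (hu.mono hD)).indMul (h.dst hi)).add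
    ((EvP.ex h.k h.k_le fun _ hD _ hi => EvP.eq (h.src hi) (hu.mono hD)).not.indMul hu)
  le a := by
    have := h.le' a
    simp only [net_n]
    omega

end Input

/-- In addition, the powers of the base stand in array `3`. -/
structure InputPw (Rep : α → (ℕ → ℕ → ℕ) → Prop) (Z : α → ℕ) (G : α → CCMAR) : Prop
    extends Input Rep Z G where
  pw : ∀ a arr, Rep a arr → ∀ j < (G a).net.digits + 1, arr 3 j = (G a).net.pw j
  cert_le : ∀ a, (G a).net.numCert ≤ Z a

namespace InputPw

variable {G : α → CCMAR} (h : InputPw Rep Z G) {u v : α → (ℕ → ℕ) → ℕ}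
include h

theorem inpPw : InpPw Rep Z fun a => (G a).net where
  toInp := h.inp
  pw {d u} hu := by
    refine (Ev.readIf (y := fun a ρ => (G a).net.pw (u a ρ)) 3
      (EvP.lt hu (h.inp.digits.add (Ev.const 1))) hu (fun a ρ arr ha hb => ?_)
      fun a ρ ρ' hρ => ?_).congr fun a ρ => ?_
    · refine h.pw a arr ha _ ?_
      by_contra hn
      exact hb (ind_of_not hn)
    · simp only [hu.1 a ρ ρ' hρ]
    · by_cases hb : u a ρ < (G a).net.digits + 1
      · rw [ind_of hb, if_pos one_ne_zero]
      · rw [ind_of_not hb, if_neg (by simp), Net.pw, ind_of_not hb, zero_mul]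
  cert_le := h.cert_le

theorem rowLen (hu : Ev Rep Z d u) : Ev Rep Z d fun a ρ => (G a).rowLen (u a ρ) :=
  (h.inpPw.len h.inpPw.cert (h.src hu)).add (Ev.const 1)

theorem item (hu : Ev Rep Z d u) (hv : Ev Rep Z d v) :
    Ev Rep Z d fun a ρ => (G a).item (u a ρ) (v a ρ) :=
  Ev.ite (EvP.eq hv (Ev.const 0)) (h.inpPw.len h.inpPw.cert (h.src hu))
    (h.inpPw.entry h.inpPw.cert (h.src hu) (hv.sub (Ev.const 1)))

theorem offset (hu : Ev Rep Z d u) : Ev Rep Z d fun a ρ => (G a).offset (u a ρ) :=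
  Ev.sum h.k h.k_le fun _ hD _ hv => (EvP.lt hv (hu.mono hD)).indMul (h.rowLen hv)

theorem outAt (hu : Ev Rep Z d u) : Ev Rep Z d fun a ρ => (G a).outAt (u a ρ) :=
  Ev.sum h.k h.k_le fun _ hD _ hi =>
    Ev.sum (h.inpPw.ell_add_two.add (Ev.const 1))
      (fun a _ => by
        have h1 := h.le' a
        have h2 := Net.covNum_le (Γ := (G a).net)
        rw [net_n] at h2
        unfold Net.ell
        omega)
      fun _ hD₁ _ hj => ((EvP.lt hj (h.rowLen (hi.mono hD₁))).and
        (EvP.eq ((h.offset (hi.mono hD₁)).add hj) ((hu.mono hD).mono hD₁))).indMul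
          (h.item (hi.mono hD₁) hj)

theorem outLen : Ev Rep Z d fun a _ => (G a).outLen :=
  Ev.sum h.k h.k_le fun _ _ _ hi => h.rowLen hi

end InputPw

/-! ## The algorithm -/

/-- A bound for all loops of the algorithm. -/
noncomputable def sizeBound (Γ : CCMAR) : ℕ :=
  (2 * Γ.n + Γ.k + 4) * (2 * Γ.n + Γ.k + 4) + Γ.net.numCert

theorem digits_le (Γ : CCMAR) : Γ.net.digits + 1 ≤ sizeBound Γ := by
  have h1 : ∑ r ∈ Finset.range Γ.net.n, ind (Γ.net.Reader r) ≤ Γ.n :=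
    (Finset.sum_le_card_nsmul _ _ 1 fun _ _ => ind_le_one _).trans (by simp)
  have h2 := Net.covNum_le (Γ := Γ.net)
  rw [net_n] at h2
  have h3 : Γ.net.digits ≤ Γ.n * (2 * Γ.n + 1) :=
    Nat.mul_le_mul h1 (by unfold Net.ell; omega)
  unfold sizeBound
  nlinarith [Nat.zero_le (Γ.n * Γ.k), Nat.zero_le (Γ.k * Γ.k), Nat.zero_le (Γ.n * Γ.n)]

theorem outLen_le_sizeBound (Γ : CCMAR) : Γ.outLen ≤ sizeBound Γ := by
  have h1 := outLen_le (Γ := Γ)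
  have h2 := Net.covNum_le (Γ := Γ.net)
  rw [net_n] at h2
  have h3 : Γ.k * (Γ.net.ell + 3) ≤ (2 * Γ.n + Γ.k + 4) * (2 * Γ.n + Γ.k + 4) :=
    Nat.mul_le_mul (by omega) (by unfold Net.ell; omega)
  unfold sizeBound
  omega

/-- Each power is `base` times the preceding table entry, by repeated addition; array `5` holds the
counter. -/
theorem exists_fill_pw : ∃ p C, ∀ (Γ : CCMAR) s, s.arr 0 = Γ.cell →
    Runs p s ((sizeBound Γ + 2) ^ C) fun s' =>
      s'.arr 0 = Γ.cell ∧ ∀ j < Γ.net.digits + 1, s'.arr 3 j = Γ.net.pw j := by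
  have h₀ : Input (fun Γ arr => arr 0 = Γ.cell) sizeBound fun Γ => Γ :=
    ⟨fun _ _ h => h, fun Γ => Nat.le_add_right _ _⟩
  refine exists_fill (A := 3) (B := 5) (by decide) (Rep := fun Γ arr => arr 0 = Γ.cell)
    (f := fun Γ j => Γ.net.pw j)
    (fun Γ arr arr' ha e => by rw [e 0 (by decide) (by decide), ha])
    (h₀.inp.digits.add (Ev.const 1)) digits_le ?_
  set Rep : CCMAR × ℕ → (ℕ → ℕ → ℕ) → Prop := fun q arr => arr 0 = q.1.cell ∧
    q.2 < q.1.net.digits + 1 ∧ arr 5 0 = q.2 ∧ ∀ j < q.2, arr 3 j = q.1.net.pw j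
  have h : Input Rep (fun q => sizeBound q.1) Prod.fst :=
    ⟨fun _ _ h => h.1, fun q => Nat.le_add_right _ _⟩
  have hi : Ev Rep (fun q => sizeBound q.1) 0 fun q _ => q.2 :=
    Ev.read 5 (Ev.const 0) (fun _ _ _ h => h.2.2.1) fun _ _ _ _ => rfl
  have hprev : Ev Rep (fun q => sizeBound q.1) 0 fun q _ =>
      if ind (0 < q.2) ≠ 0 then q.1.net.pw (q.2 - 1) else 0 :=
    Ev.readIf 3 (EvP.lt (Ev.const 0) hi) (hi.sub (Ev.const 1)) (fun q _ arr ha hb => by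
      refine ha.2.2.2 _ ?_
      by_contra hn
      exact hb (ind_of_not (by omega))) fun _ _ _ _ => rfl
  refine (((EvP.lt hi (h.inp.digits.add (Ev.const 1))).indMul (Ev.ite (EvP.eq hi (Ev.const 0))
    (Ev.const 1) (Ev.mul h.inp.base h.inp.base_le hprev)))).congr fun q _ => ?_
  obtain ⟨Γ, j⟩ := q
  simp only [Net.pw]
  by_cases hj : j < Γ.net.digits + 1
  · rw [ind_of hj, one_mul, one_mul]
    cases j with
    | zero => simp
    | succ j =>
      rw [ind_of (Nat.succ_pos j), if_neg (Nat.succ_ne_zero j), if_pos one_ne_zero,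
        Nat.add_sub_cancel, ind_of (by omega), one_mul, pow_succ, mul_comm]
  · rw [ind_of_not hj, zero_mul, zero_mul]

/-- The output length is put into register `1` last, because filling the array uses that register as
scratch space. -/
theorem exists_fill_out : ∃ p C, ∀ (Γ : CCMAR) s,
    (s.arr 0 = Γ.cell ∧ ∀ j < Γ.net.digits + 1, s.arr 3 j = Γ.net.pw j) →
    Runs p s ((sizeBound Γ + 2) ^ C) fun s' =>
      (∀ q < Γ.outLen, s'.arr 1 q = Γ.outAt q) ∧ s'.reg 1 = Γ.outLen := by
  set Rep : CCMAR → (ℕ → ℕ → ℕ) → Prop := fun Γ arr => arr 0 = Γ.cell ∧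
    ∀ j < Γ.net.digits + 1, arr 3 j = Γ.net.pw j
  have h : InputPw Rep sizeBound fun Γ => Γ :=
    ⟨⟨fun _ _ h => h.1, fun Γ => Nat.le_add_right _ _⟩, fun _ _ h => h.2,
      fun Γ => Nat.le_add_left _ _⟩
  obtain ⟨p, C, hp⟩ := exists_fill (A := 1) (B := 5) (by decide) (Rep := Rep) (Z := sizeBound)
    (m := fun Γ => Γ.outLen) (f := fun Γ q => Γ.outAt q)
    (fun Γ arr arr' ha e => by
      refine ⟨by rw [e 0 (by decide) (by decide), ha.1], fun j hj => ?_⟩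
      rw [e 3 (by decide) (by decide), ha.2 j hj])
    h.outLen outLen_le_sizeBound (by
      set Rep' : CCMAR × ℕ → (ℕ → ℕ → ℕ) → Prop := fun q arr => Rep q.1 arr ∧
        q.2 < q.1.outLen ∧ arr 5 0 = q.2 ∧ ∀ j < q.2, arr 1 j = q.1.outAt j
      have h' : InputPw Rep' (fun q => sizeBound q.1) Prod.fst :=
        ⟨⟨fun _ _ h => h.1.1, fun q => Nat.le_add_right _ _⟩, fun _ _ h => h.1.2,
          fun q => Nat.le_add_left _ _⟩
      exact h'.outAt (Ev.read 5 (Ev.const 0) (fun _ _ _ h => h.2.2.1) fun _ _ _ _ => rfl))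
  obtain ⟨q, D, hq⟩ := (h.outLen (d := 0)).2 1 (by omega)
  refine ⟨.seq p q, C + D + 1, fun Γ s hs => ?_⟩
  refine ((hp Γ s hs).seq fun s' h' => (hq Γ s' h'.1).mono le_rfl fun s'' h'' => ?_).mono
    (add_le_pow_add_two le_rfl le_rfl) fun _ h => h
  exact ⟨fun j hj => by rw [h''.1, h'.2 j hj], h''.2.1⟩

end RAM

/-! ### The time bound in terms of the parameter and the input length -/

namespace CCMAR

/-- The base `2 * n + k + 4` of the square is at most twice the input length, which gives `4` of the
`6`; the added `2` gives the rest. -/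
theorem sizeBound_le {Γ : CCMAR} (hΓ : Γ.NoOverlap) : RAM.sizeBound Γ + 2 ≤
    (Net.certBound (Γ.graph.vc + Γ.graph.vc * Γ.graph.vc) + 6) * Γ.encode.length ^ 2 := by
  have h1 := (Net.numCert_le (net_ok hΓ)).trans (Net.certBound_mono (covNum_le_vc (Γ := Γ)))
  set F := Net.certBound (Γ.graph.vc + Γ.graph.vc * Γ.graph.vc)
  have hn := Nat.le_mul_self Γ.n
  have h2 : 2 * Γ.n + Γ.k + 4 ≤ 2 * Γ.encode.length := by
    rw [length_encode]
    omega
  have h3 : 1 ≤ Γ.encode.length := by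
    rw [length_encode]
    omega
  have h4 := Nat.mul_le_mul h2 h2
  have h5 : 1 ≤ Γ.encode.length * Γ.encode.length := Nat.mul_le_mul h3 h3
  unfold RAM.sizeBound
  nlinarith [Nat.mul_le_mul_left F h5]

theorem computable_timeBound (C : ℕ) :
    Computable fun v : ℕ => (Net.certBound (v + v * v) + 6) ^ C := by
  refine Primrec.to_comp (Net.primrec_pow.comp (Primrec.nat_add.comp
    (Net.primrec_certBound.comp ?_) (Primrec.const 6)) (Primrec.const C))
  exact Primrec.nat_add.comp Primrec.id (Primrec.nat_mul.comp Primrec.id Primrec.id)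

end CCMAR

theorem mainTheorem7 :
    SolvableInFPTTime CCMAR.encode CCMAR.encodeProfile (fun Γ : CCMAR => Γ.graph.vc)
      (fun Γ => Γ.Feasible ∧ Γ.NoOverlap) CCMAR.IsOptimal := by
  obtain ⟨p, C, hp⟩ := RAM.exists_fill_pw
  obtain ⟨q, D, hq⟩ := RAM.exists_fill_out
  -- The two programs together take at most the power `C + D + 1` of `sizeBound Γ + 2`, and this
  -- base is quadratic in the input length.
  refine ⟨.seq p q, _, 2 * (C + D + 1), CCMAR.computable_timeBound (C + D + 1),
    fun Γ ⟨⟨P₀, hP₀⟩, hΓ⟩ => ?_⟩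
  obtain ⟨Q₀, hQ₀, -⟩ := CCMAR.exists_describes hΓ hP₀
  have hopt := Net.opt_cert (CCMAR.net_ok hΓ) ⟨Q₀, hQ₀⟩
  obtain ⟨P, hP⟩ := CCMAR.exists_profile hΓ hopt.1
  have hinit : (RAM.State.init Γ.encode).arr 0 = Γ.cell := by
    funext i
    simp [RAM.State.init, CCMAR.cell]
  obtain ⟨t, s, he, ht, hs⟩ := ((hp Γ _ hinit).seq (hq Γ)).mono
    (RAM.add_le_pow_add_two le_rfl le_rfl) fun _ h => h
  refine ⟨t, s, P, he, ht.trans ?_, ?_, CCMAR.isOptimal_of_opt hΓ hP hopt⟩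
  · rw [pow_mul, ← mul_pow]
    exact Nat.pow_le_pow_left (CCMAR.sizeBound_le hΓ) _
  · rw [CCMAR.encodeProfile_eq hP, RAM.State.output, hs.2]
    exact List.map_congr_left fun j hj => hs.1 j (List.mem_range.1 hj)
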